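/- Let $n\ge 2$, $\frac{2n}{n+2}<g_0\le g_1<\infty$ and $0<\nu\le 1\le L$. There is a constant $\sigma=\sigma(n,g_0,g_1,\nu,L)\in(0,1)$ with the following property. Let $g:(0,\infty)\to(0,\infty)$ be $C^1$ with $g_0-1\le \frac{s\,g'(s)}{g(s)}\le g_1-1$ for all $s>0$, and put $G(s)=\int_0^s g(r)\,dr$. Let $\mathcal A:\mathbb R^n\to\mathbb R^n$ be continuous, and $C^1$ on $\mathbb R^n\setminus\{0\}$, with $$\langle D\mathcal A(\xi)\zeta,\zeta\rangle\ge \nu\,\frac{g(|\xi|)}{|\xi|}\,|\zeta|^2,\qquad |D\mathcal A(\xi)|\le L\,\frac{g(|\xi|)}{|\xi|}\qquad\text{for all }\xi\in\mathbb R^n\setminus\{0\},\ \zeta\in\mathbb R^n .$$ Let $\Omega\subset\mathbb R^n$ be a bounded domain, $T>0$, $\Omega_T=\Omega\times(0,T)$, and let $u\ge 0$ (a.e.) be a weak subsolution of $\partial_t u-\operatorname{div}\mathcal A(Du)=0$ in $\Omega_T$. This means: on every cylinder $D\times(t_1,t_2)$ with $D$ open, $\overline D\subset\Omega$ compact and $0<t_1<t_2<T$,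 one has $u\in L^\infty(t_1,t_2;L^2(D))\cap L^1(t_1,t_2;W^{1,1}(D))$ and $\int_{t_1}^{t_2}\!\int_D \big(G(|u|)+G(|Du|)\big)\,dx\,dt<\infty$, where $Du$ is the weak spatial gradient; and $$-\int_{\Omega_T}u\,\partial_t\eta\,dx\,dt+\int_{\Omega_T}\mathcal A(Du)\cdot D\eta\,dx\,dt\le 0\qquad\text{for every nonnegative }\eta\in C_c^\infty(\Omega_T).$$ Let $(x_0,t_0)\in\Omega_T$, let $k,\rho,\theta>0$ satisfy $\theta=k^2/G(k/\rho)$, and write $Q(r,\tau)=B_r(x_0)\times(t_0-\tau,t_0)$. Suppose that $\overline{B_\rho(x_0)}\subset\Omega$ and $t_0-\theta>0$. If $$\frac1{|Q(\rho,\theta)|}\int_{Q(\rho,\theta)}\Big(G\Big(\frac u\rho\Big)+\frac{u^2}{\theta}\Big)\,dx\,dt\le\sigma\,G\Big(\frac k\rho\Big),$$ then $$\operatorname*{ess\,sup}_{Q(\rho/2,\theta/2)}u\le k .$$ -/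

import Mathlib

open MeasureTheory Set
open scoped ContDiff

noncomputable section

namespace ParabolicOrlicz

/-- `G(s) = ∫₀ˢ g(r) dr`. Only the values of `g` on `(0,∞)` matter for `s ≥ 0`. -/
def primitive (g : ℝ → ℝ) (s : ℝ) : ℝ := ∫ r in (0 : ℝ)..s, g r

/-- `g` is positive and `C¹` on `(0,∞)` with `g₀ - 1 ≤ s g'(s) / g(s) ≤ g₁ - 1` for all `s > 0`. -/
structure OrliczCondition (g₀ g₁ : ℝ) (g : ℝ → ℝ) : Prop where
  contDiffOn : ContDiffOn ℝ 1 g (Ioi 0)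
  pos : ∀ s : ℝ, 0 < s → 0 < g s
  lower : ∀ s : ℝ, 0 < s → g₀ - 1 ≤ s * deriv g s / g s
  upper : ∀ s : ℝ, 0 < s → s * deriv g s / g s ≤ g₁ - 1

/-- The structural conditions on the vector field `𝒜`, with constants `ν`, `L`. As in the model case
`𝒜(ξ) = |ξ|^(p-2) ξ` with `p < 2`, continuous differentiability is required away from the origin
only; at the origin `𝒜` is merely continuous. -/
structure StructureCondition {n : ℕ} (ν L : ℝ) (g : ℝ → ℝ)
    (A : EuclideanSpace ℝ (Fin n) → EuclideanSpace ℝ (Fin n)) : Prop where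
  continuous : Continuous A
  contDiffOn : ContDiffOn ℝ 1 A {0}ᶜ
  elliptic : ∀ ξ : EuclideanSpace ℝ (Fin n), ξ ≠ 0 → ∀ ζ : EuclideanSpace ℝ (Fin n),
    ν * (g ‖ξ‖ / ‖ξ‖) * ‖ζ‖ ^ 2 ≤ inner ℝ (fderiv ℝ A ξ ζ) ζ
  bounded : ∀ ξ : EuclideanSpace ℝ (Fin n), ξ ≠ 0 → ‖fderiv ℝ A ξ‖ ≤ L * (g ‖ξ‖ / ‖ξ‖)

/-- `f` belongs to the Orlicz space `L^G(S)`, where `G` is the primitive of `g`. -/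
def MemOrlicz {X F : Type*} [MeasureSpace X] [NormedAddCommGroup F]
    (g : ℝ → ℝ) (S : Set X) (f : X → F) : Prop :=
  AEStronglyMeasurable f (volume.restrict S) ∧
    IntegrableOn (fun z => primitive g ‖f z‖) S

/-- `η ∈ C_c^∞(U)`. -/
def IsTestFunction {F : Type*} [NormedAddCommGroup F] [NormedSpace ℝ F]
    (U : Set F) (η : F → ℝ) : Prop :=
  ContDiff ℝ ∞ η ∧ HasCompactSupport η ∧ tsupport η ⊆ U

/-- `w` is a weak gradient of `v` in `D`. -/
def HasWeakGradient {n : ℕ} (D : Set (EuclideanSpace ℝ (Fin n)))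
    (v : EuclideanSpace ℝ (Fin n) → ℝ)
    (w : EuclideanSpace ℝ (Fin n) → EuclideanSpace ℝ (Fin n)) : Prop :=
  ∀ φ : EuclideanSpace ℝ (Fin n) → ℝ, IsTestFunction D φ →
    ∫ x in D, v x • gradient φ x = -∫ x in D, φ x • w x

/-- `u ∈ V^{2,G}(D × I)` with weak spatial gradient `Du`, that is,
`u ∈ L^∞(I; L²(D)) ∩ L^G(D × I) ∩ L¹(I; W^{1,1}(D))` and `Du ∈ L^G(D × I)`. -/
structure MemV2G {n : ℕ} (g : ℝ → ℝ) (D : Set (EuclideanSpace ℝ (Fin n))) (I : Set ℝ)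
    (u : EuclideanSpace ℝ (Fin n) × ℝ → ℝ)
    (Du : EuclideanSpace ℝ (Fin n) × ℝ → EuclideanSpace ℝ (Fin n)) : Prop where
  memOrlicz : MemOrlicz g (D ×ˢ I) u
  memOrlicz_grad : MemOrlicz g (D ×ˢ I) Du
  integrable : IntegrableOn u (D ×ˢ I)
  integrable_grad : IntegrableOn Du (D ×ˢ I)
  weakGradient : ∀ᵐ t ∂(volume.restrict I),
    HasWeakGradient D (fun x => u (x, t)) (fun x => Du (x, t))
  bounded_L2 : ∃ M : NNReal, ∀ᵐ t ∂(volume.restrict I),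
    eLpNorm (fun x => u (x, t)) 2 (volume.restrict D) ≤ M

/-- `u ∈ V^{2,G}_loc(Ω × (0,T))` with weak spatial gradient `Du`: membership on every cylinder
`D × (t₁,t₂)` whose closure is a compact subset of `Ω × (0,T)`. -/
def MemV2GLoc {n : ℕ} (g : ℝ → ℝ) (Ω : Set (EuclideanSpace ℝ (Fin n))) (T : ℝ)
    (u : EuclideanSpace ℝ (Fin n) × ℝ → ℝ)
    (Du : EuclideanSpace ℝ (Fin n) × ℝ → EuclideanSpace ℝ (Fin n)) : Prop :=
  ∀ (D : Set (EuclideanSpace ℝ (Fin n))) (t₁ t₂ : ℝ), IsOpen D → IsCompact (closure D) →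
    closure D ⊆ Ω → 0 < t₁ → t₁ < t₂ → t₂ < T → MemV2G g D (Ioo t₁ t₂) u Du

/-- `u` is a weak subsolution of `∂ₜu - div 𝒜(Du) = 0` in `Ω × (0,T)`. -/
def IsWeakSubsolution {n : ℕ} (g : ℝ → ℝ)
    (A : EuclideanSpace ℝ (Fin n) → EuclideanSpace ℝ (Fin n))
    (Ω : Set (EuclideanSpace ℝ (Fin n))) (T : ℝ)
    (u : EuclideanSpace ℝ (Fin n) × ℝ → ℝ) : Prop :=
  ∃ Du : EuclideanSpace ℝ (Fin n) × ℝ → EuclideanSpace ℝ (Fin n),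
    MemV2GLoc g Ω T u Du ∧
    ∀ η : EuclideanSpace ℝ (Fin n) × ℝ → ℝ, IsTestFunction (Ω ×ˢ Ioo 0 T) η → (∀ z, 0 ≤ η z) →
      -(∫ z in Ω ×ˢ Ioo 0 T, u z * deriv (fun s => η (z.1, s)) z.2)
        + ∫ z in Ω ×ˢ Ioo 0 T, inner ℝ (A (Du z)) (gradient (fun y => η (y, z.2)) z.1) ≤ 0

/-- The backward cylinder `B_ρ(x₀) × (t₀ - θ, t₀)`. -/
def cylinder {n : ℕ} (x₀ : EuclideanSpace ℝ (Fin n)) (t₀ ρ θ : ℝ) :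
    Set (EuclideanSpace ℝ (Fin n) × ℝ) :=
  Metric.ball x₀ ρ ×ˢ Ioo (t₀ - θ) t₀

end ParabolicOrlicz

end

namespace ParabolicOrlicz
open Filter Topology

/-! ### Power comparison -/

/-! The proof is a De Giorgi iteration over shrinking cylinders and rising levels κ, measured by the
density G((u-κ)₊/ρ) + (u-κ)₊²/θ (`excess`). The relation θ = k²/G(k/ρ) balances its two terms at
height k.

Each step combines two estimates. The energy inequality is tested with a truncation of u times a
spatial cutoff, with a time weight vanishing at the bottom of the cylinder. The excess then bounds
the slice integrals of the squared truncation and the integral of G(|Du|) above the level. A Sobolev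
inequality on time slices, applied to G^(1/p) of the truncation and combined with Hölder, turns this
into a bound by the power 1 + p/n of the excess (`integral_excess_le`). Here 2n/(n+2) < p < min(g₀,
2). The bound p < g₀ makes G^(1/p) a C¹ function, p < 2 ≤ n makes Sobolev available, and the lower
bound gives p + 2p/n ≥ 2, so that the gained integrability controls the quadratic part of the excess
as well as the G part (`excess_mul_le_gainDensity`). The superlinear power beats the geometric
growth of the constants once the initial excess is small (`tendsto_zero_of_fast_decay`); this
smallness is what σ encodes.

A weak subsolution has no time derivative, so u cannot enter a test function directly. The weak
inequality is linear in the pair (u, flux), hence mollification in space-time gives C¹ functions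
with ∂ₜuₘ ≤ div Fₘ pointwise (`mollify_subsolution`). Since Fₘ is not 𝒜(Duₘ), ellipticity and growth
are invoked only after m → ∞, for the flux 𝒜(Du) - 𝒜(0) (`energyDensity_le`, `energy_bounds`);
subtracting 𝒜(0), which need not vanish, does not change the divergence. The limit is justified by
dominating functions that are mollifications of one integrable M: they control all products that
occur, by Jensen and Young, and converge in L¹ by Scheffé (`exists_smoothApprox`,
`tendsto_integral_abs_sub_of_dominated`). The slice estimate is kept at the level of uₘ, at every
time and with an error tending to zero; Fatou is applied only to the final space-time integral, so
no continuity of u in time is needed. -/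

theorem mul_rpow_le_mul_rpow_of_le_deriv {f f' : ℝ → ℝ} {β : ℝ}
    (hf : ∀ s, 0 < s → HasDerivAt f (f' s) s) (h : ∀ s, 0 < s → β * f s ≤ s * f' s)
    {r s : ℝ} (hr : 0 < r) (hrs : r ≤ s) : f r * s ^ β ≤ f s * r ^ β := by
  have hd : ∀ x : ℝ, 0 < x → HasDerivAt (fun x => f x * x ^ (-β))
      (f' x * x ^ (-β) + f x * (-β * x ^ (-β - 1))) x := fun x hx =>
    (hf x hx).mul (Real.hasDerivAt_rpow_const (Or.inl hx.ne'))
  -- The differential inequality says precisely that f(x) x^(-β) has nonnegative derivative.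
  have hmono : MonotoneOn (fun x => f x * x ^ (-β)) (Ioi 0) := by
    apply monotoneOn_of_deriv_nonneg (convex_Ioi 0)
    · exact fun x hx => (hd x hx).continuousAt.continuousWithinAt
    · rw [interior_Ioi]
      exact fun x hx => (hd x hx).differentiableAt.differentiableWithinAt
    · rw [interior_Ioi]
      intro x hx
      have hx' : 0 < x := hx
      rw [(hd x hx).deriv]
      have e : x ^ (-β) = x ^ (-β - 1) * x := by
        rw [← Real.rpow_add_one hx'.ne']; congr 1; ring
      rw [e]
      have : 0 ≤ x ^ (-β - 1) * (x * f' x - β * f x) :=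
        mul_nonneg (Real.rpow_nonneg hx'.le _) (by linarith [h x hx'])
      linarith
  have hs : 0 < s := hr.trans_le hrs
  have := hmono hr hs hrs
  simp only [Real.rpow_neg hr.le, Real.rpow_neg hs.le, ← div_eq_mul_inv] at this
  rwa [div_le_div_iff₀ (Real.rpow_pos_of_pos hr _) (Real.rpow_pos_of_pos hs _)] at this

theorem mul_rpow_le_mul_rpow_of_deriv_le {f f' : ℝ → ℝ} {β : ℝ}
    (hf : ∀ s, 0 < s → HasDerivAt f (f' s) s) (h : ∀ s, 0 < s → s * f' s ≤ β * f s)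
    {r s : ℝ} (hr : 0 < r) (hrs : r ≤ s) : f s * r ^ β ≤ f r * s ^ β := by
  have := mul_rpow_le_mul_rpow_of_le_deriv (f := fun x => -f x) (f' := fun x => -f' x) (β := β)
    (fun s hs => (hf s hs).neg) (fun s hs => by linarith [h s hs]) hr hrs
  linarith

/-! ### Growth functions -/

/-- The extension of `g` by zero to `(-∞,0]`. -/
noncomputable def extZero (g : ℝ → ℝ) (s : ℝ) : ℝ := if 0 < s then g s else 0

/-- `G` is a Young function with derivative `g`, both vanishing on `(-∞,0]`, whose growth lies
between the powers `g₀` and `g₁`. -/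
structure YoungPair (g₀ g₁ : ℝ) (g G : ℝ → ℝ) : Prop where
  hasDerivAt : ∀ s, HasDerivAt G (g s) s
  continuous : Continuous g
  monotone : Monotone g
  pos : ∀ s, 0 < s → 0 < g s
  zero_of_nonpos : ∀ s, s ≤ 0 → g s = 0
  prim_zero_of_nonpos : ∀ s, s ≤ 0 → G s = 0
  lower : ∀ s, g₀ * G s ≤ s * g s
  upper : ∀ s, s * g s ≤ g₁ * G s
  rpow_lower : ∀ r s, 0 < r → r ≤ s → g r * s ^ (g₀ - 1) ≤ g s * r ^ (g₀ - 1)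

theorem OrliczCondition.hasDerivAt {g₀ g₁ : ℝ} {g : ℝ → ℝ} (h : OrliczCondition g₀ g₁ g)
    {s : ℝ} (hs : 0 < s) : HasDerivAt g (deriv g s) s :=
  ((h.contDiffOn.differentiableOn one_ne_zero).differentiableAt (Ioi_mem_nhds hs)).hasDerivAt

theorem primitive_extZero {g : ℝ → ℝ} {s : ℝ} (hs : 0 ≤ s) :
    primitive (extZero g) s = primitive g s := by
  unfold primitive
  apply intervalIntegral.integral_congr_ae
  refine Eventually.of_forall fun x hx => ?_
  rw [uIoc_of_le hs] at hx
  simp [extZero, hx.1]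

theorem OrliczCondition.youngPair {g₀ g₁ : ℝ} {g : ℝ → ℝ} (h : OrliczCondition g₀ g₁ g)
    (h1 : 1 < g₀) : YoungPair g₀ g₁ (extZero g) (primitive (extZero g)) := by
  have hlow : ∀ s, 0 < s → (g₀ - 1) * g s ≤ s * deriv g s := fun s hs =>
    (le_div_iff₀ (h.pos s hs)).1 (h.lower s hs)
  have hup : ∀ s, 0 < s → s * deriv g s ≤ (g₁ - 1) * g s := fun s hs =>
    (div_le_iff₀ (h.pos s hs)).1 (h.upper s hs)
  have hpow : ∀ r s, 0 < r → r ≤ s → g r * s ^ (g₀ - 1) ≤ g s * r ^ (g₀ - 1) := fun r s hr hrs =>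
    mul_rpow_le_mul_rpow_of_le_deriv (fun s hs => h.hasDerivAt hs) hlow hr hrs
  have hmono : Monotone (extZero g) := by
    intro r s hrs
    unfold extZero
    by_cases hr : 0 < r
    · have hs : 0 < s := hr.trans_le hrs
      simp only [hr, hs, if_true]
      have h2 := hpow r s hr hrs
      have h3 : r ^ (g₀ - 1) ≤ s ^ (g₀ - 1) := Real.rpow_le_rpow hr.le hrs (by linarith)
      have h4 : g s * r ^ (g₀ - 1) ≤ g s * s ^ (g₀ - 1) :=
        mul_le_mul_of_nonneg_left h3 (h.pos s hs).le
      exact le_of_mul_le_mul_right (h2.trans h4) (Real.rpow_pos_of_pos hs _)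
    · simp only [hr, if_false]
      split_ifs with hs
      · exact (h.pos s hs).le
      · exact le_rfl
  have hcont : Continuous (extZero g) := by
    rw [continuous_iff_continuousAt]
    intro s
    rcases lt_trichotomy s 0 with hs | rfl | hs
    · have : extZero g =ᶠ[𝓝 s] fun _ => 0 := by
        filter_upwards [Iio_mem_nhds hs] with x hx
        simp [extZero, not_lt.2 (le_of_lt (mem_Iio.1 hx))]
      exact continuousAt_const.congr this.symm
    -- Comparison with the value at 1; since g₀ > 1, the right side tends to 0 at the origin.
    · have hb : ∀ᶠ x in 𝓝 (0 : ℝ), extZero g x ≤ g 1 * |x| ^ (g₀ - 1) := by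
        filter_upwards [Iio_mem_nhds (zero_lt_one (α := ℝ))] with x hx
        unfold extZero
        split_ifs with hx0
        · rw [abs_of_pos hx0]
          have := hpow x 1 hx0 (le_of_lt hx)
          rwa [Real.one_rpow, mul_one] at this
        · exact mul_nonneg (h.pos 1 one_pos).le (Real.rpow_nonneg (abs_nonneg _) _)
      have hz : extZero g 0 = 0 := by simp [extZero]
      unfold ContinuousAt
      rw [hz]
      refine tendsto_of_tendsto_of_tendsto_of_le_of_le' tendsto_const_nhds ?_
        (Eventually.of_forall fun x => ?_) hb
      · have : ContinuousAt (fun x : ℝ => g 1 * |x| ^ (g₀ - 1)) 0 := by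
          refine continuousAt_const.mul ?_
          exact (continuous_abs.continuousAt).rpow_const (Or.inr (by linarith))
        simpa [ContinuousAt, Real.zero_rpow (by linarith : g₀ - 1 ≠ 0)] using this
      · show 0 ≤ extZero g x
        unfold extZero
        split_ifs with hx0
        · exact (h.pos _ hx0).le
        · exact le_rfl
    · have : extZero g =ᶠ[𝓝 s] g := by
        filter_upwards [Ioi_mem_nhds hs] with x hx
        have : 0 < x := hx
        simp [extZero, this]
      exact (h.hasDerivAt hs).continuousAt.congr this.symm
  have hprim : ∀ s, HasDerivAt (primitive (extZero g)) (extZero g s) s := fun s =>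
    intervalIntegral.integral_hasDerivAt_right (hcont.intervalIntegrable _ _)
      (hcont.stronglyMeasurableAtFilter _ _) hcont.continuousAt
  have hz : ∀ s, s ≤ 0 → extZero g s = 0 := fun s hs => by simp [extZero, not_lt.2 hs]
  have hpz : ∀ s, s ≤ 0 → primitive (extZero g) s = 0 := fun s hs => by
    unfold primitive
    rw [intervalIntegral.integral_symm, neg_eq_zero]
    rw [intervalIntegral.integral_congr (g := fun _ => (0 : ℝ))]
    · simp
    · intro x hx
      rw [uIcc_of_le hs] at hx
      exact hz x hx.2
  have hd : ∀ s, 0 < s → HasDerivAt (fun s => s * extZero g s) (g s + s * deriv g s) s := by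
    intro s hs
    have : (fun s => s * extZero g s) =ᶠ[𝓝 s] fun s => s * g s := by
      filter_upwards [Ioi_mem_nhds hs] with x hx
      have : 0 < x := hx
      simp [extZero, this]
    refine HasDerivAt.congr_of_eventuallyEq ?_ this
    have := (hasDerivAt_id s).mul (h.hasDerivAt hs)
    simp only [id, one_mul] at this
    exact this
  have hge : ∀ s, 0 < s → extZero g s = g s := fun s hs => by simp [extZero, hs]
  -- With ε = 1 and ε = -1 this treats the two comparisons of s g(s) with G(s) together: the
  -- difference vanishes at 0 and its derivative has a sign.
  have key : ∀ c ε : ℝ, (∀ s, 0 < s → 0 ≤ ε * (g s + s * deriv g s - c * g s)) →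
      ∀ s, 0 < s → 0 ≤ ε * (s * extZero g s - c * primitive (extZero g) s) := by
    intro c ε hc s hs
    have hm : MonotoneOn (fun s => ε * (s * extZero g s - c * primitive (extZero g) s)) (Ici 0) := by
      have hdd : ∀ s, 0 < s → HasDerivAt
          (fun s => ε * (s * extZero g s - c * primitive (extZero g) s))
          (ε * (g s + s * deriv g s - c * g s)) s := fun s hs => by
        have := ((hd s hs).sub ((hprim s).const_mul c)).const_mul ε
        rwa [hge s hs] at this
      apply monotoneOn_of_deriv_nonneg (convex_Ici 0)
      · have : Continuous (primitive (extZero g)) :=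
          continuous_iff_continuousAt.2 fun s => (hprim s).continuousAt
        exact (continuous_const.mul ((continuous_id.mul hcont).sub
          (continuous_const.mul this))).continuousOn
      · rw [interior_Ici]
        exact fun x hx => (hdd x hx).differentiableAt.differentiableWithinAt
      · rw [interior_Ici]
        intro x hx
        rw [(hdd x hx).deriv]
        exact hc x hx
    have := hm (mem_Ici.2 le_rfl) (mem_Ici.2 hs.le) hs.le
    simpa [hpz 0 le_rfl] using this
  refine ⟨hprim, hcont, hmono, fun s hs => by rw [hge s hs]; exact h.pos s hs, hz, hpz, ?_, ?_, ?_⟩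
  · intro s
    rcases le_or_gt s 0 with hs | hs
    · simp [hz s hs, hpz s hs]
    · have := key g₀ 1 (fun s hs => by linarith [hlow s hs]) s hs
      linarith
  · intro s
    rcases le_or_gt s 0 with hs | hs
    · simp [hz s hs, hpz s hs]
    · have := key g₁ (-1) (fun s hs => by linarith [hup s hs]) s hs
      linarith
  · intro r s hr hrs
    rw [hge r hr, hge s (hr.trans_le hrs)]
    exact hpow r s hr hrs

end ParabolicOrlicz

namespace ParabolicOrlicz
open Filter Topology

/-! ### Scaling, convexity and roots of Young functions. -/

namespace YoungPair

variable {g₀ g₁ : ℝ} {g G : ℝ → ℝ}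

theorem prim_continuous (Y : YoungPair g₀ g₁ g G) : Continuous G :=
  continuous_iff_continuousAt.2 fun s => (Y.hasDerivAt s).continuousAt

theorem nonneg (Y : YoungPair g₀ g₁ g G) (s : ℝ) : 0 ≤ g s := by
  rcases le_or_gt s 0 with hs | hs
  · exact (Y.zero_of_nonpos s hs).ge
  · exact (Y.pos s hs).le

theorem prim_monotone (Y : YoungPair g₀ g₁ g G) : Monotone G :=
  monotone_of_deriv_nonneg (fun s => (Y.hasDerivAt s).differentiableAt)
    fun s => by rw [(Y.hasDerivAt s).deriv]; exact Y.nonneg s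

theorem prim_nonneg (Y : YoungPair g₀ g₁ g G) (s : ℝ) : 0 ≤ G s := by
  rcases le_or_gt s 0 with hs | hs
  · exact (Y.prim_zero_of_nonpos s hs).ge
  · rw [← Y.prim_zero_of_nonpos 0 le_rfl]; exact Y.prim_monotone hs.le

theorem prim_pos (Y : YoungPair g₀ g₁ g G) {s : ℝ} (hs : 0 < s) : 0 < G s := by
  rcases (Y.prim_nonneg s).lt_or_eq with h | h
  · exact h
  · have := Y.upper s
    rw [← h, mul_zero] at this
    exact absurd this (not_le.2 (mul_pos hs (Y.pos s hs)))

/-- The exponent is left free because it is needed for β = 1, for the Sobolev exponent p and for g₀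
itself. -/
theorem prim_mul_rpow_le (Y : YoungPair g₀ g₁ g G) {β r s : ℝ} (hβ : β ≤ g₀) (hr : 0 < r)
    (hrs : r ≤ s) : G r * s ^ β ≤ G s * r ^ β :=
  mul_rpow_le_mul_rpow_of_le_deriv (fun s _ => Y.hasDerivAt s)
    (fun s _ => (mul_le_mul_of_nonneg_right hβ (Y.prim_nonneg s)).trans (Y.lower s)) hr hrs

theorem prim_mul_rpow_ge (Y : YoungPair g₀ g₁ g G) {r s : ℝ} (hr : 0 < r)
    (hrs : r ≤ s) : G s * r ^ g₁ ≤ G r * s ^ g₁ :=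
  mul_rpow_le_mul_rpow_of_deriv_le (fun s _ => Y.hasDerivAt s) (fun s _ => Y.upper s) hr hrs

theorem prim_mul_le (Y : YoungPair g₀ g₁ g G) {c s : ℝ} (hc : 1 ≤ c) :
    G (c * s) ≤ c ^ g₁ * G s := by
  rcases le_or_gt s 0 with hs | hs
  · rw [Y.prim_zero_of_nonpos s hs, Y.prim_zero_of_nonpos _
      (mul_nonpos_of_nonneg_of_nonpos (by linarith) hs), mul_zero]
  · have h := Y.prim_mul_rpow_ge hs (le_mul_of_one_le_left hs.le hc)
    rw [Real.mul_rpow (by linarith) hs.le] at h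
    have hp := Real.rpow_pos_of_pos hs g₁
    refine le_of_mul_le_mul_right ?_ hp
    linarith

theorem prim_mul_le_mul (Y : YoungPair g₀ g₁ g G) (h1 : 1 ≤ g₀) {c s : ℝ} (hc : 0 ≤ c)
    (hc1 : c ≤ 1) : G (c * s) ≤ c * G s := by
  rcases le_or_gt s 0 with hs | hs
  · rw [Y.prim_zero_of_nonpos s hs, Y.prim_zero_of_nonpos _
      (mul_nonpos_of_nonneg_of_nonpos hc hs), mul_zero]
  · rcases hc.eq_or_lt with rfl | hc
    · simp [Y.prim_zero_of_nonpos 0 le_rfl]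
    · have h := Y.prim_mul_rpow_le h1 (mul_pos hc hs) (mul_le_of_le_one_left hs.le hc1)
      rw [Real.rpow_one, Real.rpow_one] at h
      refine le_of_mul_le_mul_right ?_ hs
      linarith

/-- Convexity of G in the form of a supporting line, as Jensen's inequality for mollifications
requires. -/
theorem tangent_le (Y : YoungPair g₀ g₁ g G) (b s : ℝ) : G b + g b * (s - b) ≤ G s := by
  have hmv : ∀ x y, x < y → ∃ c ∈ Ioo x y, g c * (y - x) = G y - G x := by
    intro x y hxy
    obtain ⟨c, hc, h⟩ := exists_hasDerivAt_eq_slope G g hxy Y.prim_continuous.continuousOn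
      (fun x _ => Y.hasDerivAt x)
    exact ⟨c, hc, by rw [h]; field_simp [sub_ne_zero.2 hxy.ne']⟩
  rcases lt_trichotomy b s with h | rfl | h
  · obtain ⟨c, hc, e⟩ := hmv b s h
    have := mul_le_mul_of_nonneg_right (Y.monotone hc.1.le) (sub_nonneg.2 h.le)
    linarith
  · simp
  · obtain ⟨c, hc, e⟩ := hmv s b h
    have := mul_le_mul_of_nonneg_right (Y.monotone hc.2.le) (sub_nonneg.2 h.le)
    linarith

theorem prim_max_le (Y : YoungPair g₀ g₁ g G) (a b : ℝ) : G (max a b) ≤ G a + G b := by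
  rcases max_cases a b with ⟨h, -⟩ | ⟨h, -⟩ <;> rw [h]
  · linarith [Y.prim_nonneg b]
  · linarith [Y.prim_nonneg a]

theorem prim_add_le (Y : YoungPair g₀ g₁ g G) (a b : ℝ) :
    G (a + b) ≤ 2 ^ g₁ * (G a + G b) := by
  have h : a + b ≤ 2 * max a b := by linarith [le_max_left a b, le_max_right a b]
  calc G (a + b) ≤ G (2 * max a b) := Y.prim_monotone h
    _ ≤ 2 ^ g₁ * G (max a b) := Y.prim_mul_le one_le_two
    _ ≤ _ := mul_le_mul_of_nonneg_left (Y.prim_max_le a b) (by positivity)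

theorem mul_le_add (Y : YoungPair g₀ g₁ g G) (h1 : 0 ≤ g₁) {a b : ℝ} (hb : 0 ≤ b) :
    g a * b ≤ g₁ * (G a + G b) := by
  calc g a * b ≤ g (max a b) * max a b :=
        mul_le_mul (Y.monotone (le_max_left _ _)) (le_max_right _ _) hb (Y.nonneg _)
    _ ≤ g₁ * G (max a b) := by rw [mul_comm]; exact Y.upper _
    _ ≤ _ := mul_le_mul_of_nonneg_left (Y.prim_max_le a b) h1

/-- Young's inequality with a small parameter, without conjugate functions. If b ≤ δa, then s g(s) ≤
g₁ G(s) at s = a suffices; otherwise a < b/δ, and the same bound at s = b/δ is followed by scaling.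
-/
theorem mul_le_add_delta (Y : YoungPair g₀ g₁ g G) (h1 : 0 ≤ g₁) {a b δ : ℝ} (hb : 0 ≤ b)
    (hδ : 0 < δ) (hδ1 : δ ≤ 1) :
    g a * b ≤ δ * (g₁ * G a) + g₁ * (δ⁻¹ ^ g₁ * G b) := by
  have hG := Y.prim_nonneg
  have hp : 0 ≤ δ⁻¹ ^ g₁ := Real.rpow_nonneg (inv_nonneg.2 hδ.le) _
  rcases le_or_gt b (δ * a) with h | h
  · calc g a * b ≤ g a * (δ * a) := mul_le_mul_of_nonneg_left h (Y.nonneg a)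
      _ = δ * (a * g a) := by ring
      _ ≤ δ * (g₁ * G a) := mul_le_mul_of_nonneg_left (Y.upper a) hδ.le
      _ ≤ _ := le_add_of_nonneg_right (mul_nonneg h1 (mul_nonneg hp (hG b)))
  · have ha : a ≤ δ⁻¹ * b := by
      rw [← div_eq_inv_mul, le_div_iff₀ hδ]; linarith
    have hδ' := one_le_inv_iff₀.2 ⟨hδ, hδ1⟩
    calc g a * b ≤ g (δ⁻¹ * b) * (δ⁻¹ * b) :=
          mul_le_mul (Y.monotone ha) (le_mul_of_one_le_left hb hδ') hb (Y.nonneg _)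
      _ ≤ g₁ * G (δ⁻¹ * b) := by rw [mul_comm]; exact Y.upper _
      _ ≤ g₁ * (δ⁻¹ ^ g₁ * G b) := mul_le_mul_of_nonneg_left (Y.prim_mul_le hδ') h1
      _ ≤ _ := le_add_of_nonneg_left (mul_nonneg hδ.le (mul_nonneg h1 (hG a)))

/-- For b ≤ s the power is at most one; for b > s the growth of G is at least that of the power p.
-/
theorem prim_mul_div_rpow_le (Y : YoungPair g₀ g₁ g G) {p s b : ℝ} (hp : 0 ≤ p) (hpg : p ≤ g₀)
    (hs : 0 < s) (hb : 0 ≤ b) : G s * (b / s) ^ p ≤ G s + G b := by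
  rcases le_or_gt b s with h | h
  · have : (b / s) ^ p ≤ 1 := Real.rpow_le_one (by positivity) ((div_le_one hs).2 h) hp
    calc G s * (b / s) ^ p ≤ G s * 1 := mul_le_mul_of_nonneg_left this (Y.prim_nonneg s)
      _ ≤ _ := by linarith [Y.prim_nonneg b]
  · have := Y.prim_mul_rpow_le hpg hs h.le
    rw [Real.div_rpow hb hs.le, ← mul_div_assoc]
    calc G s * b ^ p / s ^ p ≤ G b := (div_le_iff₀ (Real.rpow_pos_of_pos hs _)).2 this
      _ ≤ _ := by linarith [Y.prim_nonneg s]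

/-- The derivative of `G ^ (1/p)`. -/
noncomputable def rootDeriv (g G : ℝ → ℝ) (p s : ℝ) : ℝ := g s * (1 / p) * G s ^ (1 / p - 1)

theorem rootDeriv_nonneg (Y : YoungPair g₀ g₁ g G) {p : ℝ} (hp : 0 < p) (s : ℝ) :
    0 ≤ rootDeriv g G p s :=
  mul_nonneg (mul_nonneg (Y.nonneg s) (by positivity)) (Real.rpow_nonneg (Y.prim_nonneg s) _)

theorem rootDeriv_le (Y : YoungPair g₀ g₁ g G) {p : ℝ} (hp : 0 < p) {s : ℝ} (hs : 0 < s) :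
    rootDeriv g G p s ≤ g₁ / p * (G s ^ (1 / p) / s) := by
  have hG := Y.prim_pos hs
  have h1 : g s ≤ g₁ * G s / s := by rw [le_div_iff₀ hs, mul_comm]; exact Y.upper s
  have e : G s ^ (1 / p) = G s * G s ^ (1 / p - 1) := by
    rw [mul_comm, ← Real.rpow_add_one hG.ne']; congr 1; ring
  rw [e, rootDeriv]
  calc g s * (1 / p) * G s ^ (1 / p - 1) ≤ g₁ * G s / s * (1 / p) * G s ^ (1 / p - 1) := by
        gcongr
    _ = _ := by field_simp

/-- The derivative of G^(1/p) is at most a multiple of G^(1/p)/s, so the left side is controlled by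
G(s)(b/s)^p. With b a gradient norm, this bounds the p-th power of the gradient of G^(1/p) composed
with a function. -/
theorem rootDeriv_mul_rpow_le (Y : YoungPair g₀ g₁ g G) {p s b : ℝ} (hp : 0 < p) (hpg : p ≤ g₀)
    (h1 : 0 ≤ g₁) (hb : 0 ≤ b) :
    (rootDeriv g G p s * b) ^ p ≤ (g₁ / p) ^ p * (G s + G b) := by
  have hc : 0 ≤ (g₁ / p) ^ p := Real.rpow_nonneg (by positivity) _
  have hGs := Y.prim_nonneg s
  have hGb := Y.prim_nonneg b
  rcases le_or_gt s 0 with hs | hs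
  · rw [rootDeriv, Y.zero_of_nonpos s hs, zero_mul, zero_mul, zero_mul, Real.zero_rpow hp.ne']
    positivity
  · have hR : 0 ≤ G s ^ (1 / p) := Real.rpow_nonneg hGs _
    calc (rootDeriv g G p s * b) ^ p
        ≤ (g₁ / p * (G s ^ (1 / p) * (b / s))) ^ p := by
          refine Real.rpow_le_rpow (mul_nonneg (Y.rootDeriv_nonneg hp s) hb) ?_ hp.le
          calc _ ≤ g₁ / p * (G s ^ (1 / p) / s) * b :=
                mul_le_mul_of_nonneg_right (Y.rootDeriv_le hp hs) hb
            _ = _ := by ring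
      _ = (g₁ / p) ^ p * (G s * (b / s) ^ p) := by
          rw [Real.mul_rpow (by positivity) (by positivity), Real.mul_rpow hR (by positivity),
            ← Real.rpow_mul hGs, one_div_mul_cancel hp.ne', Real.rpow_one]
      _ ≤ _ := mul_le_mul_of_nonneg_left (Y.prim_mul_div_rpow_le hp.le hpg hs hb) hc

/-- Near 0 the derivative is at most a multiple of s^(g₀/p - 1), which tends to 0 because p is
strictly below g₀. -/
theorem continuous_rootDeriv (Y : YoungPair g₀ g₁ g G) {p : ℝ} (hp : 0 < p) (hpg : p < g₀)
    (h1 : 0 ≤ g₁) : Continuous (rootDeriv g G p) := by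
  have hz : ∀ s ≤ 0, rootDeriv g G p s = 0 := fun s hs => by
    rw [rootDeriv, Y.zero_of_nonpos s hs, zero_mul, zero_mul]
  rw [continuous_iff_continuousAt]
  intro s
  rcases lt_trichotomy s 0 with hs | rfl | hs
  · refine (continuousAt_const (y := (0 : ℝ))).congr ?_
    filter_upwards [Iio_mem_nhds hs] with x hx
    exact (hz x (le_of_lt hx)).symm
  · have hb : ∀ᶠ x in 𝓝 (0 : ℝ), rootDeriv g G p x ≤ g₁ / p * G 1 ^ (1 / p) * |x| ^ (g₀ / p - 1) := by
      filter_upwards [Iio_mem_nhds (zero_lt_one (α := ℝ))] with x hx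
      have hG1 : 0 ≤ G 1 ^ (1 / p) := Real.rpow_nonneg (Y.prim_nonneg 1) _
      rcases le_or_gt x 0 with hx0 | hx0
      · rw [hz x hx0]
        positivity
      · have h2 := Y.prim_mul_rpow_le le_rfl hx0 (le_of_lt (mem_Iio.1 hx))
        rw [Real.one_rpow, mul_one] at h2
        have h3 : G x ^ (1 / p) ≤ G 1 ^ (1 / p) * x ^ (g₀ / p) := by
          calc G x ^ (1 / p) ≤ (G 1 * x ^ g₀) ^ (1 / p) :=
                Real.rpow_le_rpow (Y.prim_nonneg x) h2 (by positivity)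
            _ = _ := by
                rw [Real.mul_rpow (Y.prim_nonneg 1) (by positivity), ← Real.rpow_mul hx0.le,
                  mul_one_div]
        rw [abs_of_pos hx0]
        calc rootDeriv g G p x ≤ g₁ / p * (G x ^ (1 / p) / x) := Y.rootDeriv_le hp hx0
          _ ≤ g₁ / p * (G 1 ^ (1 / p) * x ^ (g₀ / p) / x) := by gcongr
          _ = _ := by rw [Real.rpow_sub_one hx0.ne']; ring
    unfold ContinuousAt
    rw [hz 0 le_rfl]
    refine tendsto_of_tendsto_of_tendsto_of_le_of_le' tendsto_const_nhds ?_
        (Eventually.of_forall fun x => Y.rootDeriv_nonneg hp x) hb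
    have hpos : 0 < g₀ / p - 1 := by rw [sub_pos, one_lt_div hp]; exact hpg
    have : ContinuousAt (fun x : ℝ => g₁ / p * G 1 ^ (1 / p) * |x| ^ (g₀ / p - 1)) 0 :=
      continuousAt_const.mul ((continuous_abs.continuousAt).rpow_const (Or.inr hpos.le))
    simpa [ContinuousAt, Real.zero_rpow hpos.ne'] using this
  · exact (Y.continuous.continuousAt.mul continuousAt_const).mul
      (Y.prim_continuous.continuousAt.rpow_const (Or.inl (Y.prim_pos hs).ne'))

theorem hasDerivAt_root (Y : YoungPair g₀ g₁ g G) {p : ℝ} (hp : 0 < p) (hpg : p < g₀)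
    (h1 : 0 ≤ g₁) (s : ℝ) : HasDerivAt (fun s => G s ^ (1 / p)) (rootDeriv g G p s) s := by
  have hne : ∀ s, s ≠ 0 → HasDerivAt (fun s => G s ^ (1 / p)) (rootDeriv g G p s) s := by
    intro s hs
    rcases hs.lt_or_gt with hs | hs
    · rw [rootDeriv, Y.zero_of_nonpos s hs.le, zero_mul, zero_mul]
      refine (hasDerivAt_const s (0 : ℝ)).congr_of_eventuallyEq ?_
      filter_upwards [Iio_mem_nhds hs] with x hx
      rw [Y.prim_zero_of_nonpos x (le_of_lt hx), Real.zero_rpow (by positivity)]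
    · exact (Y.hasDerivAt s).rpow_const (Or.inl (Y.prim_pos hs).ne')
  rcases eq_or_ne s 0 with rfl | hs
  -- At the origin the derivative is obtained as the limit of the derivatives nearby.
  · exact hasDerivAt_of_hasDerivAt_of_ne (fun y hy => hne y hy)
      (Y.prim_continuous.rpow_const fun _ => Or.inr (by positivity)).continuousAt
      (Y.continuous_rootDeriv hp hpg h1).continuousAt
  · exact hne s hs

end YoungPair

/-! ### The vector field -/

section VectorField

variable {n : ℕ} {g₀ g₁ ν L : ℝ} {g G : ℝ → ℝ}
  {A : EuclideanSpace ℝ (Fin n) → EuclideanSpace ℝ (Fin n)}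

theorem StructureCondition.hasDerivAt_line (hA : StructureCondition ν L g A)
    {ξ : EuclideanSpace ℝ (Fin n)} (hξ : ξ ≠ 0) (e : EuclideanSpace ℝ (Fin n)) {s : ℝ}
    (hs : 0 < s) : HasDerivAt (fun s : ℝ => inner ℝ (A (s • ξ)) e)
      (inner ℝ (fderiv ℝ A (s • ξ) ξ) e) s := by
  have hne : s • ξ ≠ 0 := smul_ne_zero hs.ne' hξ
  have h1 : HasFDerivAt A (fderiv ℝ A (s • ξ)) (s • ξ) :=
    ((hA.contDiffOn.differentiableOn one_ne_zero).differentiableAt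
      (isOpen_compl_singleton.mem_nhds hne)).hasFDerivAt
  have h2 : HasDerivAt (fun s : ℝ => s • ξ) ξ s := by
    simpa using (hasDerivAt_id s).smul_const ξ
  have h3 := h1.comp_hasDerivAt s h2
  have := h3.inner ℝ (hasDerivAt_const s e)
  simpa using this

/-- The segment from 0 to ξ meets the point where 𝒜 may fail to be differentiable only at s = 0,
where continuity is enough. -/
theorem monotoneOn_line {f f' : ℝ → ℝ} (hc : Continuous f)
    (hd : ∀ s, 0 < s → HasDerivAt f (f' s) s) (hn : ∀ s, 0 < s → s ≤ 1 → 0 ≤ f' s) : f 0 ≤ f 1 := by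
  have : MonotoneOn f (Icc 0 1) := by
    apply monotoneOn_of_deriv_nonneg (convex_Icc 0 1) hc.continuousOn
    · rw [interior_Icc]
      exact fun x hx => (hd x hx.1).differentiableAt.differentiableWithinAt
    · rw [interior_Icc]
      intro x hx
      rw [(hd x hx.1).deriv]
      exact hn x hx.1 hx.2.le
  exact this (by simp) (by simp) zero_le_one

/-- Along the ray, the derivative of ⟨𝒜(sξ), ξ⟩ is at least ν g(s|ξ|)|ξ|/s. For s ≤ 1 this dominates
ν g(s|ξ|)|ξ|, the derivative of ν G(s|ξ|). -/
theorem StructureCondition.coercive (hA : StructureCondition ν L g A)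
    (Y : YoungPair g₀ g₁ (extZero g) G) (hν : 0 ≤ ν) (ξ : EuclideanSpace ℝ (Fin n)) :
    ν * G ‖ξ‖ ≤ inner ℝ (A ξ - A 0) ξ := by
  rcases eq_or_ne ξ 0 with rfl | hξ
  · simp [Y.prim_zero_of_nonpos 0 le_rfl]
  have hn : 0 < ‖ξ‖ := norm_pos_iff.2 hξ
  have hc : Continuous fun s : ℝ => inner ℝ (A (s • ξ)) ξ - ν * G (s * ‖ξ‖) := by
    have := hA.continuous
    have := Y.prim_continuous
    fun_prop
  have := monotoneOn_line hc (f' := fun s => inner ℝ (fderiv ℝ A (s • ξ) ξ) ξ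
      - ν * (extZero g (s * ‖ξ‖) * ‖ξ‖)) (fun s hs => ?_) (fun s hs hs1 => ?_)
  · simp only [zero_smul, zero_mul, one_smul, one_mul, Y.prim_zero_of_nonpos 0 le_rfl,
      mul_zero, sub_zero] at this
    rw [inner_sub_left]
    linarith
  · refine (hA.hasDerivAt_line hξ ξ hs).sub (HasDerivAt.const_mul ν ?_)
    have := (Y.hasDerivAt (s * ‖ξ‖)).comp s ((hasDerivAt_id s).mul_const ‖ξ‖)
    rw [one_mul] at this
    exact this
  · have hne : s • ξ ≠ 0 := smul_ne_zero hs.ne' hξ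
    have h := hA.elliptic (s • ξ) hne ξ
    have hns : ‖s • ξ‖ = s * ‖ξ‖ := by rw [norm_smul, Real.norm_of_nonneg hs.le]
    have hp : 0 < s * ‖ξ‖ := by positivity
    have he : extZero g (s * ‖ξ‖) = g (s * ‖ξ‖) := by simp only [extZero, hp, if_true]
    have hg : 0 < g (s * ‖ξ‖) := by rw [← he]; exact Y.pos _ hp
    rw [hns] at h
    rw [he, sub_nonneg]
    refine le_trans ?_ h
    have : g (s * ‖ξ‖) / (s * ‖ξ‖) * ‖ξ‖ ^ 2 = g (s * ‖ξ‖) * ‖ξ‖ / s := by field_simp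
    rw [mul_assoc, this]
    refine mul_le_mul_of_nonneg_left ?_ hν
    rw [le_div_iff₀ hs]
    exact mul_le_of_le_one_right (by positivity) hs1

/-- Integrating D𝒜 along the ray leads to L ∫ g(s|ξ|)/s ds over (0,1). Since g(s|ξ|) ≤ s^(g₀-1)
g(|ξ|), the singularity at 0 is integrable exactly because g₀ > 1, and the integral produces
1/(g₀-1). -/
theorem StructureCondition.norm_sub_le (hA : StructureCondition ν L g A)
    (Y : YoungPair g₀ g₁ (extZero g) G) (hL : 0 ≤ L) (h1 : 1 < g₀)
    (ξ : EuclideanSpace ℝ (Fin n)) :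
    ‖A ξ - A 0‖ ≤ L / (g₀ - 1) * extZero g ‖ξ‖ := by
  rcases eq_or_ne ξ 0 with rfl | hξ
  · simp [Y.zero_of_nonpos 0 le_rfl]
  have hn : 0 < ‖ξ‖ := norm_pos_iff.2 hξ
  have h1' : 0 < g₀ - 1 := by linarith
  -- Pairing with this fixed vector makes the problem scalar: the increment of ⟨𝒜(sξ), e⟩ over [0,1]
  -- is |e|².
  set e := A ξ - A 0 with he
  set B := L / (g₀ - 1) * extZero g ‖ξ‖ with hB
  have hB0 : 0 ≤ B := mul_nonneg (by positivity) (Y.nonneg _)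
  have hc : Continuous fun s : ℝ => B * ‖e‖ * s ^ (g₀ - 1) - inner ℝ (A (s • ξ)) e := by
    have := hA.continuous
    have h3 : Continuous fun s : ℝ => s ^ (g₀ - 1) :=
      continuous_id.rpow_const fun _ => Or.inr h1'.le
    fun_prop
  have := monotoneOn_line hc (f' := fun s => B * ‖e‖ * ((g₀ - 1) * s ^ (g₀ - 1 - 1))
      - inner ℝ (fderiv ℝ A (s • ξ) ξ) e) (fun s hs => ?_) (fun s hs hs1 => ?_)
  · simp only [zero_smul, one_smul, Real.one_rpow, mul_one, Real.zero_rpow h1'.ne',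
      mul_zero, zero_sub] at this
    have h4 : inner ℝ (A ξ) e - inner ℝ (A 0) e = ‖e‖ ^ 2 := by
      rw [← inner_sub_left, ← he, real_inner_self_eq_norm_sq]
    rcases (norm_nonneg e).eq_or_lt with h5 | h5
    · rw [← h5]; exact hB0
    · refine le_of_mul_le_mul_right ?_ h5
      nlinarith
  · exact ((Real.hasDerivAt_rpow_const (Or.inl hs.ne')).const_mul _).sub
      (hA.hasDerivAt_line hξ e hs)
  · have hne : s • ξ ≠ 0 := smul_ne_zero hs.ne' hξ
    have h := hA.bounded (s • ξ) hne
    have hns : ‖s • ξ‖ = s * ‖ξ‖ := by rw [norm_smul, Real.norm_of_nonneg hs.le]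
    have hp : 0 < s * ‖ξ‖ := by positivity
    have he' : extZero g (s * ‖ξ‖) = g (s * ‖ξ‖) := by simp only [extZero, hp, if_true]
    rw [hns, ← he'] at h
    rw [sub_nonneg]
    have h6 := Y.rpow_lower (s * ‖ξ‖) ‖ξ‖ hp (mul_le_of_le_one_left hn.le hs1)
    rw [Real.mul_rpow hs.le hn.le, ← mul_assoc] at h6
    have h7 := le_of_mul_le_mul_right h6 (Real.rpow_pos_of_pos hn _)
    calc inner ℝ (fderiv ℝ A (s • ξ) ξ) e ≤ ‖fderiv ℝ A (s • ξ) ξ‖ * ‖e‖ := real_inner_le_norm _ _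
      _ ≤ (L * (extZero g (s * ‖ξ‖) / (s * ‖ξ‖)) * ‖ξ‖) * ‖e‖ := by
          gcongr
          exact (ContinuousLinearMap.le_opNorm _ _).trans
            (mul_le_mul_of_nonneg_right h hn.le)
      _ = L * (extZero g (s * ‖ξ‖) / s) * ‖e‖ := by field_simp
      _ ≤ L * (extZero g ‖ξ‖ * s ^ (g₀ - 1) / s) * ‖e‖ := by gcongr
      _ = _ := by
          rw [Real.rpow_sub_one hs.ne' (g₀ - 1), hB]
          generalize s ^ (g₀ - 1) = z
          field_simp

end VectorField

end ParabolicOrlicz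

namespace ParabolicOrlicz
open Filter Topology

/-! ### Truncations -/

theorem hasDerivAt_max_zero_pow {q : ℕ} (hq : 2 ≤ q) (s : ℝ) :
    HasDerivAt (fun s : ℝ => max s 0 ^ q) (q * max s 0 ^ (q - 1)) s := by
  have hne : ∀ s : ℝ, s ≠ 0 → HasDerivAt (fun s : ℝ => max s 0 ^ q) (q * max s 0 ^ (q - 1)) s := by
    intro s hs
    rcases hs.lt_or_gt with hs | hs
    · rw [max_eq_right hs.le, zero_pow (by omega), mul_zero]
      refine (hasDerivAt_const s (0 : ℝ)).congr_of_eventuallyEq ?_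
      filter_upwards [Iio_mem_nhds hs] with x hx
      rw [max_eq_right (le_of_lt (mem_Iio.1 hx)), zero_pow (by omega)]
    · rw [max_eq_left hs.le]
      refine (hasDerivAt_pow q s).congr_of_eventuallyEq ?_
      filter_upwards [Ioi_mem_nhds hs] with x hx
      rw [max_eq_left (le_of_lt (mem_Ioi.1 hx))]
  rcases eq_or_ne s 0 with rfl | hs
  · exact hasDerivAt_of_hasDerivAt_of_ne (g := fun s : ℝ => q * max s 0 ^ (q - 1))
      (fun y hy => hne y hy) (by fun_prop) (by fun_prop)
  · exact hne s hs

/-- A `C¹` regularization of `s ↦ (s - κ)₊`, of slope one beyond `κ + d`. -/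
noncomputable def trunc (κ d s : ℝ) : ℝ := (max (s - κ) 0 ^ 2 - max (s - κ - d) 0 ^ 2) / (2 * d)

/-- The derivative of `trunc`. -/
noncomputable def truncDeriv (κ d s : ℝ) : ℝ := (max (s - κ) 0 - max (s - κ - d) 0) / d

/-- The primitive of `trunc`. -/
noncomputable def truncPrim (κ d s : ℝ) : ℝ :=
  (max (s - κ) 0 ^ 3 - max (s - κ - d) 0 ^ 3) / (6 * d)

theorem hasDerivAt_trunc (κ d s : ℝ) : HasDerivAt (trunc κ d) (truncDeriv κ d s) s := by
  have h1 := (hasDerivAt_max_zero_pow le_rfl (s - κ)).comp s ((hasDerivAt_id s).sub_const κ)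
  have h2 := (hasDerivAt_max_zero_pow le_rfl (s - κ - d)).comp s
    (((hasDerivAt_id s).sub_const κ).sub_const d)
  have := (h1.sub h2).div_const (2 * d)
  refine this.congr_deriv ?_
  simp only [truncDeriv]
  norm_num
  rw [← mul_sub, mul_div_mul_left _ _ two_ne_zero]

theorem hasDerivAt_truncPrim (κ d s : ℝ) : HasDerivAt (truncPrim κ d) (trunc κ d s) s := by
  have h1 := (hasDerivAt_max_zero_pow (q := 3) (by norm_num) (s - κ)).comp s
    ((hasDerivAt_id s).sub_const κ)
  have h2 := (hasDerivAt_max_zero_pow (q := 3) (by norm_num) (s - κ - d)).comp s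
    (((hasDerivAt_id s).sub_const κ).sub_const d)
  have := (h1.sub h2).div_const (6 * d)
  refine this.congr_deriv ?_
  simp only [trunc]
  norm_num
  rw [← mul_sub, show (6 : ℝ) * d = 3 * (2 * d) by ring, mul_div_mul_left _ _ three_ne_zero]

theorem continuous_truncDeriv (κ d : ℝ) : Continuous (truncDeriv κ d) := by
  unfold truncDeriv; fun_prop

theorem continuous_trunc (κ d : ℝ) : Continuous (trunc κ d) := by
  unfold trunc; fun_prop

theorem continuous_truncPrim (κ d : ℝ) : Continuous (truncPrim κ d) := by
  unfold truncPrim; fun_prop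

theorem contDiff_trunc (κ d : ℝ) : ContDiff ℝ 1 (trunc κ d) := by
  rw [contDiff_one_iff_deriv]
  refine ⟨fun s => (hasDerivAt_trunc κ d s).differentiableAt, ?_⟩
  rw [funext fun s => (hasDerivAt_trunc κ d s).deriv]
  exact continuous_truncDeriv κ d

/-- The bound of `trunc` by (s-κ)₊ times `truncDeriv` gives the cutoff term the same weight as the
elliptic term, so that it can be absorbed. The quadratic bounds link slice integrals to the excess.
The last item makes the truncation at least d/2 beyond the next level. -/
theorem truncation_bounds {κ d : ℝ} (hd : 0 < d) (s : ℝ) :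
    0 ≤ truncDeriv κ d s ∧ truncDeriv κ d s ≤ 1 ∧ 0 ≤ trunc κ d s ∧
    trunc κ d s ≤ max (s - κ) 0 * truncDeriv κ d s ∧
    trunc κ d s ^ 2 ≤ 2 * truncPrim κ d s ∧ 2 * truncPrim κ d s ≤ max (s - κ) 0 ^ 2 ∧
    (κ + d < s → s - κ - d ≤ trunc κ d s ∧ d / 2 ≤ trunc κ d s) := by
  unfold truncDeriv trunc truncPrim
  rcases le_or_gt s κ with h | h
  · rw [max_eq_right (by linarith : s - κ ≤ 0), max_eq_right (by linarith : s - κ - d ≤ 0)]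
    norm_num
    intro h'; linarith
  rcases le_or_gt s (κ + d) with h' | h'
  · rw [max_eq_left (by linarith : 0 ≤ s - κ), max_eq_right (by linarith : s - κ - d ≤ 0)]
    obtain ⟨y, hy⟩ : ∃ y, y = s - κ := ⟨_, rfl⟩
    have hy0 : 0 < y := by linarith
    have hyd : y ≤ d := by linarith
    rw [← hy]
    refine ⟨by simp; positivity, ?_, by simp; positivity, ?_, ?_, ?_, fun hh => by linarith⟩
    · rw [div_le_one hd]; linarith
    · rw [sub_zero, zero_pow two_ne_zero, sub_zero, ← mul_div_assoc, div_le_div_iff₀ (by positivity) hd]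
      nlinarith [mul_pos (mul_pos hy0 hy0) hd]
    · simp only [zero_pow two_ne_zero, zero_pow three_ne_zero, sub_zero]
      rw [div_pow, ← mul_div_assoc, div_le_div_iff₀ (by positivity) (by positivity)]
      have : 0 < y ^ 3 * d := by positivity
      nlinarith [mul_nonneg this.le (sub_nonneg.2 hyd), mul_pos this hd]
    · simp only [zero_pow three_ne_zero, sub_zero]
      rw [← mul_div_assoc, div_le_iff₀ (by positivity)]
      nlinarith [mul_nonneg (sq_nonneg y) (sub_nonneg.2 hyd), mul_pos (mul_pos hy0 hy0) hd]
  · rw [max_eq_left (by linarith : 0 ≤ s - κ), max_eq_left (by linarith : 0 ≤ s - κ - d)]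
    obtain ⟨y, hy⟩ : ∃ y, y = s - κ := ⟨_, rfl⟩
    have hyd : d < y := by linarith
    rw [← hy]
    have e1 : (y - (y - d)) / d = 1 := by field_simp; ring
    have e2 : (y ^ 2 - (y - d) ^ 2) / (2 * d) = y - d / 2 := by field_simp; ring
    have e3 : (y ^ 3 - (y - d) ^ 3) / (6 * d) = y ^ 2 / 2 - y * d / 2 + d ^ 2 / 6 := by
      field_simp; ring
    rw [e1, e2, e3]
    refine ⟨zero_le_one, le_rfl, by linarith, by linarith, by nlinarith, by nlinarith, fun _ =>
      ⟨by linarith, by linarith⟩⟩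

/-! ### Convergence lemmas -/

/-- The induction keeps Yⱼ ≤ cʲ Y₀. The surplus factor Yⱼ^α contributes c^(αj), which absorbs bʲ,
while the smallness of Y₀ supplies the next factor c. -/
theorem tendsto_zero_of_fast_decay {Y : ℕ → ℝ} {C b c α : ℝ} (hY : ∀ j, 0 ≤ Y j) (hC : 0 ≤ C)
    (hb : 0 ≤ b) (hc : 0 < c) (hc1 : c < 1) (hα : 0 < α) (hbc : b * c ^ α ≤ 1)
    (h0 : C * Y 0 ^ α ≤ c) (hstep : ∀ j, Y (j + 1) ≤ C * b ^ j * Y j ^ (1 + α)) :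
    Tendsto Y atTop (𝓝 0) := by
  have key : ∀ j, Y j ≤ c ^ j * Y 0 := by
    intro j
    induction j with
    | zero => simp
    | succ j ih =>
      have h1 : 0 ≤ c ^ j := by positivity
      calc Y (j + 1) ≤ C * b ^ j * Y j ^ (1 + α) := hstep j
        _ ≤ C * b ^ j * (c ^ j * Y 0) ^ (1 + α) := by
            refine mul_le_mul_of_nonneg_left ?_ (by positivity)
            exact Real.rpow_le_rpow (hY j) ih (by linarith)
        _ = (b * c ^ α) ^ j * (c ^ j * Y 0 * (C * Y 0 ^ α)) := by
            have h2 : (c ^ j * Y 0) ^ (1 + α) = (c ^ j * Y 0) * ((c ^ α) ^ j * Y 0 ^ α) := by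
              rw [Real.rpow_one_add' (mul_nonneg h1 (hY 0)) (by linarith),
                Real.mul_rpow h1 (hY 0), Real.rpow_pow_comm hc.le]
            rw [h2, mul_pow]; ring
        _ ≤ 1 * (c ^ j * Y 0 * c) := by
            have h3 : 0 ≤ c ^ j * Y 0 := mul_nonneg h1 (hY 0)
            refine mul_le_mul (pow_le_one₀ (by positivity) hbc)
              (mul_le_mul_of_nonneg_left h0 h3) ?_ zero_le_one
            exact mul_nonneg h3 (mul_nonneg hC (Real.rpow_nonneg (hY 0) _))
        _ = c ^ (j + 1) * Y 0 := by ring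
  refine squeeze_zero hY key ?_
  simpa using (tendsto_pow_atTop_nhds_zero_of_lt_one hc.le hc1).mul_const (Y 0)

section Convergence

variable {X : Type*} [MeasurableSpace X] {μ : Measure X}

/-- Scheffé's lemma for nonnegative functions with constant integral. -/
theorem tendsto_integral_abs_sub_of_integral_eq {M : X → ℝ} {Mm : ℕ → X → ℝ}
    (hM : Integrable M μ) (hMm : ∀ m, Integrable (Mm m) μ) (h0 : ∀ m, ∀ᵐ x ∂μ, 0 ≤ Mm m x)
    (hM0 : ∀ᵐ x ∂μ, 0 ≤ M x)
    (hint : ∀ m, ∫ x, Mm m x ∂μ = ∫ x, M x ∂μ)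
    (hlim : ∀ᵐ x ∂μ, Tendsto (fun m => Mm m x) atTop (𝓝 (M x))) :
    Tendsto (fun m => ∫ x, |Mm m x - M x| ∂μ) atTop (𝓝 0) := by
  have e : ∀ m, ∫ x, |Mm m x - M x| ∂μ = 2 * ∫ x, max (M x - Mm m x) 0 ∂μ := by
    intro m
    have h1 : ∀ x, |Mm m x - M x| = (Mm m x - M x) + 2 * max (M x - Mm m x) 0 := by
      intro x
      rcases le_total (M x) (Mm m x) with h | h
      · rw [abs_of_nonneg (by linarith), max_eq_right (by linarith)]; ring
      · rw [abs_of_nonpos (by linarith), max_eq_left (by linarith)]; ring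
    have hp : Integrable (fun x => max (M x - Mm m x) 0) μ := (hM.sub (hMm m)).pos_part
    have hs : Integrable (fun x => Mm m x - M x) μ := (hMm m).sub hM
    rw [integral_congr_ae (Eventually.of_forall h1), integral_add hs
      (hp.const_mul 2), integral_sub (hMm m) hM, hint m, sub_self, zero_add,
      integral_const_mul]
  simp only [e]
  have : Tendsto (fun m => ∫ x, max (M x - Mm m x) 0 ∂μ) atTop (𝓝 (∫ _, (0 : ℝ) ∂μ)) := by
    refine tendsto_integral_of_dominated_convergence M
      (fun m => ((hM.sub (hMm m)).pos_part).aestronglyMeasurable) hM (fun m => ?_) ?_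
    · filter_upwards [h0 m, hM0] with x hx hx'
      rw [Real.norm_of_nonneg (le_max_right _ _)]
      exact max_le (by linarith) hx'
    · filter_upwards [hlim] with x hx
      have : Tendsto (fun m => max (M x - Mm m x) 0) atTop (𝓝 (max (M x - M x) 0)) :=
        (tendsto_const_nhds.sub hx).max tendsto_const_nhds
      simpa using this
  simpa using this.const_mul 2

/-- Dominated convergence with dominating functions converging in `L¹`. -/
theorem tendsto_integral_abs_sub_of_dominated {M f : X → ℝ} {Mm fm : ℕ → X → ℝ} {C : ℝ}
    (hM : Integrable M μ) (hMm : ∀ m, Integrable (Mm m) μ)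
    (hML : Tendsto (fun m => ∫ x, |Mm m x - M x| ∂μ) atTop (𝓝 0))
    (hMl : ∀ᵐ x ∂μ, Tendsto (fun m => Mm m x) atTop (𝓝 (M x)))
    (hfm : ∀ m, AEStronglyMeasurable (fm m) μ)
    (hlim : ∀ᵐ x ∂μ, Tendsto (fun m => fm m x) atTop (𝓝 (f x)))
    (hb : ∀ m, ∀ᵐ x ∂μ, |fm m x| ≤ C * Mm m x) :
    Integrable f μ ∧ (∀ m, Integrable (fm m) μ) ∧
      Tendsto (fun m => ∫ x, |fm m x - f x| ∂μ) atTop (𝓝 0) := by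
  have hfint : ∀ m, Integrable (fm m) μ := fun m =>
    ((hMm m).const_mul C).mono' (hfm m) (hb m)
  have hfM : ∀ᵐ x ∂μ, |f x| ≤ C * M x := by
    filter_upwards [hMl, hlim, ae_all_iff.2 hb] with x h1 h2 h3
    exact le_of_tendsto_of_tendsto' h2.abs (h1.const_mul C) h3
  have hf : Integrable f μ := (hM.const_mul C).mono' (aestronglyMeasurable_of_tendsto_ae _ hfm hlim) hfM
  refine ⟨hf, hfint, ?_⟩
  -- Since |fₘ - f| ≤ C Mₘ + C M, it is at most min(|fₘ - f|, 2CM) + |C||Mₘ - M|. The first term has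
  -- a fixed dominating function, and the second tends to 0 in L¹.
  have hmeas : ∀ m, Integrable (fun x => min |fm m x - f x| (2 * (C * M x))) μ := fun m =>
    ((hfint m).sub hf).abs.inf ((hM.const_mul C).const_mul 2)
  have h1 : Tendsto (fun m => ∫ x, min |fm m x - f x| (2 * (C * M x)) ∂μ) atTop
      (𝓝 (∫ _, (0 : ℝ) ∂μ)) := by
    refine tendsto_integral_of_dominated_convergence (fun x => 2 * (C * M x))
      (fun m => (hmeas m).aestronglyMeasurable) ((hM.const_mul C).const_mul 2) (fun m => ?_) ?_
    · filter_upwards [hfM] with x hx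
      have : 0 ≤ C * M x := (abs_nonneg _).trans hx
      rw [Real.norm_of_nonneg (le_min (abs_nonneg _) (by linarith))]
      exact min_le_right _ _
    · filter_upwards [hlim, hfM] with x hx hx'
      have : 0 ≤ C * M x := (abs_nonneg _).trans hx'
      have h2 : Tendsto (fun m => |fm m x - f x|) atTop (𝓝 |f x - f x|) :=
        (hx.sub tendsto_const_nhds).abs
      have := h2.min (tendsto_const_nhds (x := 2 * (C * M x)))
      rwa [sub_self, abs_zero, min_eq_left (by linarith)] at this
  rw [integral_zero] at h1
  have h2 := h1.add (hML.const_mul |C|)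
  rw [mul_zero, add_zero] at h2
  refine squeeze_zero (fun m => integral_nonneg fun x => abs_nonneg _) (fun m => ?_) h2
  have hs : Integrable (fun x => |C| * |Mm m x - M x|) μ := ((hMm m).sub hM).abs.const_mul _
  rw [← integral_const_mul, ← integral_add (hmeas m) hs]
  refine integral_mono_ae ((hfint m).sub hf).abs ((hmeas m).add hs) ?_
  filter_upwards [hb m, hfM] with x h3 h4
  show |fm m x - f x| ≤ min |fm m x - f x| (2 * (C * M x)) + |C| * |Mm m x - M x|
  have h5 : |fm m x - f x| ≤ C * Mm m x + C * M x := (abs_sub _ _).trans (add_le_add h3 h4)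
  have h6 : C * Mm m x - C * M x ≤ |C| * |Mm m x - M x| := by
    rw [← abs_mul, mul_sub]; exact le_abs_self _
  rcases min_cases |fm m x - f x| (2 * (C * M x)) with ⟨h, -⟩ | ⟨h, -⟩ <;> rw [h]
  · have : 0 ≤ |C| * |Mm m x - M x| := by positivity
    linarith
  · linarith

end Convergence

end ParabolicOrlicz

namespace ParabolicOrlicz
open Filter Topology

/-! ### Mollification -/

section Mollification

set_option linter.unusedSectionVars false

open scoped Convolution

variable {V F : Type*} [NormedAddCommGroup V] [NormedSpace ℝ V] [FiniteDimensional ℝ V]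
  [MeasureSpace V] [BorelSpace V] [(volume : Measure V).IsAddHaarMeasure]
  [NormedAddCommGroup F] [NormedSpace ℝ F]

/-- Convolution of `f` with the normalized bump function `κ`. -/
noncomputable def mollify (κ : ContDiffBump (0 : V)) (f : V → F) (z : V) : F :=
  ∫ w, κ.normed volume (z - w) • f w

variable {κ : ContDiffBump (0 : V)}

theorem mollify_eq_convolution (κ : ContDiffBump (0 : V)) (f : V → F) :
    mollify κ f = κ.normed volume ⋆[ContinuousLinearMap.lsmul ℝ ℝ, volume] f := by
  ext z
  rw [convolution_eq_swap]
  rfl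

theorem contDiff_mollify {f : V → F} (hf : LocallyIntegrable f) :
    ContDiff ℝ 1 (mollify κ f) := by
  rw [mollify_eq_convolution]
  exact κ.hasCompactSupport_normed.contDiff_convolution_left _ κ.contDiff_normed hf

theorem integrable_bump_smul [CompleteSpace F] {f : V → F} (hf : LocallyIntegrable f) {k : V → ℝ}
    (hk : Continuous k) (hkc : HasCompactSupport k) (z : V) :
    Integrable fun w => k (z - w) • f w := by
  have := hf.integrable_smul_left_of_hasCompactSupport (g := fun w => k (z - w))
    (by fun_prop) ?_
  · exact this
  · exact hkc.comp_homeomorph (Homeomorph.subLeft z)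

theorem fderiv_mollify [CompleteSpace F] {f : V → F} (hf : LocallyIntegrable f) (z v : V) :
    fderiv ℝ (mollify κ f) z v = ∫ w, fderiv ℝ (κ.normed volume) (z - w) v • f w := by
  have hk : ContDiff ℝ 1 (κ.normed (volume : Measure V)) := κ.contDiff_normed
  have h := κ.hasCompactSupport_normed.hasFDerivAt_convolution_left
    (ContinuousLinearMap.lsmul ℝ ℝ) hk hf z
  rw [← mollify_eq_convolution] at h
  rw [h.fderiv, convolution_eq_swap, ContinuousLinearMap.integral_apply]
  · rfl
  · have hc := (κ.hasCompactSupport_normed (μ := volume)).fderiv (𝕜 := ℝ)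
    exact (hc.convolutionExists_left _ (hk.continuous_fderiv one_ne_zero) hf z).integrable_swap

theorem integral_bump_eq_one (κ : ContDiffBump (0 : V)) (z : V) :
    ∫ w, κ.normed volume (z - w) = 1 := by
  rw [integral_sub_left_eq_self (fun w => κ.normed volume w) volume z]
  exact κ.integral_normed

theorem ae_tendsto_mollify [CompleteSpace F] {κ : ℕ → ContDiffBump (0 : V)} {K : ℝ}
    (hκ : Tendsto (fun m => (κ m).rOut) atTop (𝓝 0)) (hκ' : ∀ m, (κ m).rOut ≤ K * (κ m).rIn)
    {f : V → F} (hf : LocallyIntegrable f) :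
    ∀ᵐ z, Tendsto (fun m => mollify (κ m) f z) atTop (𝓝 (f z)) := by
  simp only [mollify_eq_convolution]
  exact ContDiffBump.ae_convolution_tendsto_right_of_locallyIntegrable hκ
    (Eventually.of_forall hκ') hf

theorem integrable_mollify {f : V → ℝ} (hf : Integrable f) : Integrable (mollify κ f) := by
  rw [mollify_eq_convolution]
  exact κ.integrable_normed.integrable_convolution _ hf

theorem integral_mollify {f : V → ℝ} (hf : Integrable f) : ∫ z, mollify κ f z = ∫ z, f z := by
  rw [mollify_eq_convolution, integral_convolution _ κ.integrable_normed hf, κ.integral_normed]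
  simp

theorem mollify_mono {f h : V → ℝ} (hf : LocallyIntegrable f) (hh : LocallyIntegrable h)
    (hfh : ∀ z, f z ≤ h z) (z : V) : mollify κ f z ≤ mollify κ h z :=
  integral_mono (integrable_bump_smul hf κ.continuous_normed κ.hasCompactSupport_normed z)
    (integrable_bump_smul hh κ.continuous_normed κ.hasCompactSupport_normed z)
    fun w => mul_le_mul_of_nonneg_left (hfh w) (κ.nonneg_normed _)

theorem mollify_nonneg {f : V → ℝ} (hf : ∀ z, 0 ≤ f z) (z : V) : 0 ≤ mollify κ f z :=
  integral_nonneg fun w => mul_nonneg (κ.nonneg_normed _) (hf w)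

theorem mollify_add {f h : V → F} [CompleteSpace F] (hf : LocallyIntegrable f)
    (hh : LocallyIntegrable h) (z : V) :
    mollify κ (fun w => f w + h w) z = mollify κ f z + mollify κ h z := by
  simp only [mollify, smul_add]
  exact integral_add (integrable_bump_smul hf κ.continuous_normed κ.hasCompactSupport_normed z)
    (integrable_bump_smul hh κ.continuous_normed κ.hasCompactSupport_normed z)

theorem mollify_const_mul {f : V → ℝ} (c : ℝ) (z : V) :
    mollify κ (fun w => c * f w) z = c * mollify κ f z := by
  simp only [mollify, smul_eq_mul, ← integral_const_mul]
  congr 1; ext w; ring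

theorem mollify_const (c : ℝ) (z : V) : mollify κ (fun _ => c) z = c := by
  simp only [mollify, smul_eq_mul]
  rw [integral_mul_const, integral_bump_eq_one, one_mul]

theorem norm_mollify_le (f : V → F) (z : V) :
    ‖mollify κ f z‖ ≤ mollify κ (fun w => ‖f w‖) z := by
  refine (norm_integral_le_integral_norm _).trans (le_of_eq ?_)
  congr 1; ext w
  rw [norm_smul, Real.norm_of_nonneg (κ.nonneg_normed _), smul_eq_mul]

/-- Jensen's inequality for a function admitting an affine minorant touching at `mollify κ f z`. -/
theorem le_mollify_of_tangent {φ f : V → ℝ} {c a z}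
    (hf : LocallyIntegrable f) (hφ : LocallyIntegrable φ)
    (h : ∀ w, c + a * (f w - mollify κ f z) ≤ φ w) : c ≤ mollify κ φ z := by
  have hl : LocallyIntegrable (fun _ : V => c - a * mollify κ f z) := locallyIntegrable_const _
  have hl' : LocallyIntegrable (fun w => a * f w) := hf.smul a
  have h1 := mollify_mono (κ := κ) (hl'.add hl) hφ (fun w => by
    have := h w
    show a * f w + (c - a * mollify κ f z) ≤ φ w
    linarith) z
  have h2 := mollify_add (κ := κ) hl' hl z
  rw [mollify_const_mul, mollify_const] at h2
  calc c = a * mollify κ f z + (c - a * mollify κ f z) := by ring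
    _ = _ := h2.symm
    _ ≤ _ := h1

end Mollification

instance isAddHaarMeasure_volume_prod (n : ℕ) :
    (volume : Measure (EuclideanSpace ℝ (Fin n) × ℝ)).IsAddHaarMeasure :=
  inferInstanceAs ((volume : Measure (EuclideanSpace ℝ (Fin n))).prod
    (volume : Measure ℝ)).IsAddHaarMeasure

end ParabolicOrlicz

namespace ParabolicOrlicz
open Filter Topology

/-! ### Smooth approximation of weak subsolutions -/

/-- Euclidean space of dimension `n`. -/
abbrev Euc (n : ℕ) : Type := EuclideanSpace ℝ (Fin n)

section Approximation

variable {n : ℕ}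

/-- The spatial gradient of a function of `(x, t)`. -/
noncomputable def spaceGrad (f : Euc n × ℝ → ℝ) (z : Euc n × ℝ) : Euc n := gradient (fun y => f (y, z.2)) z.1

/-- The spatial divergence of a vector field depending on `(x, t)`. -/
noncomputable def spaceDiv (F : Euc n × ℝ → Euc n) (z : Euc n × ℝ) : ℝ :=
  ∑ i, (fderiv ℝ F z (EuclideanSpace.single i 1, 0)) i

theorem inner_spaceGrad {f : Euc n × ℝ → ℝ} {z : Euc n × ℝ} (hf : DifferentiableAt ℝ f z) (v : Euc n) :
    inner ℝ (spaceGrad f z) v = fderiv ℝ f z (v, 0) := by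
  have h : HasFDerivAt (fun y => f (y, z.2))
      ((fderiv ℝ f z).comp (ContinuousLinearMap.inl ℝ (Euc n) ℝ)) z.1 :=
    HasFDerivAt.comp z.1 (g := f) (hf.hasFDerivAt) (hasFDerivAt_prodMk_left z.1 z.2)
  rw [spaceGrad, gradient, InnerProductSpace.toDual_symm_apply, h.fderiv]
  rfl

theorem spaceGrad_eq_of_inner {f : Euc n × ℝ → ℝ} {z : Euc n × ℝ} (hf : DifferentiableAt ℝ f z) {w : (Euc n)}
    (h : ∀ v, fderiv ℝ f z (v, 0) = inner ℝ w v) : spaceGrad f z = w :=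
  ext_inner_right ℝ fun v => by rw [inner_spaceGrad hf, h]

variable {κ : ContDiffBump (0 : Euc n × ℝ)}

/-- The test function `w ↦ κ (z - w)`. -/
noncomputable def reflBump (κ : ContDiffBump (0 : Euc n × ℝ)) (z w : Euc n × ℝ) : ℝ :=
  κ.normed volume (z - w)

theorem contDiff_reflBump (z : Euc n × ℝ) : ContDiff ℝ ∞ (reflBump κ z) :=
  κ.contDiff_normed.comp (contDiff_const.sub contDiff_id)

theorem hasCompactSupport_reflBump (z : Euc n × ℝ) : HasCompactSupport (reflBump κ z) :=
  (κ.hasCompactSupport_normed (μ := volume)).comp_homeomorph (Homeomorph.subLeft z)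

theorem tsupport_reflBump_subset (z : Euc n × ℝ) :
    tsupport (reflBump κ z) ⊆ Metric.closedBall z κ.rOut := by
  refine closure_minimal (fun w hw => ?_) Metric.isClosed_closedBall
  have h : z - w ∈ Function.support (κ.normed volume) := hw
  rw [κ.support_normed_eq, Metric.mem_ball, dist_zero_right] at h
  rw [Metric.mem_closedBall, dist_comm, dist_eq_norm]
  exact h.le

theorem isTestFunction_reflBump {z : Euc n × ℝ} {S : Set (Euc n × ℝ)}
    (hS : Metric.closedBall z κ.rOut ⊆ S) : IsTestFunction S (reflBump κ z) :=
  ⟨contDiff_reflBump z, hasCompactSupport_reflBump z, (tsupport_reflBump_subset z).trans hS⟩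

theorem fderiv_reflBump (z w v : Euc n × ℝ) :
    fderiv ℝ (reflBump κ z) w v = -fderiv ℝ (κ.normed volume) (z - w) v := by
  have h1 : HasFDerivAt (κ.normed (volume : Measure (Euc n × ℝ)))
      (fderiv ℝ (κ.normed volume) (z - w)) (z - w) :=
    ((κ.contDiff_normed (n := 1)).differentiable one_ne_zero _).hasFDerivAt
  have h2 : HasFDerivAt (fun w : Euc n × ℝ => z - w) (-ContinuousLinearMap.id ℝ (Euc n × ℝ)) w :=
    (hasFDerivAt_id w).const_sub z
  rw [show reflBump κ z = κ.normed volume ∘ fun w => z - w from rfl, (h1.comp w h2).fderiv]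
  simp

theorem reflBump_eq_zero {z w : Euc n × ℝ} {S : Set (Euc n × ℝ)}
    (hS : Metric.closedBall z κ.rOut ⊆ S) (hw : w ∉ S) : reflBump κ z w = 0 :=
  image_eq_zero_of_notMem_tsupport fun h => hw (hS (tsupport_reflBump_subset z h))

/-- This makes cutting off by the indicator of S harmless at points whose mollification ball lies in
S. -/
theorem fderiv_bump_eq_zero {z w : Euc n × ℝ} {S : Set (Euc n × ℝ)}
    (hS : Metric.closedBall z κ.rOut ⊆ S) (hw : w ∉ S) (v : Euc n × ℝ) :
    fderiv ℝ (κ.normed volume) (z - w) v = 0 := by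
  have h : fderiv ℝ (reflBump κ z) w = 0 := by
    by_contra hne
    exact hw (hS (tsupport_reflBump_subset z (support_fderiv_subset ℝ hne)))
  have := fderiv_reflBump (κ := κ) z w v
  rw [h] at this
  simpa using this.symm

theorem spaceGrad_reflBump_inner (z w : Euc n × ℝ) (v : Euc n) :
    inner ℝ v (gradient (fun y => reflBump κ z (y, w.2)) w.1)
      = -fderiv ℝ (κ.normed volume) (z - w) (v, 0) := by
  rw [real_inner_comm]
  have := inner_spaceGrad (f := reflBump κ z) (z := w)
    (((contDiff_reflBump z).differentiable (by simp)) w) v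
  rw [fderiv_reflBump] at this
  exact this

theorem deriv_reflBump (z w : Euc n × ℝ) :
    deriv (fun s => reflBump κ z (w.1, s)) w.2
      = -fderiv ℝ (κ.normed volume) (z - w) (0, 1) := by
  have hd : DifferentiableAt ℝ (reflBump κ z) (w.1, w.2) :=
    ((contDiff_reflBump z).differentiable (by simp)) w
  have h2 : HasDerivAt (fun s : ℝ => (w.1, s)) ((0 : Euc n), (1 : ℝ)) w.2 :=
    (hasDerivAt_const w.2 w.1).prodMk (hasDerivAt_id w.2)
  rw [show (fun s => reflBump κ z (w.1, s)) = reflBump κ z ∘ fun s => (w.1, s) from rfl,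
    (hd.hasFDerivAt.comp_hasDerivAt w.2 h2).deriv, fderiv_reflBump]

theorem continuous_fderiv_bump (v : Euc n × ℝ) :
    Continuous fun w => fderiv ℝ (κ.normed (volume : Measure (Euc n × ℝ))) w v :=
  ((κ.contDiff_normed (n := 1)).continuous_fderiv one_ne_zero).clm_apply continuous_const

theorem hasCompactSupport_fderiv_bump (v : Euc n × ℝ) :
    HasCompactSupport fun w => fderiv ℝ (κ.normed (volume : Measure (Euc n × ℝ))) w v :=
  (κ.hasCompactSupport_normed (μ := volume)).fderiv_apply (𝕜 := ℝ) v

/-- All derivatives fall on the kernel; up to sign the result is the flux term of the weak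
formulation tested with `reflBump`. -/
theorem spaceDiv_mollify {Φ : Euc n × ℝ → Euc n} (hΦ : LocallyIntegrable Φ) (z : Euc n × ℝ) :
    spaceDiv (mollify κ Φ) z = ∫ w, fderiv ℝ (κ.normed volume) (z - w) (Φ w, 0) := by
  have hint : ∀ v, Integrable fun w => fderiv ℝ (κ.normed volume) (z - w) v • Φ w := fun v =>
    integrable_bump_smul hΦ (continuous_fderiv_bump v) (hasCompactSupport_fderiv_bump v) z
  have h1 : ∀ i, (∫ w, fderiv ℝ (κ.normed volume) (z - w) (EuclideanSpace.single i 1, 0) • Φ w) i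
      = ∫ w, fderiv ℝ (κ.normed volume) (z - w) (EuclideanSpace.single i 1, 0) * Φ w i := by
    intro i
    have := ContinuousLinearMap.integral_comp_comm (EuclideanSpace.proj (𝕜 := ℝ) i)
      (hint (EuclideanSpace.single i 1, 0))
    simpa using this.symm
  simp only [spaceDiv, fderiv_mollify hΦ, h1]
  rw [← integral_finsetSum]
  · congr 1
    ext w
    have e : ((Φ w, 0) : Euc n × ℝ) = ∑ i, Φ w i • ((EuclideanSpace.single i (1 : ℝ), 0) : Euc n × ℝ) := by
      ext j
      · simp [Prod.fst_sum, Finset.sum_apply, Pi.single_apply]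
      · simp [Prod.snd_sum]
    rw [e, map_sum]
    refine Finset.sum_congr rfl fun i _ => ?_
    rw [map_smul, smul_eq_mul, mul_comm]
  · intro i _
    have := (EuclideanSpace.proj (𝕜 := ℝ) i).integrable_comp
      (hint (EuclideanSpace.single i 1, 0))
    simpa using this

/-- The reflected kernel centred at z is an admissible test function. Reflection changes the sign of
both derivatives, and the weak inequality becomes the pointwise one at z. -/
theorem mollify_subsolution {A : Euc n → Euc n} {Ω : Set (Euc n)} {T : ℝ} {u : Euc n × ℝ → ℝ} {Du : Euc n × ℝ → Euc n}
    (hΩ : MeasurableSet Ω)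
    (hsub : ∀ η : Euc n × ℝ → ℝ, IsTestFunction (Ω ×ˢ Ioo 0 T) η → (∀ z, 0 ≤ η z) →
      -(∫ z in Ω ×ˢ Ioo 0 T, u z * deriv (fun s => η (z.1, s)) z.2)
        + ∫ z in Ω ×ˢ Ioo 0 T, inner ℝ (A (Du z)) (gradient (fun y => η (y, z.2)) z.1) ≤ 0)
    {S : Set (Euc n × ℝ)} (hSΩ : S ⊆ Ω ×ˢ Ioo 0 T)
    (hu : Integrable (S.indicator u)) (hA : Integrable (S.indicator fun z => A (Du z)))
    {z : Euc n × ℝ} (hz : Metric.closedBall z κ.rOut ⊆ S) :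
    fderiv ℝ (mollify κ (S.indicator u)) z (0, 1)
      ≤ spaceDiv (mollify κ (S.indicator fun z => A (Du z))) z := by
  have h := hsub (reflBump κ z) (isTestFunction_reflBump (hz.trans hSΩ))
    (fun w => κ.nonneg_normed _)
  have hmeas : MeasurableSet (Ω ×ˢ Ioo (0 : ℝ) T) := hΩ.prod measurableSet_Ioo
  rw [fderiv_mollify hu.locallyIntegrable, spaceDiv_mollify hA.locallyIntegrable]
  rw [← integral_indicator hmeas, ← integral_indicator hmeas] at h
  have e1 : ∀ w, (Ω ×ˢ Ioo (0 : ℝ) T).indicator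
      (fun w => u w * deriv (fun s => reflBump κ z (w.1, s)) w.2) w
      = -(fderiv ℝ (κ.normed volume) (z - w) (0, 1) • S.indicator u w) := by
    intro w
    by_cases hw : w ∈ S
    · rw [indicator_of_mem (hSΩ hw), indicator_of_mem hw, deriv_reflBump, smul_eq_mul]; ring
    · rw [indicator_of_notMem hw, smul_zero, neg_zero]
      by_cases hw' : w ∈ Ω ×ˢ Ioo (0 : ℝ) T
      · rw [indicator_of_mem hw', deriv_reflBump, fderiv_bump_eq_zero hz hw]; simp
      · rw [indicator_of_notMem hw']
  have e2 : ∀ w, (Ω ×ˢ Ioo (0 : ℝ) T).indicator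
      (fun w => inner ℝ (A (Du w)) (gradient (fun y => reflBump κ z (y, w.2)) w.1)) w
      = -(fderiv ℝ (κ.normed volume) (z - w) (S.indicator (fun z => A (Du z)) w, 0)) := by
    intro w
    by_cases hw : w ∈ S
    · rw [indicator_of_mem (hSΩ hw), indicator_of_mem hw, spaceGrad_reflBump_inner]
    · rw [fderiv_bump_eq_zero hz hw, neg_zero]
      by_cases hw' : w ∈ Ω ×ˢ Ioo (0 : ℝ) T
      · rw [indicator_of_mem hw', spaceGrad_reflBump_inner, fderiv_bump_eq_zero hz hw, neg_zero]
      · rw [indicator_of_notMem hw']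
  simp only [e1, e2, integral_neg] at h
  linarith

theorem spaceGrad_mollify {D : Set (Euc n)} {I : Set ℝ} (hD : MeasurableSet D) (hI : MeasurableSet I)
    {u : Euc n × ℝ → ℝ} {Du : Euc n × ℝ → Euc n}
    (hu : IntegrableOn u (D ×ˢ I)) (hDu : IntegrableOn Du (D ×ˢ I))
    (hw : ∀ᵐ t ∂(volume.restrict I), HasWeakGradient D (fun x => u (x, t)) (fun x => Du (x, t)))
    {z : Euc n × ℝ} (hz : Metric.closedBall z κ.rOut ⊆ D ×ˢ I) :
    spaceGrad (mollify κ ((D ×ˢ I).indicator u)) z = mollify κ ((D ×ˢ I).indicator Du) z := by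
  have hS : MeasurableSet (D ×ˢ I) := hD.prod hI
  have hu' : Integrable ((D ×ˢ I).indicator u) := (integrable_indicator_iff hS).2 hu
  have hDu' : Integrable ((D ×ˢ I).indicator Du) := (integrable_indicator_iff hS).2 hDu
  have hdiff : DifferentiableAt ℝ (mollify κ ((D ×ˢ I).indicator u)) z :=
    (contDiff_mollify hu'.locallyIntegrable).differentiable one_ne_zero z
  have hgc : Continuous fun w : Euc n × ℝ => gradient (fun y => reflBump κ z (y, w.2)) w.1 := by
    have e : (fun w : Euc n × ℝ => gradient (fun y => reflBump κ z (y, w.2)) w.1)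
        = fun w => (InnerProductSpace.toDual ℝ (Euc n)).symm
          ((fderiv ℝ (reflBump κ z) w).comp (ContinuousLinearMap.inl ℝ (Euc n) ℝ)) := by
      ext1 w
      refine ext_inner_right ℝ fun v => ?_
      rw [InnerProductSpace.toDual_symm_apply]
      exact inner_spaceGrad (f := reflBump κ z) (((contDiff_reflBump z).differentiable (by simp)) w) v
    rw [e]
    refine (LinearIsometryEquiv.continuous _).comp ?_
    exact (((contDiff_reflBump z).continuous_fderiv (by simp))).clm_comp continuous_const
  have hgs : HasCompactSupport fun w : Euc n × ℝ => gradient (fun y => reflBump κ z (y, w.2)) w.1 := by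
    refine (hasCompactSupport_reflBump (κ := κ) z).mono' (fun w hw => ?_)
    by_contra hn
    apply hw
    refine ext_inner_left ℝ fun v => ?_
    rw [spaceGrad_reflBump_inner, ← fderiv_reflBump, inner_zero_right,
      image_eq_zero_of_notMem_tsupport fun h => hn (tsupport_fderiv_subset ℝ h)]
    rfl
  have hi1 : Integrable (fun w => u w • gradient (fun y => reflBump κ z (y, w.2)) w.1)
      ((volume.restrict D).prod (volume.restrict I)) := by
    rw [Measure.prod_restrict]
    have := hu'.locallyIntegrable.integrable_smul_right_of_hasCompactSupport hgc hgs
    rw [← Measure.volume_eq_prod]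
    refine (this.integrableOn (s := D ×ˢ I)).congr_fun (fun w hw => ?_) hS
    simp only [indicator_of_mem hw]
  have hi2 : Integrable (fun w => reflBump κ z w • Du w)
      ((volume.restrict D).prod (volume.restrict I)) := by
    rw [Measure.prod_restrict]
    have := hDu'.locallyIntegrable.integrable_smul_left_of_hasCompactSupport
      (contDiff_reflBump (κ := κ) z).continuous (hasCompactSupport_reflBump z)
    rw [← Measure.volume_eq_prod]
    refine (this.integrableOn (s := D ×ˢ I)).congr_fun (fun w hw => ?_) hS
    simp only [indicator_of_mem hw]
  -- The weak gradient is given only on almost every time slice, so Fubini is applied and the slice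
  -- of the kernel serves as test function.
  have key : ∫ w in D ×ˢ I, u w • gradient (fun y => reflBump κ z (y, w.2)) w.1
      = -∫ w in D ×ˢ I, reflBump κ z w • Du w := by
    rw [Measure.volume_eq_prod, ← Measure.prod_restrict, integral_prod_symm _ hi1,
      integral_prod_symm _ hi2, ← integral_neg]
    refine integral_congr_ae ?_
    filter_upwards [hw] with t ht
    by_cases hemp : ∃ y, (y, t) ∈ Metric.closedBall z κ.rOut
    · obtain ⟨y₀, hy₀⟩ := hemp
      refine ht (fun y => reflBump κ z (y, t)) ⟨?_, ?_, ?_⟩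
      · exact (contDiff_reflBump z).comp (contDiff_id.prodMk contDiff_const)
      · refine HasCompactSupport.intro (isCompact_closedBall z.1 κ.rOut) fun y hy => ?_
        refine reflBump_eq_zero Subset.rfl fun h => hy ?_
        exact (le_max_left _ _).trans (Metric.mem_closedBall.1 h)
      · intro y hy
        have : (y, t) ∈ tsupport (reflBump κ z) := by
          have h1 : Continuous fun y : Euc n => (y, t) := by fun_prop
          exact tsupport_comp_subset_preimage (reflBump κ z) h1 hy
        exact (hz (tsupport_reflBump_subset z this)).1
    · have h0 : (fun y => reflBump κ z (y, t)) = fun _ => 0 := by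
        ext y
        exact reflBump_eq_zero Subset.rfl fun h => hemp ⟨y, h⟩
      have h1 : ∀ y, reflBump κ z (y, t) = 0 := fun y => congrFun h0 y
      simp [h1, gradient]
  refine spaceGrad_eq_of_inner hdiff fun v => ?_
  rw [fderiv_mollify hu'.locallyIntegrable]
  have e3 : mollify κ ((D ×ˢ I).indicator Du) z = ∫ w in D ×ˢ I, reflBump κ z w • Du w := by
    rw [← integral_indicator hS]
    refine integral_congr_ae (Eventually.of_forall fun w => ?_)
    by_cases hw : w ∈ D ×ˢ I
    · simp only [indicator_of_mem hw]; rfl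
    · simp only [indicator_of_notMem hw, smul_zero]
  have e4 : ∫ w, fderiv ℝ (κ.normed volume) (z - w) (v, 0) • (D ×ˢ I).indicator u w
      = -∫ w in D ×ˢ I, inner ℝ v (u w • gradient (fun y => reflBump κ z (y, w.2)) w.1) := by
    rw [← integral_indicator hS, ← integral_neg]
    refine integral_congr_ae (Eventually.of_forall fun w => ?_)
    by_cases hw : w ∈ D ×ˢ I
    · simp only [indicator_of_mem hw, inner_smul_right, spaceGrad_reflBump_inner, smul_eq_mul]
      ring
    · simp only [indicator_of_notMem hw, smul_zero, neg_zero]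
  rw [e4, e3, real_inner_comm]
  rw [Measure.prod_restrict, ← Measure.volume_eq_prod] at hi1
  rw [integral_inner hi1 v, key, inner_neg_right, neg_neg]

end Approximation

end ParabolicOrlicz

namespace ParabolicOrlicz
open Filter Topology

/-! ### Construction of the approximating sequence. -/

section Approximation

variable {n : ℕ}

/-- `C¹` pointwise subsolutions `um` with fluxes `Fm` converging to `u`, `Du`, `F` on `K`, together
with dominating functions `Mm` that converge in `L¹(K)`. -/
structure SmoothApprox (G : ℝ → ℝ) (K : Set (Euc n × ℝ)) (u : Euc n × ℝ → ℝ)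
    (Du F : Euc n × ℝ → Euc n) (um : ℕ → Euc n × ℝ → ℝ) (Fm : ℕ → Euc n × ℝ → Euc n)
    (M : Euc n × ℝ → ℝ) (Mm : ℕ → Euc n × ℝ → ℝ) : Prop where
  contDiff_fun : ∀ m, ContDiff ℝ 1 (um m)
  contDiff_flux : ∀ m, ContDiff ℝ 1 (Fm m)
  subsolution : ∀ m, ∀ z ∈ K, fderiv ℝ (um m) z (0, 1) ≤ spaceDiv (Fm m) z
  tendsto_fun : ∀ᵐ z ∂(volume.restrict K), Tendsto (fun m => um m z) atTop (𝓝 (u z))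
  tendsto_grad : ∀ᵐ z ∂(volume.restrict K),
    Tendsto (fun m => spaceGrad (um m) z) atTop (𝓝 (Du z))
  tendsto_flux : ∀ᵐ z ∂(volume.restrict K), Tendsto (fun m => Fm m z) atTop (𝓝 (F z))
  sq_le : ∀ m, ∀ z ∈ K, um m z ^ 2 ≤ Mm m z
  prim_le : ∀ m, ∀ z ∈ K, G |um m z| ≤ Mm m z
  prim_grad_le : ∀ m, ∀ z ∈ K, G ‖spaceGrad (um m) z‖ ≤ Mm m z
  flux_mul_le : ∀ m, ∀ z ∈ K, ‖Fm m z‖ * |um m z| ≤ Mm m z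
  flux_mul_grad_le : ∀ m, ∀ z ∈ K, ‖Fm m z‖ * ‖spaceGrad (um m) z‖ ≤ Mm m z
  integrable_dom : ∀ m, IntegrableOn (Mm m) K
  integrable_lim : IntegrableOn M K
  tendsto_dom : ∀ᵐ z ∂(volume.restrict K), Tendsto (fun m => Mm m z) atTop (𝓝 (M z))
  tendsto_integral : Tendsto (fun m => ∫ z in K, |Mm m z - M z|) atTop (𝓝 0)

theorem prim_norm_mollify_le {V H : Type*} [NormedAddCommGroup V] [NormedSpace ℝ V]
    [FiniteDimensional ℝ V] [MeasureSpace V] [BorelSpace V] [(volume : Measure V).IsAddHaarMeasure]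
    [NormedAddCommGroup H] [NormedSpace ℝ H] {κ : ContDiffBump (0 : V)}
    {g₀ g₁ : ℝ} {g G : ℝ → ℝ} (Y : YoungPair g₀ g₁ g G) {f : V → H} (hf : Integrable f)
    (hG : Integrable fun w => G ‖f w‖) (z : V) :
    G ‖mollify κ f z‖ ≤ mollify κ (fun w => G ‖f w‖) z :=
  (Y.prim_monotone (norm_mollify_le f z)).trans
    (le_mollify_of_tangent hf.norm.locallyIntegrable hG.locallyIntegrable
      fun _ => Y.tangent_le _ _)

/-- Young's inequality is applied inside the average with b frozen. Taking b to be the modulus of a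
mollified function at z, a product of two mollifications is bounded by mollifications of G once
Jensen is applied to G(b). -/
theorem norm_mollify_mul_le {V H H' : Type*} [NormedAddCommGroup V] [NormedSpace ℝ V]
    [FiniteDimensional ℝ V] [MeasureSpace V] [BorelSpace V] [(volume : Measure V).IsAddHaarMeasure]
    [NormedAddCommGroup H] [NormedSpace ℝ H] [NormedAddCommGroup H'] {κ : ContDiffBump (0 : V)}
    {g₀ g₁ : ℝ} {g G : ℝ → ℝ} (Y : YoungPair g₀ g₁ g G) (h1 : 0 ≤ g₁) {f : V → H} {w : V → H'}
    {C b : ℝ} (hC : 0 ≤ C) (hb : 0 ≤ b)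
    (hf : Integrable f) (hfw : ∀ z, ‖f z‖ ≤ C * g ‖w z‖)
    (hG : Integrable fun z => G ‖w z‖) (z : V) :
    ‖mollify κ f z‖ * b ≤ C * g₁ * (mollify κ (fun z => G ‖w z‖) z + G b) := by
  have hc : LocallyIntegrable (fun _ : V => G b) := locallyIntegrable_const _
  calc ‖mollify κ f z‖ * b ≤ mollify κ (fun w => ‖f w‖) z * b :=
        mul_le_mul_of_nonneg_right (norm_mollify_le f z) hb
    _ = mollify κ (fun w => b * ‖f w‖) z := by rw [mollify_const_mul, mul_comm]
    _ ≤ mollify κ (fun z => C * g₁ * (G ‖w z‖ + G b)) z := by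
        refine mollify_mono (hf.norm.const_mul b).locallyIntegrable
          ((hG.locallyIntegrable.add hc).smul (C * g₁)) (fun z => ?_) z
        calc b * ‖f z‖ ≤ b * (C * g ‖w z‖) := mul_le_mul_of_nonneg_left (hfw z) hb
          _ = C * (g ‖w z‖ * b) := by ring
          _ ≤ C * (g₁ * (G ‖w z‖ + G b)) := mul_le_mul_of_nonneg_left (Y.mul_le_add h1 hb) hC
          _ = C * g₁ * (G ‖w z‖ + G b) := by ring
    _ = _ := by
        rw [mollify_const_mul, mollify_add hG.locallyIntegrable hc, mollify_const]

/-- Jensen's inequality with the tangent line of the square at the mollified value. -/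
theorem sq_mollify_le {V : Type*} [NormedAddCommGroup V] [NormedSpace ℝ V]
    [FiniteDimensional ℝ V] [MeasureSpace V] [BorelSpace V] [(volume : Measure V).IsAddHaarMeasure]
    {κ : ContDiffBump (0 : V)} {f : V → ℝ} (hf : Integrable f)
    (hf2 : Integrable fun w => f w ^ 2) (z : V) :
    mollify κ f z ^ 2 ≤ mollify κ (fun w => f w ^ 2) z :=
  le_mollify_of_tangent (a := 2 * mollify κ f z) hf.locallyIntegrable hf2.locallyIntegrable
    fun w => by nlinarith [sq_nonneg (f w - mollify κ f z)]

theorem integrableOn_sq_of_eLpNorm_le {D : Set (Euc n)} {I : Set ℝ} {u : Euc n × ℝ → ℝ}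
    (hI : volume I ≠ ⊤) (hu : AEStronglyMeasurable u (volume.restrict (D ×ˢ I))) {M : NNReal}
    (hM : ∀ᵐ t ∂(volume.restrict I), eLpNorm (fun x => u (x, t)) 2 (volume.restrict D) ≤ M) :
    IntegrableOn (fun z => u z ^ 2) (D ×ˢ I) := by
  refine ⟨hu.pow 2, ?_⟩
  rw [hasFiniteIntegral_iff_enorm]
  have hm : volume.restrict (D ×ˢ I)
      = (volume.restrict D).prod (volume.restrict I : Measure ℝ) := by
    rw [Measure.prod_restrict]; rfl
  rw [hm] at hu ⊢
  have hu2 : AEMeasurable (fun z => ‖u z ^ 2‖ₑ)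
    ((volume.restrict D).prod (volume.restrict I)) := (hu.pow 2).enorm
  rw [lintegral_prod_symm _ hu2]
  have hle : ∀ᵐ t ∂(volume.restrict I),
      ∫⁻ x in D, ‖u (x, t) ^ 2‖ₑ ≤ (M : ENNReal) ^ (2 : ℝ) := by
    filter_upwards [hM] with t ht
    rw [eLpNorm_eq_lintegral_rpow_enorm_toReal (by norm_num) (by norm_num)] at ht
    have h2 := ENNReal.rpow_le_rpow ht (by norm_num : (0 : ℝ) ≤ 2)
    rw [← ENNReal.rpow_mul] at h2
    norm_num at h2
    simpa [enorm_pow] using h2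
  calc _ ≤ ∫⁻ _ in I, (M : ENNReal) ^ (2 : ℝ) := lintegral_mono_ae hle
    _ = (M : ENNReal) ^ (2 : ℝ) * volume I := by
        rw [lintegral_const, Measure.restrict_apply_univ]
    _ < ⊤ := ENNReal.mul_lt_top (ENNReal.rpow_lt_top_of_nonneg (by norm_num) (by simp))
        hI.lt_top

theorem exists_smoothApprox {g₀ g₁ ν L : ℝ} {g : ℝ → ℝ} {A : Euc n → Euc n} {Ω : Set (Euc n)}
    {T : ℝ} {u : Euc n × ℝ → ℝ} (h1 : 1 < g₀) (h01 : g₀ ≤ g₁) (hL : 0 ≤ L)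
    (hg : OrliczCondition g₀ g₁ g) (hA : StructureCondition ν L g A) (hΩ : IsOpen Ω)
    {Du : Euc n × ℝ → Euc n} (hV : MemV2GLoc g Ω T u Du)
    (hsub : ∀ η : Euc n × ℝ → ℝ, IsTestFunction (Ω ×ˢ Ioo 0 T) η → (∀ z, 0 ≤ η z) →
      -(∫ z in Ω ×ˢ Ioo 0 T, u z * deriv (fun s => η (z.1, s)) z.2)
        + ∫ z in Ω ×ˢ Ioo 0 T, inner ℝ (A (Du z)) (gradient (fun y => η (y, z.2)) z.1) ≤ 0)
    {K₀ : Set (Euc n)} {a b : ℝ} (hK : IsCompact K₀) (hKΩ : K₀ ⊆ Ω) (ha : 0 < a) (hab : a ≤ b)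
    (hb : b < T) :
    ∃ um Fm M Mm, SmoothApprox (primitive (extZero g)) (K₀ ×ˢ Icc a b) u Du
      (fun z => A (Du z) - A 0) um Fm M Mm := by
  have Y := hg.youngPair h1
  set G := primitive (extZero g) with hGdef
  have hg1 : 0 ≤ g₁ := by linarith
  -- Room is left around K₀ in space, and below as well as above [a, b] in time, so that small balls
  -- about points of the cylinder stay in S.
  obtain ⟨δ, hδ, hδΩ⟩ := hK.exists_cthickening_subset_open hΩ hKΩ
  set D := Metric.thickening δ K₀ with hDdef
  have hDo : IsOpen D := Metric.isOpen_thickening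
  have hcl : closure D ⊆ Metric.cthickening δ K₀ := Metric.closure_thickening_subset_cthickening _ _
  have hDb : Bornology.IsBounded D := hK.isBounded.thickening
  have hDc : IsCompact (closure D) := Metric.isCompact_of_isClosed_isBounded isClosed_closure
    hDb.closure
  set I := Ioo (a / 2) ((b + T) / 2) with hIdef
  have hmem : MemV2G g D I u Du := hV D _ _ hDo hDc (hcl.trans hδΩ) (by linarith) (by linarith)
    (by linarith)
  set S := D ×ˢ I with hSdef
  have hSo : IsOpen S := hDo.prod isOpen_Ioo
  have hSm : MeasurableSet S := hSo.measurableSet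
  have hSΩ : S ⊆ Ω ×ˢ Ioo 0 T := by
    refine prod_mono (subset_closure.trans (hcl.trans hδΩ)) fun t ht => ⟨?_, ?_⟩
    · linarith [ht.1]
    · linarith [ht.2]
  have hSfin : volume S ≠ ⊤ := by
    refine ((hDb.prod (Metric.isBounded_Ioo _ _)).measure_lt_top).ne
  have hKc : IsCompact (K₀ ×ˢ Icc a b) := hK.prod isCompact_Icc
  have hKS : K₀ ×ˢ Icc a b ⊆ S := by
    refine prod_mono (Metric.self_subset_thickening hδ _) fun t ht => ⟨?_, ?_⟩
    · linarith [ht.1]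
    · linarith [ht.2]
  obtain ⟨ε, hε, hεS⟩ := hKc.exists_cthickening_subset_open hSo hKS
  have hball : ∀ z ∈ K₀ ×ˢ Icc a b, Metric.closedBall z ε ⊆ S := fun z hz =>
    (Metric.closedBall_subset_cthickening hz ε).trans hεS
  -- The ratio of outer to inner radius is fixed at 2, as the almost everywhere convergence requires
  -- it to be bounded.
  let κ : ℕ → ContDiffBump (0 : Euc n × ℝ) := fun m =>
    ⟨ε / (m + 1) / 2, ε / (m + 1), by positivity, half_lt_self (by positivity)⟩
  have hκε : ∀ m, (κ m).rOut ≤ ε := fun m => div_le_self hε.le (by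
    have : (0 : ℝ) ≤ m := m.cast_nonneg
    linarith)
  have hκ0 : Tendsto (fun m => (κ m).rOut) atTop (𝓝 0) := by
    have := tendsto_one_div_add_atTop_nhds_zero_nat (𝕜 := ℝ).const_mul ε
    simpa only [mul_one_div, mul_zero] using this
  have hκ2 : ∀ m, (κ m).rOut ≤ 2 * (κ m).rIn := fun m => by
    show ε / (m + 1) ≤ 2 * (ε / (m + 1) / 2)
    linarith
  have hz : ∀ m, ∀ z ∈ K₀ ×ˢ Icc a b, Metric.closedBall z (κ m).rOut ⊆ S := fun m z hzK =>
    (Metric.closedBall_subset_closedBall (hκε m)).trans (hball z hzK)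
  -- the extended functions
  set U := S.indicator u with hUdef
  set W := S.indicator Du with hWdef
  set Φ := S.indicator fun z => A (Du z) with hΦdef
  set Ψ := S.indicator fun z => A (Du z) - A 0 with hΨdef
  have hU : Integrable U := (integrable_indicator_iff hSm).2 hmem.integrable
  have hW : Integrable W := (integrable_indicator_iff hSm).2 hmem.integrable_grad
  have hGz : G 0 = 0 := Y.prim_zero_of_nonpos 0 le_rfl
  have hGU : Integrable fun w => G ‖U w‖ := by
    have e : (fun w => G ‖U w‖) = S.indicator fun w => primitive g ‖u w‖ := by
      ext w
      by_cases hw : w ∈ S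
      · simp only [hUdef, indicator_of_mem hw]; exact primitive_extZero (norm_nonneg _)
      · simp only [hUdef, indicator_of_notMem hw, norm_zero, hGz]
    rw [e]
    exact (integrable_indicator_iff hSm).2 hmem.memOrlicz.2
  have hGW : Integrable fun w => G ‖W w‖ := by
    have e : (fun w => G ‖W w‖) = S.indicator fun w => primitive g ‖Du w‖ := by
      ext w
      by_cases hw : w ∈ S
      · simp only [hWdef, indicator_of_mem hw]; exact primitive_extZero (norm_nonneg _)
      · simp only [hWdef, indicator_of_notMem hw, norm_zero, hGz]
    rw [e]
    exact (integrable_indicator_iff hSm).2 hmem.memOrlicz_grad.2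
  have hU2 : Integrable fun w => U w ^ 2 := by
    have e : (fun w => U w ^ 2) = S.indicator fun w => u w ^ 2 := by
      ext w
      by_cases hw : w ∈ S
      · simp only [hUdef, indicator_of_mem hw]
      · simp only [hUdef, indicator_of_notMem hw]; norm_num
    rw [e]
    obtain ⟨M, hM⟩ := hmem.bounded_L2
    exact (integrable_indicator_iff hSm).2 (integrableOn_sq_of_eLpNorm_le (by simp [hIdef])
      hmem.memOrlicz.1 hM)
  set C := L / (g₀ - 1) with hCdef
  have hC : 0 ≤ C := div_nonneg hL (by linarith)
  have hΨW : ∀ z, ‖Ψ z‖ ≤ C * extZero g ‖W z‖ := by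
    intro z
    by_cases hw : z ∈ S
    · simp only [hΨdef, hWdef, indicator_of_mem hw]
      exact hA.norm_sub_le Y hL h1 _
    · simp only [hΨdef, hWdef, indicator_of_notMem hw, norm_zero]
      exact mul_nonneg hC (Y.nonneg _)
  have hind : Integrable (S.indicator fun _ => (1 : ℝ)) :=
    (integrable_indicator_iff hSm).2 (integrableOn_const hSfin)
  have hΨ : Integrable Ψ := by
    have hb : Integrable fun z => C * (g₁ * (G ‖W z‖ + G 1 * S.indicator (fun _ => (1 : ℝ)) z)) :=
      ((hGW.add (hind.const_mul _)).const_mul _).const_mul _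
    refine hb.mono' ?_ (Eventually.of_forall fun z => ?_)
    · exact (aestronglyMeasurable_indicator_iff hSm).2
        ((hA.continuous.comp_aestronglyMeasurable hmem.memOrlicz_grad.1).sub
          aestronglyMeasurable_const)
    · by_cases hw : z ∈ S
      · refine (hΨW z).trans (mul_le_mul_of_nonneg_left ?_ hC)
        have := Y.mul_le_add hg1 (a := ‖W z‖) zero_le_one
        simpa [indicator_of_mem hw] using this
      · simp only [hΨdef, hWdef, indicator_of_notMem hw, norm_zero, hGz]
        simp
  have hΦ : Integrable Φ := by
    have e : Φ = fun z => Ψ z + S.indicator (fun _ => (1 : ℝ)) z • A 0 := by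
      ext1 z
      by_cases hw : z ∈ S
      · simp [hΦdef, hΨdef, indicator_of_mem hw]
      · simp [hΦdef, hΨdef, indicator_of_notMem hw]
    rw [e]
    exact hΨ.add (hind.smul_const _)
  -- The left form has the divergence of the mollified flux; the right form carries the growth
  -- bound. They agree where the kernel sees only S.
  have hflux : ∀ m, ∀ z ∈ K₀ ×ˢ Icc a b, mollify (κ m) Φ z - A 0 = mollify (κ m) Ψ z := by
    intro m z hzK
    have e : A 0 = ∫ w, (κ m).normed volume (z - w) • A 0 := by
      rw [integral_smul_const, integral_bump_eq_one, one_smul]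
    have hi : Integrable fun w => (κ m).normed volume (z - w) • A 0 :=
      integrable_bump_smul (locallyIntegrable_const (A 0)) (κ m).continuous_normed
        (κ m).hasCompactSupport_normed z
    conv_lhs => rw [e]
    unfold mollify
    rw [← integral_sub (integrable_bump_smul hΦ.locallyIntegrable (κ m).continuous_normed
        (κ m).hasCompactSupport_normed z) hi]
    refine integral_congr_ae (Eventually.of_forall fun w => ?_)
    by_cases hw : w ∈ S
    · simp only [hΦdef, hΨdef, indicator_of_mem hw, smul_sub]
    · have : (κ m).normed volume (z - w) = 0 := reflBump_eq_zero (hz m z hzK) hw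
      simp only [this, zero_smul, sub_zero]
  have hgrad : ∀ m, ∀ z ∈ K₀ ×ˢ Icc a b,
      spaceGrad (mollify (κ m) U) z = mollify (κ m) W z := fun m z hzK =>
    spaceGrad_mollify hDo.measurableSet measurableSet_Ioo hmem.integrable hmem.integrable_grad
      hmem.weakGradient (hz m z hzK)
  -- The 1 covers G(|uₘ|) and G(|Duₘ|). The term 2Cg₁ covers flux times gradient, where Young and
  -- Jensen produce the mollified G(|Du|) twice.
  set c := 1 + 2 * (C * g₁) with hcdef
  have hCg : 0 ≤ C * g₁ := mul_nonneg hC hg1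
  set M := fun z => c * (G ‖U z‖ + G ‖W z‖) + U z ^ 2 with hMdef
  have hGUW : Integrable fun z => c * (G ‖U z‖ + G ‖W z‖) := (hGU.add hGW).const_mul c
  have hMint : Integrable M := hGUW.add hU2
  have hMeq : ∀ m z, mollify (κ m) M z = c * (mollify (κ m) (fun z => G ‖U z‖) z
      + mollify (κ m) (fun z => G ‖W z‖) z) + mollify (κ m) (fun z => U z ^ 2) z := by
    intro m z
    rw [hMdef, mollify_add hGUW.locallyIntegrable hU2.locallyIntegrable]
    rw [mollify_const_mul, mollify_add hGU.locallyIntegrable hGW.locallyIntegrable]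
  have hn1 : ∀ m z, 0 ≤ mollify (κ m) (fun z => G ‖U z‖) z := fun m z =>
    mollify_nonneg (fun w => Y.prim_nonneg _) z
  have hn2 : ∀ m z, 0 ≤ mollify (κ m) (fun z => G ‖W z‖) z := fun m z =>
    mollify_nonneg (fun w => Y.prim_nonneg _) z
  have hn3 : ∀ m z, 0 ≤ mollify (κ m) (fun z => U z ^ 2) z := fun m z =>
    mollify_nonneg (fun w => sq_nonneg _) z
  have hjU : ∀ m z, G |mollify (κ m) U z| ≤ mollify (κ m) (fun z => G ‖U z‖) z := fun m z =>
    prim_norm_mollify_le Y hU hGU z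
  have hjW : ∀ m z, G ‖mollify (κ m) W z‖ ≤ mollify (κ m) (fun z => G ‖W z‖) z := fun m z =>
    prim_norm_mollify_le Y hW hGW z
  have hM0 : ∀ z, 0 ≤ M z := fun z => add_nonneg (mul_nonneg (by linarith)
    (add_nonneg (Y.prim_nonneg _) (Y.prim_nonneg _))) (sq_nonneg _)
  have hMt := ae_tendsto_mollify hκ0 hκ2 hMint.locallyIntegrable
  -- Mollification over the whole space preserves the integral of M, so Scheffé's lemma applies.
  have hML := tendsto_integral_abs_sub_of_integral_eq hMint (fun m => integrable_mollify (κ := κ m)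
    hMint) (fun m => Eventually.of_forall fun z => mollify_nonneg hM0 z)
    (Eventually.of_forall hM0) (fun m => integral_mollify hMint) hMt
  have hKm : MeasurableSet (K₀ ×ˢ Icc a b) := hKc.measurableSet
  refine ⟨fun m => mollify (κ m) U, fun m z => mollify (κ m) Φ z - A 0, M, fun m => mollify (κ m) M,
    fun m => contDiff_mollify hU.locallyIntegrable, fun m =>
      (contDiff_mollify hΦ.locallyIntegrable).sub contDiff_const, fun m z hzK => ?_, ?_, ?_, ?_,
    fun m z hzK => ?_, fun m z hzK => ?_, fun m z hzK => ?_, fun m z hzK => ?_, fun m z hzK => ?_,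
    fun m => (integrable_mollify hMint).integrableOn, hMint.integrableOn,
    ae_restrict_of_ae hMt, ?_⟩
  · have h3 := mollify_subsolution (κ := κ m) hΩ.measurableSet hsub hSΩ hU hΦ (hz m z hzK)
    simpa only [spaceDiv, fderiv_sub_const] using h3
  · filter_upwards [ae_restrict_of_ae (ae_tendsto_mollify hκ0 hκ2 hU.locallyIntegrable),
      ae_restrict_mem hKm] with z h3 h4
    rwa [hUdef, indicator_of_mem (hKS h4)] at h3
  · filter_upwards [ae_restrict_of_ae (ae_tendsto_mollify hκ0 hκ2 hW.locallyIntegrable),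
      ae_restrict_mem hKm] with z h3 h4
    simp only [hgrad _ z h4]
    rwa [hWdef, indicator_of_mem (hKS h4)] at h3
  · filter_upwards [ae_restrict_of_ae (ae_tendsto_mollify hκ0 hκ2 hΨ.locallyIntegrable),
      ae_restrict_mem hKm] with z h3 h4
    simp only [hflux _ z h4]
    rwa [hΨdef, indicator_of_mem (hKS h4)] at h3
  · rw [hMeq]
    have := sq_mollify_le (κ := κ m) hU hU2 z
    nlinarith [hn1 m z, hn2 m z]
  · rw [hMeq]
    nlinarith [hn1 m z, hn2 m z, hn3 m z, hjU m z]
  · rw [hMeq, hgrad m z hzK]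
    nlinarith [hn1 m z, hn2 m z, hn3 m z, hjW m z]
  · have h4 := norm_mollify_mul_le (κ := κ m) Y hg1 hC (abs_nonneg (mollify (κ m) U z)) hΨ hΨW hGW z
    rw [hMeq, hflux m z hzK]
    nlinarith [hn1 m z, hn2 m z, hn3 m z, mul_nonneg hCg (hn1 m z), mul_nonneg hCg (hn2 m z),
      mul_le_mul_of_nonneg_left (hjU m z) hCg]
  · have h4 := norm_mollify_mul_le (κ := κ m) Y hg1 hC (norm_nonneg (mollify (κ m) W z)) hΨ hΨW hGW z
    rw [hMeq, hflux m z hzK, hgrad m z hzK]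
    nlinarith [hn1 m z, hn2 m z, hn3 m z, mul_nonneg hCg (hn1 m z), mul_nonneg hCg (hn2 m z),
      mul_le_mul_of_nonneg_left (hjW m z) hCg]
  · refine squeeze_zero (fun m => integral_nonneg fun z => abs_nonneg _) (fun m => ?_) hML
    exact setIntegral_le_integral (((integrable_mollify hMint).sub hMint).abs)
      (Eventually.of_forall fun z => abs_nonneg _)

end Approximation

end ParabolicOrlicz

namespace ParabolicOrlicz
open Filter Topology

/-! ### Energy inequality for smooth subsolutions -/

section Energy

variable {n : ℕ}

theorem continuous_spaceGrad {f : Euc n × ℝ → ℝ} (hf : ContDiff ℝ 1 f) :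
    Continuous (spaceGrad f) := by
  have e : spaceGrad f = fun w => (InnerProductSpace.toDual ℝ (Euc n)).symm
      ((fderiv ℝ f w).comp (ContinuousLinearMap.inl ℝ (Euc n) ℝ)) := by
    ext1 w
    refine ext_inner_right ℝ fun v => ?_
    rw [InnerProductSpace.toDual_symm_apply, inner_spaceGrad (hf.differentiable one_ne_zero w) v]
    rfl
  rw [e]
  refine (LinearIsometryEquiv.continuous _).comp ?_
  exact (hf.continuous_fderiv one_ne_zero).clm_comp continuous_const

theorem continuous_spaceDiv {F : Euc n × ℝ → Euc n} (hF : ContDiff ℝ 1 F) :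
    Continuous (spaceDiv F) := by
  unfold spaceDiv
  refine continuous_finsetSum _ fun i _ => ?_
  exact (EuclideanSpace.proj (𝕜 := ℝ) i).continuous.comp
    ((hF.continuous_fderiv one_ne_zero).clm_apply continuous_const)

theorem inner_gradient {η : Euc n → ℝ} (x v : Euc n) :
    inner ℝ (gradient η x) v = fderiv ℝ η x v := by
  rw [gradient, InnerProductSpace.toDual_symm_apply]

theorem continuous_gradient {η : Euc n → ℝ} (hη : ContDiff ℝ 1 η) : Continuous (gradient η) :=
  (LinearIsometryEquiv.continuous _).comp (hη.continuous_fderiv one_ne_zero)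

theorem integral_mul_spaceDiv {F : Euc n × ℝ → Euc n} (hF : ContDiff ℝ 1 F) {ψ : Euc n → ℝ}
    (hψ : ContDiff ℝ 1 ψ) (hψc : HasCompactSupport ψ) (s : ℝ) :
    ∫ x, ψ x * spaceDiv F (x, s) = -∫ x, inner ℝ (F (x, s)) (gradient ψ x) := by
  have hFi : ∀ i, ContDiff ℝ 1 fun x : Euc n => F (x, s) i := fun i =>
    (EuclideanSpace.proj (𝕜 := ℝ) i).contDiff.comp
      (hF.comp (contDiff_id.prodMk contDiff_const))
  have hder : ∀ i x v, fderiv ℝ (fun x : Euc n => F (x, s) i) x v = (fderiv ℝ F (x, s) (v, 0)) i := by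
    intro i x v
    have h1 : HasFDerivAt (fun y => F (y, s))
        ((fderiv ℝ F (x, s)).comp (ContinuousLinearMap.inl ℝ (Euc n) ℝ)) x :=
      HasFDerivAt.comp x (g := F) ((hF.differentiable one_ne_zero (x, s)).hasFDerivAt)
        (hasFDerivAt_prodMk_left x s)
    have h2 := (EuclideanSpace.proj i : Euc n →L[ℝ] ℝ).hasFDerivAt.comp x h1
    have h3 : fderiv ℝ (fun x : Euc n => F (x, s) i) x = _ := h2.fderiv
    rw [h3]
    rfl
  have hcs : ∀ {f : Euc n → ℝ}, Continuous f → Integrable fun x => ψ x * f x := fun hf =>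
    (hψ.continuous.mul hf).integrable_of_hasCompactSupport hψc.mul_right
  have hcs' : ∀ {f : Euc n → ℝ} (v : Euc n), Continuous f →
      Integrable fun x => fderiv ℝ ψ x v * f x := fun v hf =>
    (((hψ.continuous_fderiv one_ne_zero).clm_apply continuous_const).mul
      hf).integrable_of_hasCompactSupport (hψc.fderiv_apply (𝕜 := ℝ) v).mul_right
  have hdc : ∀ i (v : Euc n), Continuous fun x => fderiv ℝ (fun x : Euc n => F (x, s) i) x v :=
    fun i v => ((hFi i).continuous_fderiv one_ne_zero).clm_apply continuous_const
  have h1 : ∀ x, ψ x * spaceDiv F (x, s)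
      = ∑ i, ψ x * fderiv ℝ (fun x : Euc n => F (x, s) i) x (EuclideanSpace.single i 1) := by
    intro x
    simp only [spaceDiv, Finset.mul_sum, hder]
  have h2 : ∀ x, inner ℝ (F (x, s)) (gradient ψ x)
      = ∑ i, fderiv ℝ ψ x (EuclideanSpace.single i 1) * F (x, s) i := by
    intro x
    rw [real_inner_comm, inner_gradient]
    have e : F (x, s) = ∑ i, F (x, s) i • EuclideanSpace.single i (1 : ℝ) := by
      ext j
      simp [Finset.sum_apply, Pi.single_apply]
    conv_lhs => rw [e, map_sum]
    refine Finset.sum_congr rfl fun i _ => ?_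
    rw [map_smul, smul_eq_mul, mul_comm]
  simp only [h1, h2]
  rw [integral_finsetSum _ fun i _ => hcs (hdc i _), integral_finsetSum _ fun i _ =>
    hcs' _ (hFi i).continuous, ← Finset.sum_neg_distrib]
  refine Finset.sum_congr rfl fun i _ => ?_
  exact integral_mul_fderiv_eq_neg_fderiv_mul_of_integrable (hcs' _ (hFi i).continuous)
    (hcs (hdc i _)) (hcs (hFi i).continuous)
    (fun x _ => hψ.differentiable one_ne_zero x) (fun x _ => (hFi i).differentiable one_ne_zero x)

theorem gradient_eq_zero_of_notMem {B : Set (Euc n)} (hB : IsClosed B) {η : Euc n → ℝ}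
    (hη : ∀ x ∉ B, η x = 0) {x : Euc n} (hx : x ∉ B) : gradient η x = 0 := by
  have : η =ᶠ[𝓝 x] fun _ => 0 := by
    filter_upwards [hB.isOpen_compl.mem_nhds hx] with y hy using hη y hy
  rw [gradient, this.fderiv_eq]
  simp

theorem gradient_comp_mul {u : Euc n × ℝ → ℝ} (hu : ContDiff ℝ 1 u) {η : Euc n → ℝ}
    (hη : ContDiff ℝ 1 η) {h h' : ℝ → ℝ} (hh : ∀ s, HasDerivAt h (h' s) s) (s : ℝ) (x : Euc n) :
    gradient (fun x => h (u (x, s)) * η x) x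
      = (h' (u (x, s)) * η x) • spaceGrad u (x, s) + h (u (x, s)) • gradient η x := by
  refine ext_inner_right ℝ fun v => ?_
  have h1 : HasFDerivAt (fun y => u (y, s))
      ((fderiv ℝ u (x, s)).comp (ContinuousLinearMap.inl ℝ (Euc n) ℝ)) x :=
    HasFDerivAt.comp x (g := u) ((hu.differentiable one_ne_zero (x, s)).hasFDerivAt)
      (hasFDerivAt_prodMk_left x s)
  have h2 := ((hh (u (x, s))).comp_hasFDerivAt x h1).mul
    (hη.differentiable one_ne_zero x).hasFDerivAt
  have h3 : fderiv ℝ (fun x => h (u (x, s)) * η x) x = _ := h2.fderiv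
  rw [inner_gradient, h3, inner_add_left, inner_smul_left, inner_smul_left, inner_gradient,
    inner_spaceGrad (hu.differentiable one_ne_zero (x, s))]
  simp
  ring

/-- The integrand of the energy inequality. -/
noncomputable def energyDensity (H h h' : ℝ → ℝ) (η : Euc n → ℝ) (a : ℝ) (u : Euc n × ℝ → ℝ)
    (Du F : Euc n × ℝ → Euc n) (z : Euc n × ℝ) : ℝ :=
  H (u z) * η z.1 - (z.2 - a) * (h' (u z) * η z.1 * inner ℝ (F z) (Du z)
    + h (u z) * inner ℝ (F z) (gradient η z.1))

/-- The pointwise inequality is multiplied by (s-a) h(u) η ≥ 0 and integrated by parts in space. The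
weight s-a removes the initial value at the cost of the term H(u) η. -/
theorem energy_inequality_of_contDiff {u : Euc n × ℝ → ℝ} {F : Euc n × ℝ → Euc n}
    (hu : ContDiff ℝ 1 u) (hF : ContDiff ℝ 1 F) {B : Set (Euc n)} (hB : IsCompact B) {a t : ℝ}
    (hat : a ≤ t) (hsub : ∀ z ∈ B ×ˢ Icc a t, fderiv ℝ u z (0, 1) ≤ spaceDiv F z)
    {η : Euc n → ℝ} (hη : ContDiff ℝ 1 η) (hη0 : ∀ x, 0 ≤ η x) (hηB : ∀ x ∉ B, η x = 0)
    {H h h' : ℝ → ℝ} (hH : ∀ s, HasDerivAt H (h s) s) (hh : ∀ s, HasDerivAt h (h' s) s)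
    (hh' : Continuous h') (hh0 : ∀ s, 0 ≤ h s) :
    (t - a) * ∫ x, H (u (x, t)) * η x
      ≤ ∫ z in B ×ˢ Icc a t, energyDensity H h h' η a u (spaceGrad u) F z := by
  have hHc : Continuous H := continuous_iff_continuousAt.2 fun s => (hH s).continuousAt
  have hhc : Continuous h := continuous_iff_continuousAt.2 fun s => (hh s).continuousAt
  have huc := hu.continuous
  have hFc := hF.continuous
  have hηc := hη.continuous
  have hdt : Continuous fun z => fderiv ℝ u z (0, 1) :=
    (hu.continuous_fderiv one_ne_zero).clm_apply continuous_const
  have hdiv := continuous_spaceDiv hF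
  have hgr := continuous_spaceGrad hu
  have hgη := continuous_gradient hη
  have hKc : IsCompact (B ×ˢ Icc a t) := hB.prod isCompact_Icc
  have hBm : MeasurableSet B := hB.measurableSet
  have hKm : MeasurableSet (B ×ˢ Icc a t) := hBm.prod measurableSet_Icc
  -- The time derivative of (s-a) H(u) η.
  set P : Euc n × ℝ → ℝ := fun z =>
    H (u z) * η z.1 + (z.2 - a) * (h (u z) * fderiv ℝ u z (0, 1) * η z.1) with hP
  have hPc : Continuous P := by fun_prop
  have htime : ∀ x, (t - a) * (H (u (x, t)) * η x) = ∫ s in Icc a t, P (x, s) := by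
    intro x
    rw [integral_Icc_eq_integral_Ioc, ← intervalIntegral.integral_of_le hat]
    have hd : ∀ s, HasDerivAt (fun s => (s - a) * (H (u (x, s)) * η x)) (P (x, s)) s := by
      intro s
      have h2 : HasDerivAt (fun s : ℝ => (x, s)) ((0 : Euc n), (1 : ℝ)) s :=
        (hasDerivAt_const s x).prodMk (hasDerivAt_id s)
      have h3 := ((hu.differentiable one_ne_zero (x, s)).hasFDerivAt).comp_hasDerivAt s h2
      have h4 := ((hH (u (x, s))).comp s h3).mul_const (η x)
      have h5 := ((hasDerivAt_id s).sub_const a).mul h4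
      rw [one_mul] at h5
      exact h5
    rw [intervalIntegral.integral_eq_sub_of_hasDerivAt (fun s _ => hd s)]
    · simp
    · exact (hPc.comp (by fun_prop)).intervalIntegrable _ _
  have hPz : ∀ x ∉ B, ∫ s in Icc a t, P (x, s) = 0 := by
    intro x hx
    simp [hP, hηB x hx]
  have hintOn : ∀ {f : Euc n × ℝ → ℝ}, Continuous f →
      Integrable f ((volume.restrict B).prod (volume.restrict (Icc a t))) := fun hf => by
    rw [Measure.prod_restrict]
    exact hf.continuousOn.integrableOn_compact hKc
  have hvol : (volume : Measure (Euc n × ℝ)).restrict (B ×ˢ Icc a t)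
      = (volume.restrict B).prod (volume.restrict (Icc a t)) := by
    rw [Measure.prod_restrict]; rfl
  have hLHS : (t - a) * ∫ x, H (u (x, t)) * η x = ∫ z in B ×ˢ Icc a t, P z := by
    rw [hvol, integral_prod _ (hintOn hPc), ← integral_const_mul]
    simp only [htime]
    exact (setIntegral_eq_integral_of_forall_compl_eq_zero hPz).symm
  rw [hLHS]
  set Q₁ : Euc n × ℝ → ℝ := fun z => H (u z) * η z.1 with hQ₁
  set Q₂ : Euc n × ℝ → ℝ := fun z => (z.2 - a) * (h (u z) * η z.1 * spaceDiv F z) with hQ₂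
  set Q₃ : Euc n × ℝ → ℝ := fun z => (z.2 - a) * (h' (u z) * η z.1 * inner ℝ (F z) (spaceGrad u z)
    + h (u z) * inner ℝ (F z) (gradient η z.1)) with hQ₃
  have hQ₁c : Continuous Q₁ := by fun_prop
  have hQ₂c : Continuous Q₂ := by fun_prop
  have hQ₃c : Continuous Q₃ := by fun_prop
  have hstep : ∫ z in B ×ˢ Icc a t, P z ≤ ∫ z in B ×ˢ Icc a t, (Q₁ z + Q₂ z) := by
    refine setIntegral_mono_on (hPc.continuousOn.integrableOn_compact hKc)
      ((hQ₁c.add hQ₂c).continuousOn.integrableOn_compact hKc) hKm fun z hz => ?_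
    have h6 : 0 ≤ (z.2 - a) * (h (u z) * η z.1) :=
      mul_nonneg (sub_nonneg.2 hz.2.1) (mul_nonneg (hh0 _) (hη0 _))
    have h7 := mul_le_mul_of_nonneg_left (hsub z hz) h6
    simp only [hP, hQ₁, hQ₂]
    linarith
  refine hstep.trans (le_of_eq ?_)
  have hparts : ∫ z in B ×ˢ Icc a t, Q₂ z = -∫ z in B ×ˢ Icc a t, Q₃ z := by
    rw [hvol, integral_prod_symm _ (hintOn hQ₂c), integral_prod_symm _ (hintOn hQ₃c),
      ← integral_neg]
    refine integral_congr_ae (Eventually.of_forall fun s => ?_)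
    have hslice : Continuous fun x : Euc n => (x, s) := by fun_prop
    have hcomp : ContDiff ℝ 1 fun x : Euc n => u (x, s) :=
      hu.comp (contDiff_id.prodMk contDiff_const)
    have hhC : ContDiff ℝ 1 h := by
      rw [contDiff_one_iff_deriv]
      exact ⟨fun s => (hh s).differentiableAt, by rwa [funext fun s => (hh s).deriv]⟩
    have hψ : ContDiff ℝ 1 fun x => h (u (x, s)) * η x := (hhC.comp hcomp).mul hη
    have hψc : HasCompactSupport fun x => h (u (x, s)) * η x :=
      HasCompactSupport.intro hB fun x hx => by rw [hηB x hx, mul_zero]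
    have hgψ : ∀ x, gradient (fun x => h (u (x, s)) * η x) x
        = (h' (u (x, s)) * η x) • spaceGrad u (x, s) + h (u (x, s)) • gradient η x :=
      fun x => gradient_comp_mul hu hη hh s x
    have h8 := integral_mul_spaceDiv hF hψ hψc s
    have h9 : ∫ x in B, Q₂ (x, s) = (s - a) * ∫ x, h (u (x, s)) * η x * spaceDiv F (x, s) := by
      rw [← integral_const_mul]
      have hz : ∀ x ∉ B, Q₂ (x, s) = 0 := fun x hx => by simp [hQ₂, hηB x hx]
      exact setIntegral_eq_integral_of_forall_compl_eq_zero hz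
    have h10 : ∫ x in B, Q₃ (x, s)
        = (s - a) * ∫ x, inner ℝ (F (x, s)) (gradient (fun x => h (u (x, s)) * η x) x) := by
      rw [← integral_const_mul]
      have hz : ∀ x ∉ B, Q₃ (x, s) = 0 := fun x hx => by
        simp only [hQ₃, hηB x hx, gradient_eq_zero_of_notMem hB.isClosed hηB hx, inner_zero_right,
          mul_zero, zero_mul, add_zero]
      rw [setIntegral_eq_integral_of_forall_compl_eq_zero hz]
      refine integral_congr_ae (Eventually.of_forall fun x => ?_)
      simp only [hQ₃, hgψ, inner_add_right, inner_smul_right]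
    show ∫ x in B, Q₂ (x, s) = -∫ x in B, Q₃ (x, s)
    rw [h9, h10, h8]
    ring
  have i1 := hQ₁c.continuousOn.integrableOn_compact (μ := volume) hKc
  have i2 := hQ₂c.continuousOn.integrableOn_compact (μ := volume) hKc
  have i3 := hQ₃c.continuousOn.integrableOn_compact (μ := volume) hKc
  rw [integral_add i1 i2, hparts, ← sub_eq_add_neg, ← integral_sub i1 i3]
  rfl

end Energy

end ParabolicOrlicz

namespace ParabolicOrlicz
open Filter Topology

/-! ### Cutoff functions -/

section Cutoff

variable {n : ℕ}

/-- The cutoff profile `(1 - |x - x₀|² / R²)₊`. -/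
noncomputable def cutoffBase (x₀ : Euc n) (R : ℝ) (x : Euc n) : ℝ :=
  max (1 - ‖x - x₀‖ ^ 2 / R ^ 2) 0

/-- The `q`-th power of the cutoff profile. -/
noncomputable def cutoff (x₀ : Euc n) (R : ℝ) (q : ℕ) (x : Euc n) : ℝ := cutoffBase x₀ R x ^ q

variable {x₀ : Euc n} {R : ℝ} {q : ℕ}

theorem cutoffBase_nonneg (x : Euc n) : 0 ≤ cutoffBase x₀ R x := le_max_right _ _

theorem cutoffBase_le_one (x : Euc n) : cutoffBase x₀ R x ≤ 1 :=
  max_le (by linarith [show 0 ≤ ‖x - x₀‖ ^ 2 / R ^ 2 by positivity]) zero_le_one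

theorem cutoff_nonneg (x : Euc n) : 0 ≤ cutoff x₀ R q x := pow_nonneg (cutoffBase_nonneg x) q

theorem cutoff_le_one (x : Euc n) : cutoff x₀ R q x ≤ 1 :=
  pow_le_one₀ (cutoffBase_nonneg x) (cutoffBase_le_one x)

theorem cutoffBase_eq_zero (hR : 0 < R) {x : Euc n} (hx : x ∉ Metric.closedBall x₀ R) :
    cutoffBase x₀ R x = 0 := by
  rw [Metric.mem_closedBall, dist_eq_norm, not_le] at hx
  refine max_eq_right ?_
  rw [sub_nonpos, one_le_div (by positivity)]
  exact pow_le_pow_left₀ hR.le hx.le 2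

theorem cutoff_eq_zero (hR : 0 < R) (hq : q ≠ 0) {x : Euc n} (hx : x ∉ Metric.closedBall x₀ R) :
    cutoff x₀ R q x = 0 := by
  rw [cutoff, cutoffBase_eq_zero hR hx, zero_pow hq]

theorem contDiff_max_zero_pow (hq : 2 ≤ q) : ContDiff ℝ 1 fun s : ℝ => max s 0 ^ q := by
  rw [contDiff_one_iff_deriv]
  refine ⟨fun s => (hasDerivAt_max_zero_pow hq s).differentiableAt, ?_⟩
  rw [funext fun s => (hasDerivAt_max_zero_pow hq s).deriv]
  fun_prop

theorem contDiff_cutoff (hq : 2 ≤ q) : ContDiff ℝ 1 (cutoff x₀ R q) := by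
  refine (contDiff_max_zero_pow hq).comp (contDiff_const.sub (ContDiff.div_const ?_ _))
  exact (contDiff_id.sub contDiff_const).norm_sq ℝ

theorem norm_gradient_cutoff_le (hR : 0 < R) (hq : 2 ≤ q) (x : Euc n) :
    ‖gradient (cutoff x₀ R q) x‖ ≤ q * cutoffBase x₀ R x ^ (q - 1) * (2 / R) := by
  have hb := cutoffBase_nonneg (x₀ := x₀) (R := R) x
  by_cases hx : x ∈ Metric.closedBall x₀ R
  · have h1 : HasFDerivAt (fun x : Euc n => ‖x - x₀‖ ^ 2) (2 • innerSL ℝ (x - x₀)) x := by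
      have := ((hasFDerivAt_id x).sub_const x₀).norm_sq
      simpa using this
    have h2 : HasFDerivAt (fun x : Euc n => 1 - ‖x - x₀‖ ^ 2 / R ^ 2)
        (-((R ^ 2)⁻¹ • (2 • innerSL ℝ (x - x₀)))) x := by
      have := (h1.mul_const (R ^ 2)⁻¹).const_sub 1
      simpa only [div_eq_mul_inv] using this
    have h3 := (hasDerivAt_max_zero_pow hq (1 - ‖x - x₀‖ ^ 2 / R ^ 2)).comp_hasFDerivAt x h2
    have h4 : fderiv ℝ (cutoff x₀ R q) x = _ := h3.fderiv
    rw [gradient, LinearIsometryEquiv.norm_map, h4, norm_smul, Real.norm_of_nonneg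
      (by positivity)]
    refine mul_le_mul_of_nonneg_left ?_ (by positivity)
    rw [norm_neg, norm_smul, Real.norm_of_nonneg (by positivity)]
    have h5 : ‖2 • innerSL ℝ (x - x₀)‖ ≤ 2 * R := by
      rw [two_nsmul]
      refine (norm_add_le _ _).trans ?_
      rw [innerSL_apply_norm]
      rw [Metric.mem_closedBall, dist_eq_norm] at hx
      linarith
    calc (R ^ 2)⁻¹ * ‖2 • innerSL ℝ (x - x₀)‖ ≤ (R ^ 2)⁻¹ * (2 * R) := by gcongr
      _ = 2 / R := by field_simp
  · rw [gradient_eq_zero_of_notMem Metric.isClosed_closedBall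
      (fun y hy => cutoff_eq_zero hR (by omega) hy) hx, norm_zero]
    positivity

/-- Since r < R, one has 1 - r²/R² ≥ 1 - r/R. The cutoff is not constant on the inner ball; only
this lower bound is used. -/
theorem le_cutoffBase {r : ℝ} (hr : 0 ≤ r) (hrR : r < R) {x : Euc n}
    (hx : x ∈ Metric.closedBall x₀ r) : (R - r) / R ≤ cutoffBase x₀ R x := by
  have hR : 0 < R := by linarith
  rw [Metric.mem_closedBall, dist_eq_norm] at hx
  refine le_trans ?_ (le_max_left _ _)
  have h1 : ‖x - x₀‖ ^ 2 ≤ r * R := by nlinarith [norm_nonneg (x - x₀)]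
  rw [div_le_iff₀ hR, sub_mul, one_mul]
  have : ‖x - x₀‖ ^ 2 / R ^ 2 * R ≤ r := by
    rw [div_mul_eq_mul_div, div_le_iff₀ (by positivity)]
    nlinarith
  linarith

end Cutoff

/-! ### Sobolev inequality on time slices -/

/-- Hölder with exponents n/(n-p) and n/p leaves the norm of w in L^(pn/(n-p)), to which the
Gagliardo-Nirenberg-Sobolev inequality applies. -/
theorem exists_sobolev_const {n : ℕ} {p : ℝ} (hp : 1 ≤ p) (hpn : p < n) :
    ∃ C : NNReal, ∀ (w : Euc n → ℝ) (V : Euc n → ENNReal), ContDiff ℝ 1 w →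
      HasCompactSupport w → Measurable V →
      ∫⁻ x, ‖w x‖ₑ ^ p * V x ^ (p / n)
        ≤ C * (∫⁻ x, ‖fderiv ℝ w x‖ₑ ^ p) * (∫⁻ x, V x) ^ (p / n) := by
  have hp0 : 0 < p := by linarith
  have hn0 : (0 : ℝ) < n := by linarith
  have hnp : 0 < (n : ℝ) - p := by linarith
  set p' : ℝ := p * n / (n - p) with hp'
  have hp'0 : 0 < p' := by positivity
  set C₀ := SNormLESNormFDerivOfEqConst ℝ (volume : Measure (Euc n)) p with hC₀
  refine ⟨C₀ ^ p, fun w V hw hwc hV => ?_⟩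
  have hfin : Module.finrank ℝ (Euc n) = n := by simp [Euc]
  have hS := eLpNorm_le_eLpNorm_fderiv_of_eq (F := ℝ) (volume : Measure (Euc n)) hw hwc
    (p := p.toNNReal) (p' := p'.toNNReal) (by simpa using hp)
    (by rw [hfin]; exact_mod_cast hn0) (by
      rw [hfin, NNReal.coe_inv, Real.coe_toNNReal _ hp'0.le, Real.coe_toNNReal _ hp0.le, hp']
      field_simp)
  rw [eLpNorm_nnreal_eq_lintegral (by simpa using hp'0),
    eLpNorm_nnreal_eq_lintegral (by simpa using hp0), Real.coe_toNNReal _ hp'0.le,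
    Real.coe_toNNReal _ hp0.le] at hS
  have hconj : Real.HolderConjugate ((n : ℝ) / (n - p)) (n / p) := by
    rw [Real.holderConjugate_iff]
    refine ⟨(one_lt_div hnp).2 (by linarith), ?_⟩
    field_simp
    ring
  have hwm : Measurable fun x => ‖w x‖ₑ ^ p := (hw.continuous.measurable.enorm).pow_const p
  have hH := ENNReal.lintegral_mul_le_Lp_mul_Lq volume hconj hwm.aemeasurable
    (hV.pow_const (p / n)).aemeasurable
  refine hH.trans ?_
  simp only [← ENNReal.rpow_mul]
  have e1 : p * (n / (n - p)) = p' := by rw [hp']; ring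
  have e2 : p / n * (n / p) = 1 := by field_simp
  rw [e1, e2]
  simp only [ENNReal.rpow_one]
  have e3 : 1 / ((n : ℝ) / p) = p / n := by rw [one_div_div]
  rw [e3]
  refine mul_le_mul_left ?_ _
  have h5 := ENNReal.rpow_le_rpow hS hp0.le
  rw [ENNReal.mul_rpow_of_nonneg _ _ hp0.le, ← ENNReal.rpow_mul, ← ENNReal.rpow_mul] at h5
  have e4 : 1 / p' * p = 1 / ((n : ℝ) / (n - p)) := by rw [hp']; field_simp
  have e5 : 1 / p * p = 1 := by field_simp
  rw [e4, e5, ENNReal.rpow_one] at h5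
  rwa [ENNReal.coe_rpow_of_nonneg _ hp0.le]

end ParabolicOrlicz

namespace ParabolicOrlicz
open Filter Topology

/-! ### Pointwise absorption of the cutoff term. -/

section Step

variable {n : ℕ} {g₀ g₁ ν C₁ : ℝ} {g G : ℝ → ℝ}

/-- The constant of the pointwise energy bound. -/
noncomputable def energyConst (g₁ ν C₁ : ℝ) (q : ℕ) : ℝ :=
  g₁ * ((ν / (2 * g₁))⁻¹ ^ g₁ * (4 * q * C₁) ^ g₁) + 1

theorem energyConst_pos (h1 : 0 < g₁) (hν : 0 < ν) (hC₁ : 0 ≤ C₁) (q : ℕ) :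
    0 < energyConst g₁ ν C₁ q := by
  unfold energyConst; positivity

/-- Young's inequality absorbs the cutoff term into half of the elliptic term. What remains is a
multiple of G((u-κ)₊/ρ), with the negative powers of the cutoff profile compensated by η, as q ≥ g₁.
-/
theorem energyDensity_le (Y : YoungPair g₀ g₁ g G) (h1 : 1 ≤ g₁) (hν : 0 < ν) (hν1 : ν ≤ 1)
    (hC₁ : 1 ≤ C₁) {q : ℕ} (hq : 2 ≤ q) (hqg : g₁ ≤ q) {u : Euc n × ℝ → ℝ}
    {Du F : Euc n × ℝ → Euc n} {z : Euc n × ℝ} (hcoer : ν * G ‖Du z‖ ≤ inner ℝ (F z) (Du z))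
    (hgrow : ‖F z‖ ≤ C₁ * g ‖Du z‖) {x₀ : Euc n} {R ρ θ a κ d : ℝ} (hρ : 0 < ρ)
    (hρR : ρ / 2 ≤ R) (hθ : 0 < θ) (hd : 0 < d) (haz : a ≤ z.2) (hza : z.2 - a ≤ θ) :
    energyDensity (truncPrim κ d) (trunc κ d) (truncDeriv κ d) (cutoff x₀ R q) a u Du F z
      ≤ θ * (energyConst g₁ ν C₁ q * (G (max (u z - κ) 0 / ρ) + max (u z - κ) 0 ^ 2 / θ))
        - (z.2 - a) * (ν / 2 * (truncDeriv κ d (u z) * cutoff x₀ R q z.1 * G ‖Du z‖)) := by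
  obtain ⟨hh0, hh1, ht0, ht1, -, hH, -⟩ := truncation_bounds (κ := κ) hd (u z)
  have hR : 0 < R := by linarith
  set y := max (u z - κ) 0 with hy
  have hy0 : 0 ≤ y := le_max_right _ _
  set φ := cutoffBase x₀ R z.1 with hφ
  have hφ0 : 0 ≤ φ := cutoffBase_nonneg _
  have hφ1 : φ ≤ 1 := cutoffBase_le_one _
  set η := cutoff x₀ R q z.1 with hη
  have hηφ : η = φ ^ q := rfl
  have hη0 : 0 ≤ η := cutoff_nonneg _
  have hη1 : η ≤ 1 := cutoff_le_one _
  set h' := truncDeriv κ d (u z) with hh'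
  set h := trunc κ d (u z) with hh
  set C₂ := g₁ * ((ν / (2 * g₁))⁻¹ ^ g₁ * (4 * q * C₁) ^ g₁) with hC₂
  have hg1 : 0 < g₁ := by linarith
  have hq0 : (2 : ℝ) ≤ q := by exact_mod_cast hq
  have hGy : 0 ≤ G (y / ρ) := Y.prim_nonneg _
  have hGD : 0 ≤ G ‖Du z‖ := Y.prim_nonneg _
  have hC₂0 : 0 ≤ C₂ := by positivity
  -- the cross term
  have hcross : -(h * inner ℝ (F z) (gradient (cutoff x₀ R q) z.1))
      ≤ ν / 2 * (h' * η * G ‖Du z‖) + C₂ * G (y / ρ) := by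
    have hb1 : -(h * inner ℝ (F z) (gradient (cutoff x₀ R q) z.1))
        ≤ h' * y * (C₁ * g ‖Du z‖) * (q * φ ^ (q - 1) * (2 / R)) := by
      have h2 := abs_real_inner_le_norm (F z) (gradient (cutoff x₀ R q) z.1)
      have h3 := norm_gradient_cutoff_le (x₀ := x₀) hR hq z.1
      have h4 : ‖F z‖ * ‖gradient (cutoff x₀ R q) z.1‖
          ≤ (C₁ * g ‖Du z‖) * (q * φ ^ (q - 1) * (2 / R)) :=
        mul_le_mul hgrow h3 (norm_nonneg _) ((norm_nonneg _).trans hgrow)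
      calc -(h * inner ℝ (F z) (gradient (cutoff x₀ R q) z.1))
          = h * -(inner ℝ (F z) (gradient (cutoff x₀ R q) z.1)) := by ring
        _ ≤ h * ((C₁ * g ‖Du z‖) * (q * φ ^ (q - 1) * (2 / R))) :=
            mul_le_mul_of_nonneg_left ((neg_le_abs _).trans (h2.trans h4)) ht0
        _ ≤ (y * h') * ((C₁ * g ‖Du z‖) * (q * φ ^ (q - 1) * (2 / R))) :=
            mul_le_mul_of_nonneg_right ht1 ((mul_nonneg (norm_nonneg _) (norm_nonneg _)).trans h4)
        _ = _ := by ring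
    refine hb1.trans ?_
    rcases hφ0.eq_or_lt with hφz | hφp
    · rw [← hφz, zero_pow (by omega : q - 1 ≠ 0)]
      simp only [mul_zero, zero_mul]
      positivity
    -- Dividing by φ completes the φ^(q-1) of the gradient bound to η = φ^q.
    · set b := 2 * q * C₁ / φ * (y / R) with hb
      have hb0 : 0 ≤ b := by positivity
      have e : h' * y * (C₁ * g ‖Du z‖) * (q * φ ^ (q - 1) * (2 / R)) = h' * η * (g ‖Du z‖ * b) := by
        rw [hηφ, hb, ← Nat.sub_add_cancel (by omega : 1 ≤ q), pow_succ]
        simp only [Nat.add_sub_cancel]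
        field_simp
      -- With this parameter the first term of Young's inequality is exactly ν/2 times G(|Du|).
      have hδ1 : ν / (2 * g₁) ≤ 1 := by rw [div_le_one (by positivity)]; linarith
      have hY := Y.mul_le_add_delta hg1.le (a := ‖Du z‖) hb0 (by positivity : 0 < ν / (2 * g₁)) hδ1
      have hbb : b ≤ 4 * q * C₁ / φ * (y / ρ) := by
        have : y / R ≤ 2 * (y / ρ) := by
          rw [← mul_div_assoc, div_le_div_iff₀ hR hρ]; nlinarith
        calc b ≤ 2 * q * C₁ / φ * (2 * (y / ρ)) := mul_le_mul_of_nonneg_left this (by positivity)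
          _ = _ := by ring
      have hc1 : 1 ≤ 4 * q * C₁ / φ := by rw [one_le_div hφp]; nlinarith
      have hGb : η * G b ≤ (4 * q * C₁) ^ g₁ * G (y / ρ) := by
        have h5 : G b ≤ (4 * q * C₁ / φ) ^ g₁ * G (y / ρ) :=
          (Y.prim_monotone hbb).trans (Y.prim_mul_le hc1)
        have h6 : η * (4 * q * C₁ / φ) ^ g₁ ≤ (4 * q * C₁) ^ g₁ := by
          rw [Real.div_rpow (by positivity) hφ0, ← mul_div_assoc,
            div_le_iff₀ (Real.rpow_pos_of_pos hφp _), mul_comm]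
          refine mul_le_mul_of_nonneg_left ?_ (by positivity)
          rw [hηφ, ← Real.rpow_natCast]
          exact Real.rpow_le_rpow_of_exponent_ge hφp hφ1 hqg
        calc η * G b ≤ η * ((4 * q * C₁ / φ) ^ g₁ * G (y / ρ)) :=
              mul_le_mul_of_nonneg_left h5 hη0
          _ = η * (4 * q * C₁ / φ) ^ g₁ * G (y / ρ) := by ring
          _ ≤ _ := mul_le_mul_of_nonneg_right h6 hGy
      rw [e]
      calc h' * η * (g ‖Du z‖ * b)
          ≤ h' * η * (ν / (2 * g₁) * (g₁ * G ‖Du z‖) + g₁ * ((ν / (2 * g₁))⁻¹ ^ g₁ * G b)) :=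
            mul_le_mul_of_nonneg_left hY (by positivity)
        _ = ν / 2 * (h' * η * G ‖Du z‖) + h' * (g₁ * (ν / (2 * g₁))⁻¹ ^ g₁ * (η * G b)) := by
            field_simp
        _ ≤ ν / 2 * (h' * η * G ‖Du z‖)
              + 1 * (g₁ * (ν / (2 * g₁))⁻¹ ^ g₁ * ((4 * q * C₁) ^ g₁ * G (y / ρ))) := by
            have : 0 ≤ η * G b := mul_nonneg hη0 (Y.prim_nonneg _)
            gcongr
        _ = _ := by rw [hC₂]; ring
  have hs0 : 0 ≤ z.2 - a := by linarith
  have hmain : h' * η * (ν * G ‖Du z‖) ≤ h' * η * inner ℝ (F z) (Du z) :=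
    mul_le_mul_of_nonneg_left hcoer (by positivity)
  have hHη : truncPrim κ d (u z) * η ≤ y ^ 2 := by
    have h7 := (truncation_bounds (κ := κ) hd (u z)).2.2.2.2.1
    have h8 := sq_nonneg (trunc κ d (u z))
    have h9 : 0 ≤ truncPrim κ d (u z) := by linarith
    have h10 := mul_le_of_le_one_right h9 hη1
    linarith
  have hlast : (z.2 - a) * (C₂ * G (y / ρ)) ≤ θ * (C₂ * G (y / ρ)) :=
    mul_le_mul_of_nonneg_right hza (by positivity)
  have hcr := mul_le_mul_of_nonneg_left hcross hs0
  have hmn := mul_le_mul_of_nonneg_left hmain hs0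
  have hE : energyConst g₁ ν C₁ q = C₂ + 1 := rfl
  have hexp : θ * ((C₂ + 1) * (G (y / ρ) + y ^ 2 / θ))
      = θ * (C₂ * G (y / ρ)) + θ * G (y / ρ) + C₂ * y ^ 2 + y ^ 2 := by
    field_simp; ring
  rw [hE, hexp, energyDensity]
  have p1 : 0 ≤ θ * G (y / ρ) := by positivity
  have p2 : 0 ≤ C₂ * y ^ 2 := by positivity
  show truncPrim κ d (u z) * η - (z.2 - a) * (h' * η * inner ℝ (F z) (Du z)
    + h * inner ℝ (F z) (gradient (cutoff x₀ R q) z.1)) ≤ _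
  linarith

end Step

end ParabolicOrlicz

namespace ParabolicOrlicz
open Filter Topology

/-! ### Passage to the limit in the energy inequality. -/

section Step

variable {n : ℕ} {g₀ g₁ ν C₁ : ℝ} {g G : ℝ → ℝ}

/-- The closed cylinder `B̄_R(x₀) × [t₀ - τ, t₀]`. -/
def closedCylinder (x₀ : Euc n) (t₀ R τ : ℝ) : Set (Euc n × ℝ) :=
  Metric.closedBall x₀ R ×ˢ Icc (t₀ - τ) t₀

theorem isCompact_closedCylinder (x₀ : Euc n) (t₀ R τ : ℝ) :
    IsCompact (closedCylinder x₀ t₀ R τ) :=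
  (isCompact_closedBall x₀ R).prod isCompact_Icc

theorem measurableSet_closedCylinder (x₀ : Euc n) (t₀ R τ : ℝ) :
    MeasurableSet (closedCylinder x₀ t₀ R τ) :=
  (isCompact_closedCylinder x₀ t₀ R τ).measurableSet

theorem closedCylinder_mono {x₀ : Euc n} {t₀ R τ R' τ' : ℝ} (hR : R' ≤ R) (hτ : τ' ≤ τ) :
    closedCylinder x₀ t₀ R' τ' ⊆ closedCylinder x₀ t₀ R τ :=
  prod_mono (Metric.closedBall_subset_closedBall hR) (Icc_subset_Icc (by linarith) le_rfl)

/-- The density `G((u - κ)₊ / ρ) + (u - κ)₊² / θ`. -/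
noncomputable def excess (G : ℝ → ℝ) (ρ θ κ : ℝ) (u : Euc n × ℝ → ℝ) (z : Euc n × ℝ) : ℝ :=
  G (max (u z - κ) 0 / ρ) + max (u z - κ) 0 ^ 2 / θ

theorem excess_nonneg (Y : YoungPair g₀ g₁ g G) {ρ θ κ : ℝ} (hθ : 0 < θ) (u : Euc n × ℝ → ℝ)
    (z : Euc n × ℝ) : 0 ≤ excess G ρ θ κ u z :=
  add_nonneg (Y.prim_nonneg _) (by positivity)

variable {K : Set (Euc n × ℝ)} {u : Euc n × ℝ → ℝ} {Du F : Euc n × ℝ → Euc n}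
  {um : ℕ → Euc n × ℝ → ℝ} {Fm : ℕ → Euc n × ℝ → Euc n} {M : Euc n × ℝ → ℝ}
  {Mm : ℕ → Euc n × ℝ → ℝ}

theorem SmoothApprox.tendsto_integral_abs_sub (S : SmoothApprox G K u Du F um Fm M Mm)
    (hK : MeasurableSet K) {f : Euc n × ℝ → ℝ} {fm : ℕ → Euc n × ℝ → ℝ} {C : ℝ}
    (hfm : ∀ m, Continuous (fm m))
    (hlim : ∀ᵐ z ∂(volume.restrict K), Tendsto (fun m => fm m z) atTop (𝓝 (f z)))
    (hb : ∀ m, ∀ z ∈ K, |fm m z| ≤ C * Mm m z) :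
    IntegrableOn f K ∧ (∀ m, IntegrableOn (fm m) K) ∧
      Tendsto (fun m => ∫ z in K, |fm m z - f z|) atTop (𝓝 0) :=
  tendsto_integral_abs_sub_of_dominated S.integrable_lim S.integrable_dom S.tendsto_integral
    S.tendsto_dom (fun m => (hfm m).aestronglyMeasurable) hlim fun m => by
      filter_upwards [ae_restrict_mem hK] with z hz using hb m z hz

theorem max_sub_zero_le_abs {κ s : ℝ} (hκ : 0 ≤ κ) : max (s - κ) 0 ≤ |s| :=
  max_le (by linarith [le_abs_self s]) (abs_nonneg s)

theorem YoungPair.prim_div_le (Y : YoungPair g₀ g₁ g G) {ρ s : ℝ} (hs : 0 ≤ s) :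
    G (s / ρ) ≤ max 1 ρ⁻¹ ^ g₁ * G s := by
  have h : s / ρ ≤ max 1 ρ⁻¹ * s := by
    rw [div_eq_inv_mul]; exact mul_le_mul_of_nonneg_right (le_max_right _ _) hs
  exact (Y.prim_monotone h).trans (Y.prim_mul_le (le_max_left _ _))

theorem SmoothApprox.integrableOn_excess (S : SmoothApprox G K u Du F um Fm M Mm)
    (Y : YoungPair g₀ g₁ g G) (hK : MeasurableSet K) {ρ θ κ : ℝ} (hθ : 0 < θ)
    (hκ : 0 ≤ κ) : IntegrableOn (excess G ρ θ κ u) K := by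
  have hGc := Y.prim_continuous
  have hc : Continuous fun s : ℝ => G (max (s - κ) 0 / ρ) + max (s - κ) 0 ^ 2 / θ := by fun_prop
  refine (S.tendsto_integral_abs_sub hK (fm := fun m z => excess G ρ θ κ (um m) z)
    (C := max 1 ρ⁻¹ ^ g₁ + θ⁻¹) (fun m => hc.comp (S.contDiff_fun m).continuous) ?_ ?_).1
  · filter_upwards [S.tendsto_fun] with z hz
    exact (hc.tendsto _).comp hz
  · intro m z hz
    rw [abs_of_nonneg (excess_nonneg Y hθ _ _), add_mul]
    have h1 := max_sub_zero_le_abs (s := um m z) hκ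
    have h0 : 0 ≤ max (um m z - κ) 0 := le_max_right _ _
    refine add_le_add ?_ ?_
    · calc G (max (um m z - κ) 0 / ρ) ≤ max 1 ρ⁻¹ ^ g₁ * G (max (um m z - κ) 0) := Y.prim_div_le h0
        _ ≤ max 1 ρ⁻¹ ^ g₁ * Mm m z := by
            refine mul_le_mul_of_nonneg_left ((Y.prim_monotone h1).trans (S.prim_le m z hz)) ?_
            positivity
    · rw [div_eq_inv_mul]
      refine mul_le_mul_of_nonneg_left ?_ (by positivity)
      refine le_trans ?_ (S.sq_le m z hz)
      rw [← sq_abs (um m z)]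
      exact pow_le_pow_left₀ h0 h1 2

/-- Each of the three terms is dominated by a multiple of Mₘ through the square, the flux-gradient
and the flux-function bounds respectively; no structure of Fₘ is used. -/
theorem SmoothApprox.tendsto_energyDensity (S : SmoothApprox G K u Du F um Fm M Mm)
    (hK : MeasurableSet K) {x₀ : Euc n} {R κ d a θ : ℝ} {q : ℕ} (hq : 2 ≤ q) (hR : 0 < R)
    (hκ : 0 ≤ κ) (hd : 0 < d) (hKa : ∀ z ∈ K, |z.2 - a| ≤ θ) :
    let f := fun (u : Euc n × ℝ → ℝ) (Du F : Euc n × ℝ → Euc n) =>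
      energyDensity (truncPrim κ d) (trunc κ d) (truncDeriv κ d) (cutoff x₀ R q) a u Du F
    IntegrableOn (f u Du F) K ∧
      (∀ m, IntegrableOn (f (um m) (spaceGrad (um m)) (Fm m)) K) ∧
      Tendsto (fun m => ∫ z in K, |f (um m) (spaceGrad (um m)) (Fm m) z - f u Du F z|)
        atTop (𝓝 0) := by
  intro f
  have hc1 := continuous_truncPrim κ d
  have hc2 := continuous_trunc κ d
  have hc3 := continuous_truncDeriv κ d
  have hη := contDiff_cutoff (x₀ := x₀) (R := R) hq
  have hc4 := hη.continuous
  have hc5 := continuous_gradient hη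
  refine S.tendsto_integral_abs_sub hK (C := 1 + θ * (1 + q * (2 / R))) (fun m => ?_) ?_ ?_
  · have h1 := (S.contDiff_fun m).continuous
    have h2 := (S.contDiff_flux m).continuous
    have h3 := continuous_spaceGrad (S.contDiff_fun m)
    simp only [f]
    unfold energyDensity
    fun_prop
  · filter_upwards [S.tendsto_fun, S.tendsto_grad, S.tendsto_flux] with z h1 h2 h3
    refine Tendsto.sub (((hc1.tendsto _).comp h1).mul_const _) (Tendsto.const_mul _ ?_)
    exact ((((hc3.tendsto _).comp h1).mul_const _).mul (h3.inner h2)).add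
      (((hc2.tendsto _).comp h1).mul (h3.inner tendsto_const_nhds))
  · intro m z hz
    obtain ⟨hh0, hh1, ht0, ht1, hH1, hH, -⟩ := truncation_bounds (κ := κ) hd (um m z)
    have hy := max_sub_zero_le_abs (s := um m z) hκ
    have hy0 : 0 ≤ max (um m z - κ) 0 := le_max_right _ _
    have hM1 := S.sq_le m z hz
    have hM2 := S.flux_mul_le m z hz
    have hM3 := S.flux_mul_grad_le m z hz
    have hM0 : 0 ≤ Mm m z := (sq_nonneg _).trans hM1
    have hη0 := cutoff_nonneg (x₀ := x₀) (R := R) (q := q) z.1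
    have hη1 := cutoff_le_one (x₀ := x₀) (R := R) (q := q) z.1
    have hθ := hKa z hz
    have b1 : |truncPrim κ d (um m z) * cutoff x₀ R q z.1| ≤ Mm m z := by
      have hp : 0 ≤ truncPrim κ d (um m z) := by
        have := sq_nonneg (trunc κ d (um m z)); linarith
      rw [abs_of_nonneg (mul_nonneg hp hη0)]
      have h5 : max (um m z - κ) 0 ^ 2 ≤ um m z ^ 2 := by
        rw [← sq_abs (um m z)]; exact pow_le_pow_left₀ hy0 hy 2
      have h6 := mul_le_of_le_one_right hp hη1
      linarith
    have b2 : |truncDeriv κ d (um m z) * cutoff x₀ R q z.1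
        * inner ℝ (Fm m z) (spaceGrad (um m) z)| ≤ Mm m z := by
      rw [abs_mul, abs_of_nonneg (mul_nonneg hh0 hη0)]
      have h5 := abs_real_inner_le_norm (Fm m z) (spaceGrad (um m) z)
      have h6 : truncDeriv κ d (um m z) * cutoff x₀ R q z.1 ≤ 1 :=
        mul_le_one₀ hh1 hη0 hη1
      exact (mul_le_of_le_one_left (abs_nonneg _) h6).trans (h5.trans hM3)
    have b3 : |trunc κ d (um m z) * inner ℝ (Fm m z) (gradient (cutoff x₀ R q) z.1)|
        ≤ q * (2 / R) * Mm m z := by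
      rw [abs_mul, abs_of_nonneg ht0]
      have h5 := abs_real_inner_le_norm (Fm m z) (gradient (cutoff x₀ R q) z.1)
      have h6 : ‖gradient (cutoff x₀ R q) z.1‖ ≤ q * (2 / R) := by
        refine (norm_gradient_cutoff_le hR hq z.1).trans ?_
        have : cutoffBase x₀ R z.1 ^ (q - 1) ≤ 1 :=
          pow_le_one₀ (cutoffBase_nonneg _) (cutoffBase_le_one _)
        calc (q : ℝ) * cutoffBase x₀ R z.1 ^ (q - 1) * (2 / R) ≤ q * 1 * (2 / R) := by gcongr
          _ = _ := by ring
      have h7 : trunc κ d (um m z) ≤ |um m z| :=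
        (ht1.trans (mul_le_of_le_one_right hy0 hh1)).trans hy
      calc trunc κ d (um m z) * |inner ℝ (Fm m z) (gradient (cutoff x₀ R q) z.1)|
          ≤ |um m z| * (‖Fm m z‖ * (q * (2 / R))) := by
            refine mul_le_mul h7 (h5.trans ?_) (abs_nonneg _) (abs_nonneg _)
            exact mul_le_mul_of_nonneg_left h6 (norm_nonneg _)
        _ = q * (2 / R) * (‖Fm m z‖ * |um m z|) := by ring
        _ ≤ _ := mul_le_mul_of_nonneg_left hM2 (by positivity)
    simp only [f, energyDensity]
    refine (abs_sub _ _).trans ?_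
    rw [abs_mul (z.2 - a)]
    have b4 := (abs_add_le _ _).trans (add_le_add b2 b3)
    have b5 := mul_le_mul hθ b4 (abs_nonneg _) ((abs_nonneg _).trans hθ)
    calc _ ≤ Mm m z + θ * (Mm m z + q * (2 / R) * Mm m z) := add_le_add b1 b5
      _ = _ := by ring

/-- The energy inequality in the limit. -/
theorem SmoothApprox.energy_bounds {x₀ : Euc n} {t₀ ρ θ : ℝ}
    (S : SmoothApprox G (closedCylinder x₀ t₀ ρ θ) u Du F um Fm M Mm)
    (Y : YoungPair g₀ g₁ g G) (h1 : 1 ≤ g₁) (hν : 0 < ν) (hν1 : ν ≤ 1)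
    (hC₁ : 1 ≤ C₁) {q : ℕ} (hq : 2 ≤ q) (hqg : g₁ ≤ q)
    (hcoer : ∀ z, ν * G ‖Du z‖ ≤ inner ℝ (F z) (Du z)) (hgrow : ∀ z, ‖F z‖ ≤ C₁ * g ‖Du z‖)
    {R τ κ d : ℝ} (hρ : 0 < ρ) (hρR : ρ / 2 ≤ R) (hRρ : R ≤ ρ) (hθ : 0 < θ) (hτ0 : 0 < τ)
    (hτ : τ ≤ θ) (hκ : 0 ≤ κ) (hd : 0 < d)
    (hint : IntegrableOn (fun z => truncDeriv κ d (u z) * cutoff x₀ R q z.1 * G ‖Du z‖)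
      (closedCylinder x₀ t₀ ρ θ)) :
    let X := ∫ z in closedCylinder x₀ t₀ R τ, excess G ρ θ κ u z
    (∃ e : ℕ → ℝ, Tendsto e atTop (𝓝 0) ∧ (∀ m, 0 ≤ e m) ∧
      ∀ m, ∀ t ∈ Icc (t₀ - τ) t₀,
        (t - (t₀ - τ)) * ∫ x, truncPrim κ d (um m (x, t)) * cutoff x₀ R q x
          ≤ θ * (energyConst g₁ ν C₁ q * X) + e m) ∧
    ν / 2 * ∫ z in closedCylinder x₀ t₀ R τ, (z.2 - (t₀ - τ)) *
      (truncDeriv κ d (u z) * cutoff x₀ R q z.1 * G ‖Du z‖)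
        ≤ θ * (energyConst g₁ ν C₁ q * X) := by
  intro X
  have hR : 0 < R := by linarith
  set a := t₀ - τ with ha
  have hKm := measurableSet_closedCylinder x₀ t₀ ρ θ
  have hsubK : closedCylinder x₀ t₀ R τ ⊆ closedCylinder x₀ t₀ ρ θ := closedCylinder_mono hRρ hτ
  have hKa : ∀ z ∈ closedCylinder x₀ t₀ ρ θ, |z.2 - a| ≤ θ := by
    intro z hz
    have := hz.2.1
    have := hz.2.2
    rw [abs_le]
    constructor <;> linarith
  set f := energyDensity (truncPrim κ d) (trunc κ d) (truncDeriv κ d) (cutoff x₀ R q) a u Du F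
    with hfdef
  set fm := fun m => energyDensity (truncPrim κ d) (trunc κ d) (truncDeriv κ d) (cutoff x₀ R q) a
    (um m) (spaceGrad (um m)) (Fm m) with hfmdef
  obtain ⟨hf, hfm, hlim⟩ : IntegrableOn f (closedCylinder x₀ t₀ ρ θ) ∧
      (∀ m, IntegrableOn (fm m) (closedCylinder x₀ t₀ ρ θ)) ∧
      Tendsto (fun m => ∫ z in closedCylinder x₀ t₀ ρ θ, |fm m z - f z|) atTop (𝓝 0) :=
    S.tendsto_energyDensity hKm hq hR hκ hd hKa
  set C := energyConst g₁ ν C₁ q with hC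
  have hC0 : 0 < C := energyConst_pos (by linarith) hν (by linarith) q
  have hex := S.integrableOn_excess (ρ := ρ) Y hKm hθ hκ
  have hexn : ∀ z, 0 ≤ excess G ρ θ κ u z := fun z => excess_nonneg Y hθ u z
  set D := fun z : Euc n × ℝ => truncDeriv κ d (u z) * cutoff x₀ R q z.1 * G ‖Du z‖ with hD
  have hDn : ∀ z, 0 ≤ D z := fun z => mul_nonneg (mul_nonneg
    (truncation_bounds (κ := κ) hd (u z)).1 (cutoff_nonneg _)) (Y.prim_nonneg _)
  have hDint : IntegrableOn (fun z => (z.2 - a) * D z) (closedCylinder x₀ t₀ R τ) := by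
    refine ((hint.mono_set hsubK).bdd_mul (c := θ) ?_ ?_)
    · exact (by fun_prop : Continuous fun z : Euc n × ℝ => z.2 - a).aestronglyMeasurable
    · filter_upwards [ae_restrict_mem (measurableSet_closedCylinder x₀ t₀ R τ)] with z hz
      exact hKa z (hsubK hz)
  have hpt : ∀ z ∈ closedCylinder x₀ t₀ R τ,
      f z ≤ θ * (C * excess G ρ θ κ u z) - (z.2 - a) * (ν / 2 * D z) := by
    intro z hz
    exact energyDensity_le Y h1 hν hν1 hC₁ hq hqg (hcoer z) (hgrow z) hρ hρR hθ hd hz.2.1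
      ((le_abs_self _).trans (hKa z (hsubK hz)))
  have hXθ : ∀ s ⊆ closedCylinder x₀ t₀ R τ, MeasurableSet s →
      ∫ z in s, f z ≤ θ * (C * X) := by
    intro s hs hsm
    calc ∫ z in s, f z ≤ ∫ z in s, θ * (C * excess G ρ θ κ u z) := by
          refine setIntegral_mono_on (hf.mono_set (hs.trans hsubK))
            (((hex.mono_set (hs.trans hsubK)).const_mul C).const_mul θ) hsm fun z hz => ?_
          refine (hpt z (hs hz)).trans (sub_le_self _ ?_)
          have := (hs hz).2.1
          exact mul_nonneg (by linarith) (mul_nonneg (by linarith) (hDn z))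
      _ ≤ ∫ z in closedCylinder x₀ t₀ R τ, θ * (C * excess G ρ θ κ u z) := by
          refine setIntegral_mono_set (((hex.mono_set hsubK).const_mul C).const_mul θ) ?_
            hs.eventuallyLE
          exact Eventually.of_forall fun z => mul_nonneg hθ.le (mul_nonneg hC0.le (hexn z))
      _ = _ := by rw [integral_const_mul, integral_const_mul]
  -- The error is independent of the subset, which makes the slice estimate uniform in t.
  have hmle : ∀ m, ∀ s ⊆ closedCylinder x₀ t₀ ρ θ, MeasurableSet s →
      ∫ z in s, fm m z ≤ (∫ z in s, f z) + ∫ z in closedCylinder x₀ t₀ ρ θ, |fm m z - f z| := by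
    intro m s hs hsm
    have i1 := (hfm m).mono_set hs
    have i2 := hf.mono_set hs
    have h5 : (∫ z in s, fm m z) - ∫ z in s, f z ≤ ∫ z in s, |fm m z - f z| := by
      rw [← integral_sub i1 i2]
      exact integral_mono (i1.sub i2) (i1.sub i2).abs fun z => le_abs_self _
    have h6 : ∫ z in s, |fm m z - f z| ≤ ∫ z in closedCylinder x₀ t₀ ρ θ, |fm m z - f z| :=
      setIntegral_mono_set ((hfm m).sub hf).abs
        (Eventually.of_forall fun z => abs_nonneg _) hs.eventuallyLE
    linarith
  have hen : ∀ m, ∀ t ∈ Icc a t₀,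
      (t - a) * ∫ x, truncPrim κ d (um m (x, t)) * cutoff x₀ R q x
        ≤ ∫ z in Metric.closedBall x₀ R ×ˢ Icc a t, fm m z := by
    intro m t ht
    refine energy_inequality_of_contDiff (S.contDiff_fun m) (S.contDiff_flux m)
      (isCompact_closedBall x₀ R) ht.1 (fun z hz => S.subsolution m z (hsubK ?_))
      (contDiff_cutoff hq) cutoff_nonneg (fun x hx => cutoff_eq_zero hR (by omega) hx)
      (hasDerivAt_truncPrim κ d) (hasDerivAt_trunc κ d) (continuous_truncDeriv κ d)
      (fun s => (truncation_bounds hd s).2.2.1)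
    exact ⟨hz.1, hz.2.1, hz.2.2.trans ht.2⟩
  have hsubt : ∀ t ∈ Icc a t₀, Metric.closedBall x₀ R ×ˢ Icc a t ⊆ closedCylinder x₀ t₀ R τ :=
    fun t ht => prod_mono Subset.rfl (Icc_subset_Icc le_rfl ht.2)
  refine ⟨⟨fun m => ∫ z in closedCylinder x₀ t₀ ρ θ, |fm m z - f z|, hlim,
    fun m => integral_nonneg fun z => abs_nonneg _, fun m t ht => ?_⟩, ?_⟩
  · have hms : MeasurableSet (Metric.closedBall x₀ R ×ˢ Icc a t) :=
      measurableSet_closedBall.prod measurableSet_Icc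
    have h5 := hmle m _ ((hsubt t ht).trans hsubK) hms
    have h6 := hXθ _ (hsubt t ht) hms
    exact (hen m t ht).trans (h5.trans (by linarith))
  -- For the gradient bound, only the nonnegativity of the slice term at t₀ is kept. In the limit
  -- the integral of f is nonnegative, and the pointwise bound moves the gradient term to the other
  -- side.
  · have hnn : ∀ m, 0 ≤ (∫ z in closedCylinder x₀ t₀ R τ, f z)
        + ∫ z in closedCylinder x₀ t₀ ρ θ, |fm m z - f z| := by
      intro m
      have ht : t₀ ∈ Icc a t₀ := ⟨by linarith, le_rfl⟩
      refine le_trans ?_ ((hen m t₀ ht).trans (hmle m _ hsubK (measurableSet_closedCylinder _ _ _ _)))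
      refine mul_nonneg (by linarith) (integral_nonneg fun x => mul_nonneg ?_ (cutoff_nonneg x))
      have h5 := (truncation_bounds (κ := κ) hd (um m (x, t₀))).2.2.2.2.1
      have h6 := sq_nonneg (trunc κ d (um m (x, t₀)))
      linarith
    have h7 : 0 ≤ ∫ z in closedCylinder x₀ t₀ R τ, f z := by
      have := ge_of_tendsto' (hlim.const_add (∫ z in closedCylinder x₀ t₀ R τ, f z)) hnn
      rwa [add_zero] at this
    have i1 : IntegrableOn (fun z => θ * (C * excess G ρ θ κ u z)) (closedCylinder x₀ t₀ R τ) :=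
      ((hex.mono_set hsubK).const_mul C).const_mul θ
    have i2 : IntegrableOn (fun z => ν / 2 * ((z.2 - a) * D z)) (closedCylinder x₀ t₀ R τ) :=
      hDint.const_mul _
    have h8 : ∫ z in closedCylinder x₀ t₀ R τ, f z
        ≤ ∫ z in closedCylinder x₀ t₀ R τ, (θ * (C * excess G ρ θ κ u z)
          - ν / 2 * ((z.2 - a) * D z)) := by
      refine setIntegral_mono_on (hf.mono_set hsubK) (i1.sub i2)
        (measurableSet_closedCylinder _ _ _ _) fun z hz => ?_
      have := hpt z hz
      linarith
    rw [integral_sub i1 i2, integral_const_mul, integral_const_mul, integral_const_mul] at h8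
    linarith

end Step

end ParabolicOrlicz

namespace ParabolicOrlicz
open Filter Topology

/-! ### Sobolev gain on time slices. -/

section Step

variable {n : ℕ} {g₀ g₁ ν C₁ : ℝ} {g G : ℝ → ℝ}

/-- The density controlling the gradient in the Sobolev inequality. -/
noncomputable def sobolevDensity (G : ℝ → ℝ) (ρ κ d : ℝ) (η : Euc n → ℝ) (u : Euc n × ℝ → ℝ)
    (Du : Euc n × ℝ → Euc n) (z : Euc n × ℝ) : ℝ :=
  truncDeriv κ d (u z) * η z.1 * G ‖Du z‖ + G (trunc κ d (u z) / ρ)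

/-- The constant relating the gradient of the test function to `sobolevDensity`. -/
noncomputable def gradConst (g₁ p : ℝ) (q : ℕ) : ℝ :=
  (g₁ / p) ^ p * (1 + 2 ^ g₁ * (4 * q) ^ g₁)

/-- The higher integrability density. -/
noncomputable def gainDensity (G : ℝ → ℝ) (ρ κ d β : ℝ) (η : Euc n → ℝ) (u : Euc n × ℝ → ℝ)
    (z : Euc n × ℝ) : ℝ :=
  G (trunc κ d (u z) * η z.1 / ρ) * (trunc κ d (u z) ^ 2 * η z.1) ^ β

theorem sobolevDensity_nonneg (Y : YoungPair g₀ g₁ g G) {ρ κ d : ℝ} (hd : 0 < d) {η : Euc n → ℝ}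
    (hη : ∀ x, 0 ≤ η x) (u : Euc n × ℝ → ℝ) (Du : Euc n × ℝ → Euc n) (z : Euc n × ℝ) :
    0 ≤ sobolevDensity G ρ κ d η u Du z :=
  add_nonneg (mul_nonneg (mul_nonneg (truncation_bounds hd _).1 (hη _)) (Y.prim_nonneg _))
    (Y.prim_nonneg _)

/-- The function to which the Sobolev inequality is applied. -/
noncomputable def sobolevTest (G : ℝ → ℝ) (ρ κ d p : ℝ) (η : Euc n → ℝ) (u : Euc n × ℝ → ℝ)
    (t : ℝ) (x : Euc n) : ℝ :=
  G (trunc κ d (u (x, t)) * η x / ρ) ^ (1 / p)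

theorem contDiff_sobolevTest (Y : YoungPair g₀ g₁ g G) (h1 : 1 ≤ g₁) {p ρ κ d : ℝ} (hp : 0 < p)
    (hpg : p < g₀) {η : Euc n → ℝ} (hη : ContDiff ℝ 1 η) {u : Euc n × ℝ → ℝ}
    (hu : ContDiff ℝ 1 u) (t : ℝ) : ContDiff ℝ 1 (sobolevTest G ρ κ d p η u t) := by
  have hroot : ContDiff ℝ 1 fun s => G s ^ (1 / p) := by
    rw [contDiff_one_iff_deriv]
    have hd := Y.hasDerivAt_root hp hpg (by linarith)
    refine ⟨fun s => (hd s).differentiableAt, ?_⟩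
    rw [funext fun s => (hd s).deriv]
    exact Y.continuous_rootDeriv hp hpg (by linarith)
  refine hroot.comp (ContDiff.div_const ?_ _)
  exact ((contDiff_trunc κ d).comp (hu.comp (contDiff_id.prodMk contDiff_const))).mul hη

/-- By the chain rule and `rootDeriv_mul_rpow_le`, everything reduces to G(b/ρ) and G(|∇b|) for the
truncation b times the cutoff. Since `truncDeriv` times η is at most 1, convexity lets this factor
leave G and become the weight present in the energy estimate. -/
theorem norm_fderiv_sobolevTest_rpow_le (Y : YoungPair g₀ g₁ g G) (h1 : 1 ≤ g₁)
    {p ρ κ d R : ℝ} (hp : 0 < p) (hg0 : 1 ≤ g₀)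
    (hpg : p < g₀) (hρ : 0 < ρ) (hρR : ρ / 2 ≤ R) (hd : 0 < d) {q : ℕ} (hq : 2 ≤ q)
    {x₀ : Euc n} {u : Euc n × ℝ → ℝ} (hu : ContDiff ℝ 1 u) (t : ℝ) (x : Euc n) :
    ‖fderiv ℝ (sobolevTest G ρ κ d p (cutoff x₀ R q) u t) x‖ ^ p
      ≤ gradConst g₁ p q * ρ ^ (-p)
        * sobolevDensity G ρ κ d (cutoff x₀ R q) u (spaceGrad u) (x, t) := by
  have hR : 0 < R := by linarith
  have hη := contDiff_cutoff (x₀ := x₀) (R := R) hq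
  have hη0 := cutoff_nonneg (x₀ := x₀) (R := R) (q := q) x
  have hη1 := cutoff_le_one (x₀ := x₀) (R := R) (q := q) x
  obtain ⟨hh0, hh1, ht0, -⟩ := truncation_bounds (κ := κ) hd (u (x, t))
  set b : Euc n → ℝ := fun x => trunc κ d (u (x, t)) * cutoff x₀ R q x with hb
  have hbC : ContDiff ℝ 1 b :=
    ((contDiff_trunc κ d).comp (hu.comp (contDiff_id.prodMk contDiff_const))).mul hη
  have hbd : HasFDerivAt (fun x => b x / ρ) (ρ⁻¹ • fderiv ℝ b x) x := by
    have := (hbC.differentiable one_ne_zero x).hasFDerivAt.mul_const ρ⁻¹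
    simpa only [div_eq_mul_inv] using this
  have hw := (Y.hasDerivAt_root hp hpg (by linarith) (b x / ρ)).comp_hasFDerivAt x hbd
  have hw' : fderiv ℝ (sobolevTest G ρ κ d p (cutoff x₀ R q) u t) x = _ := hw.fderiv
  have hrd := Y.rootDeriv_nonneg hp (b x / ρ)
  have hng : ‖fderiv ℝ b x‖ = ‖gradient b x‖ := by
    rw [gradient, LinearIsometryEquiv.norm_map]
  have hgb : ‖gradient b x‖ ≤ truncDeriv κ d (u (x, t)) * cutoff x₀ R q x * ‖spaceGrad u (x, t)‖
      + 4 * q * (trunc κ d (u (x, t)) / ρ) := by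
    rw [hb, gradient_comp_mul hu hη (hasDerivAt_trunc κ d) t x]
    refine (norm_add_le _ _).trans ?_
    rw [norm_smul, norm_smul, Real.norm_of_nonneg (mul_nonneg hh0 hη0), Real.norm_of_nonneg ht0]
    refine add_le_add le_rfl ?_
    have h3 : ‖gradient (cutoff x₀ R q) x‖ ≤ q * (4 / ρ) := by
      refine (norm_gradient_cutoff_le hR hq x).trans ?_
      have h4 : cutoffBase x₀ R x ^ (q - 1) ≤ 1 :=
        pow_le_one₀ (cutoffBase_nonneg _) (cutoffBase_le_one _)
      have h5 : 2 / R ≤ 4 / ρ := by rw [div_le_div_iff₀ hR hρ]; linarith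
      calc (q : ℝ) * cutoffBase x₀ R x ^ (q - 1) * (2 / R) ≤ q * 1 * (4 / ρ) := by gcongr
        _ = _ := by ring
    calc trunc κ d (u (x, t)) * ‖gradient (cutoff x₀ R q) x‖
        ≤ trunc κ d (u (x, t)) * (q * (4 / ρ)) := mul_le_mul_of_nonneg_left h3 ht0
      _ = _ := by ring
  have hq1 : (1 : ℝ) ≤ 4 * q := by
    have : (2 : ℝ) ≤ q := by exact_mod_cast hq
    linarith
  have h2g : (1 : ℝ) ≤ (4 * q : ℝ) ^ g₁ := Real.one_le_rpow hq1 (by linarith)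
  set A := truncDeriv κ d (u (x, t)) * cutoff x₀ R q x * G ‖spaceGrad u (x, t)‖ with hA
  set B := G (trunc κ d (u (x, t)) / ρ) with hB
  have hA0 : 0 ≤ A := mul_nonneg (mul_nonneg hh0 hη0) (Y.prim_nonneg _)
  have hB0 : 0 ≤ B := Y.prim_nonneg _
  have hGgrad : G ‖gradient b x‖ ≤ 2 ^ g₁ * (4 * q) ^ g₁ * (A + B) := by
    calc G ‖gradient b x‖ ≤ 2 ^ g₁ * (G (truncDeriv κ d (u (x, t)) * cutoff x₀ R q x
            * ‖spaceGrad u (x, t)‖) + G (4 * q * (trunc κ d (u (x, t)) / ρ))) :=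
          (Y.prim_monotone hgb).trans (Y.prim_add_le _ _)
      _ ≤ 2 ^ g₁ * (A + (4 * q) ^ g₁ * B) := by
          refine mul_le_mul_of_nonneg_left (add_le_add ?_ (Y.prim_mul_le hq1)) (by positivity)
          exact Y.prim_mul_le_mul hg0 (mul_nonneg hh0 hη0) (mul_le_one₀ hh1 hη0 hη1)
      _ ≤ 2 ^ g₁ * ((4 * q) ^ g₁ * A + (4 * q) ^ g₁ * B) := by
          refine mul_le_mul_of_nonneg_left (add_le_add ?_ le_rfl) (by positivity)
          exact le_mul_of_one_le_left hA0 h2g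
      _ = _ := by ring
  have hGb : G (b x / ρ) ≤ A + B := by
    have : b x / ρ ≤ trunc κ d (u (x, t)) / ρ := by
      gcongr
      exact mul_le_of_le_one_right ht0 hη1
    linarith [Y.prim_monotone this]
  rw [hw', norm_smul, Real.norm_of_nonneg hrd, norm_smul, Real.norm_of_nonneg (by positivity), hng]
  have hr := Y.rootDeriv_mul_rpow_le (s := b x / ρ) hp hpg.le (by linarith)
    (norm_nonneg (gradient b x))
  have hc : 0 ≤ (g₁ / p) ^ p := Real.rpow_nonneg (by positivity) _
  calc (YoungPair.rootDeriv g G p (b x / ρ) * (ρ⁻¹ * ‖gradient b x‖)) ^ p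
      = ρ ^ (-p) * (YoungPair.rootDeriv g G p (b x / ρ) * ‖gradient b x‖) ^ p := by
        rw [mul_left_comm, Real.mul_rpow (by positivity) (mul_nonneg hrd (norm_nonneg _)),
          Real.inv_rpow hρ.le, Real.rpow_neg hρ.le]
    _ ≤ ρ ^ (-p) * ((g₁ / p) ^ p * ((A + B) + 2 ^ g₁ * (4 * q) ^ g₁ * (A + B))) := by
        refine mul_le_mul_of_nonneg_left (hr.trans ?_) (Real.rpow_nonneg hρ.le _)
        exact mul_le_mul_of_nonneg_left (add_le_add hGb hGgrad) hc
    _ = gradConst g₁ p q * ρ ^ (-p) * (A + B) := by rw [gradConst]; ring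

theorem continuous_sobolevDensity (Y : YoungPair g₀ g₁ g G) {ρ κ d : ℝ} {η : Euc n → ℝ}
    (hη : Continuous η) {u : Euc n × ℝ → ℝ} (hu : ContDiff ℝ 1 u) :
    Continuous (sobolevDensity G ρ κ d η u (spaceGrad u)) := by
  have h1 := Y.prim_continuous
  have h2 := hu.continuous
  have h3 := continuous_spaceGrad hu
  have h4 := continuous_trunc κ d
  have h5 := continuous_truncDeriv κ d
  unfold sobolevDensity
  fun_prop

theorem continuous_gainDensity (Y : YoungPair g₀ g₁ g G) {ρ κ d β : ℝ} (hβ : 0 ≤ β) {η : Euc n → ℝ}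
    (hη : Continuous η) {u : Euc n × ℝ → ℝ} (hu : Continuous u) :
    Continuous (gainDensity G ρ κ d β η u) := by
  have h1 := Y.prim_continuous
  have h4 := continuous_trunc κ d
  unfold gainDensity
  refine Continuous.mul (by fun_prop) (Continuous.rpow_const (by fun_prop) fun _ => Or.inr hβ)

/-- `CS` is a constant for the Sobolev inequality with exponent `p`. -/
def IsSobolevConst (n : ℕ) (p : ℝ) (CS : NNReal) : Prop :=
  ∀ (w : Euc n → ℝ) (V : Euc n → ENNReal), ContDiff ℝ 1 w → HasCompactSupport w → Measurable V →
    ∫⁻ x, ‖w x‖ₑ ^ p * V x ^ (p / n)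
      ≤ CS * (∫⁻ x, ‖fderiv ℝ w x‖ₑ ^ p) * (∫⁻ x, V x) ^ (p / n)

theorem gradConst_nonneg (h1 : 0 ≤ g₁) {p : ℝ} (hp : 0 < p) (q : ℕ) : 0 ≤ gradConst g₁ p q := by
  unfold gradConst; positivity

/-- Gain of integrability on a time slice. -/
theorem lintegral_gainDensity_slice_le {p : ℝ} {CS : NNReal} (hCS : IsSobolevConst n p CS)
    (Y : YoungPair g₀ g₁ g G) (h1 : 1 ≤ g₁)
    {ρ κ d R : ℝ} (hp : 0 < p) (hg0 : 1 ≤ g₀)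
    (hpg : p < g₀) (hρ : 0 < ρ) (hρR : ρ / 2 ≤ R) (hd : 0 < d) {q : ℕ} (hq : 2 ≤ q)
    {x₀ : Euc n} {u : Euc n × ℝ → ℝ} (hu : ContDiff ℝ 1 u) (t : ℝ) {T : ℝ}
    (hT : 2 * ∫ x, truncPrim κ d (u (x, t)) * cutoff x₀ R q x ≤ T) :
    ∫⁻ x in Metric.closedBall x₀ R,
        ENNReal.ofReal (gainDensity G ρ κ d (p / n) (cutoff x₀ R q) u (x, t))
      ≤ ENNReal.ofReal (CS * (gradConst g₁ p q * ρ ^ (-p)) * T ^ (p / n)) *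
        ∫⁻ x in Metric.closedBall x₀ R, ENNReal.ofReal
          (sobolevDensity G ρ κ d (cutoff x₀ R q) u (spaceGrad u) (x, t)) := by
  have hR : 0 < R := by linarith
  have hq0 : q ≠ 0 := by omega
  have hη := contDiff_cutoff (x₀ := x₀) (R := R) hq
  have hβ : 0 ≤ p / n := by positivity
  have hηn := cutoff_nonneg (x₀ := x₀) (R := R) (q := q)
  have hηz : ∀ x ∉ Metric.closedBall x₀ R, cutoff x₀ R q x = 0 := fun x hx =>
    cutoff_eq_zero hR hq0 hx
  have huc : Continuous fun x : Euc n => u (x, t) := hu.continuous.comp (by fun_prop)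
  have htc := continuous_trunc κ d
  have htp := continuous_truncPrim κ d
  have hηc := hη.continuous
  set w := sobolevTest G ρ κ d p (cutoff x₀ R q) u t with hw
  have hwz : ∀ x ∉ Metric.closedBall x₀ R, w x = 0 := fun x hx => by
    rw [hw, sobolevTest, hηz x hx, mul_zero, zero_div, Y.prim_zero_of_nonpos 0 le_rfl,
      Real.zero_rpow (by positivity)]
  have hwC := contDiff_sobolevTest (ρ := ρ) (κ := κ) (d := d) Y h1 hp hpg hη hu t
  have hwc : HasCompactSupport w := HasCompactSupport.intro (isCompact_closedBall x₀ R) hwz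
  set V : Euc n → ℝ := fun x => trunc κ d (u (x, t)) ^ 2 * cutoff x₀ R q x with hV
  have hVc : Continuous V := by fun_prop
  have hV0 : ∀ x, 0 ≤ V x := fun x => mul_nonneg (sq_nonneg _) (hηn x)
  have hS := hCS w (fun x => ENNReal.ofReal (V x)) hwC hwc
    (ENNReal.measurable_ofReal.comp hVc.measurable)
  have e1 : ∀ x, ENNReal.ofReal (gainDensity G ρ κ d (p / n) (cutoff x₀ R q) u (x, t))
      = ‖w x‖ₑ ^ p * ENNReal.ofReal (V x) ^ (p / n) := by
    intro x
    have hG := Y.prim_nonneg (trunc κ d (u (x, t)) * cutoff x₀ R q x / ρ)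
    show ENNReal.ofReal (G (trunc κ d (u (x, t)) * cutoff x₀ R q x / ρ) * V x ^ (p / n))
      = ‖G (trunc κ d (u (x, t)) * cutoff x₀ R q x / ρ) ^ (1 / p)‖ₑ ^ p * _
    rw [ENNReal.ofReal_mul hG, Real.enorm_eq_ofReal (Real.rpow_nonneg hG _),
      ENNReal.ofReal_rpow_of_nonneg (Real.rpow_nonneg hG _) hp.le,
      ENNReal.ofReal_rpow_of_nonneg (hV0 x) hβ, ← Real.rpow_mul hG, one_div_mul_cancel hp.ne',
      Real.rpow_one]
  have e2 : ∫⁻ x, ‖fderiv ℝ w x‖ₑ ^ p ≤ ENNReal.ofReal (gradConst g₁ p q * ρ ^ (-p)) *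
      ∫⁻ x in Metric.closedBall x₀ R, ENNReal.ofReal
        (sobolevDensity G ρ κ d (cutoff x₀ R q) u (spaceGrad u) (x, t)) := by
    have hfz : ∀ x ∉ Metric.closedBall x₀ R, ‖fderiv ℝ w x‖ₑ ^ p = 0 := by
      intro x hx
      have hev : w =ᶠ[𝓝 x] fun _ => 0 := by
        filter_upwards [Metric.isClosed_closedBall.isOpen_compl.mem_nhds hx] with y hy
        exact hwz y hy
      have h0 : fderiv ℝ w x = 0 := by rw [hev.fderiv_eq]; simp
      rw [← ofReal_norm, h0, norm_zero, ENNReal.ofReal_zero, ENNReal.zero_rpow_of_pos hp]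
    have hsupp : (Function.support fun x => ‖fderiv ℝ w x‖ₑ ^ p) ⊆ Metric.closedBall x₀ R := by
      intro x hx
      by_contra hn
      exact hx (hfz x hn)
    rw [← setLIntegral_eq_of_support_subset hsupp, ← lintegral_const_mul' _ _ ENNReal.ofReal_ne_top]
    refine lintegral_mono fun x => ?_
    have hc : 0 ≤ gradConst g₁ p q * ρ ^ (-p) :=
      mul_nonneg (gradConst_nonneg (by linarith) hp q) (Real.rpow_nonneg hρ.le _)
    rw [← ENNReal.ofReal_mul hc, ← ofReal_norm,
      ENNReal.ofReal_rpow_of_nonneg (norm_nonneg _) hp.le]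
    exact ENNReal.ofReal_le_ofReal (norm_fderiv_sobolevTest_rpow_le Y h1 hp hg0 hpg hρ hρR hd hq hu t x)
  have hVint : Integrable V := hVc.integrable_of_hasCompactSupport
    (HasCompactSupport.intro (isCompact_closedBall x₀ R) fun x hx => by simp [hV, hηz x hx])
  have hHint : Integrable fun x => truncPrim κ d (u (x, t)) * cutoff x₀ R q x :=
    (by fun_prop : Continuous _).integrable_of_hasCompactSupport
      (HasCompactSupport.intro (isCompact_closedBall x₀ R) fun x hx => by simp [hηz x hx])
  -- The square of the truncation is at most twice its primitive, so the slice estimate controls V.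
  have hVT : ∫ x, V x ≤ T := by
    refine le_trans ?_ hT
    rw [← integral_const_mul]
    refine integral_mono hVint (hHint.const_mul 2) fun x => ?_
    have h3 := (truncation_bounds (κ := κ) hd (u (x, t))).2.2.2.2.1
    show trunc κ d (u (x, t)) ^ 2 * cutoff x₀ R q x ≤ 2 * (truncPrim κ d (u (x, t)) * cutoff x₀ R q x)
    calc _ ≤ 2 * truncPrim κ d (u (x, t)) * cutoff x₀ R q x := mul_le_mul_of_nonneg_right h3 (hηn x)
      _ = _ := by ring
  have hT0 : 0 ≤ T := (integral_nonneg hV0).trans hVT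
  have e3 : (∫⁻ x, ENNReal.ofReal (V x)) ^ (p / n) ≤ ENNReal.ofReal (T ^ (p / n)) := by
    rw [← ofReal_integral_eq_lintegral_ofReal hVint (Eventually.of_forall hV0),
      ← ENNReal.ofReal_rpow_of_nonneg hT0 hβ]
    exact ENNReal.rpow_le_rpow (ENNReal.ofReal_le_ofReal hVT) hβ
  have hc : 0 ≤ gradConst g₁ p q * ρ ^ (-p) :=
    mul_nonneg (gradConst_nonneg (by linarith) hp q) (Real.rpow_nonneg hρ.le _)
  calc _ ≤ ∫⁻ x, ‖w x‖ₑ ^ p * ENNReal.ofReal (V x) ^ (p / n) := by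
        simp only [e1]
        exact setLIntegral_le_lintegral _ _
    _ ≤ CS * (∫⁻ x, ‖fderiv ℝ w x‖ₑ ^ p) * (∫⁻ x, ENNReal.ofReal (V x)) ^ (p / n) := hS
    _ ≤ CS * (ENNReal.ofReal (gradConst g₁ p q * ρ ^ (-p)) *
          ∫⁻ x in Metric.closedBall x₀ R, ENNReal.ofReal
            (sobolevDensity G ρ κ d (cutoff x₀ R q) u (spaceGrad u) (x, t)))
          * ENNReal.ofReal (T ^ (p / n)) := by gcongr
    _ = _ := by
        rw [ENNReal.ofReal_mul (mul_nonneg CS.coe_nonneg hc), ENNReal.ofReal_mul CS.coe_nonneg,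
          ENNReal.ofReal_coe_nnreal]
        ring

end Step

end ParabolicOrlicz

namespace ParabolicOrlicz
open Filter Topology

/-! ### Sobolev gain on cylinders. -/

section Step

variable {n : ℕ} {g₀ g₁ ν C₁ : ℝ} {g G : ℝ → ℝ}
variable {K : Set (Euc n × ℝ)} {u : Euc n × ℝ → ℝ} {Du F : Euc n × ℝ → Euc n}
  {um : ℕ → Euc n × ℝ → ℝ} {Fm : ℕ → Euc n × ℝ → Euc n} {M : Euc n × ℝ → ℝ}
  {Mm : ℕ → Euc n × ℝ → ℝ}

theorem trunc_le_max {κ d : ℝ} (hd : 0 < d) (s : ℝ) : trunc κ d s ≤ max (s - κ) 0 := by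
  obtain ⟨-, h1, -, h2, -⟩ := truncation_bounds (κ := κ) hd s
  exact h2.trans (mul_le_of_le_one_right (le_max_right _ _) h1)

theorem SmoothApprox.integrableOn_weightedGrad (S : SmoothApprox G K u Du F um Fm M Mm)
    (Y : YoungPair g₀ g₁ g G) (hK : MeasurableSet K) {x₀ : Euc n} {R κ d : ℝ} {q : ℕ} (hq : 2 ≤ q)
    (hd : 0 < d) :
    IntegrableOn (fun z => truncDeriv κ d (u z) * cutoff x₀ R q z.1 * G ‖Du z‖) K := by
  have hc1 := Y.prim_continuous
  have hc3 := continuous_truncDeriv κ d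
  have hc4 := (contDiff_cutoff (x₀ := x₀) (R := R) hq).continuous
  refine (S.tendsto_integral_abs_sub hK (C := 1) (fm := fun m z =>
    truncDeriv κ d (um m z) * cutoff x₀ R q z.1 * G ‖spaceGrad (um m) z‖) (fun m => ?_) ?_ ?_).1
  · have h1 := (S.contDiff_fun m).continuous
    have h3 := continuous_spaceGrad (S.contDiff_fun m)
    fun_prop
  · filter_upwards [S.tendsto_fun, S.tendsto_grad] with z h1 h2
    exact (((hc3.tendsto _).comp h1).mul_const _).mul ((hc1.tendsto _).comp h2.norm)
  · intro m z hz
    obtain ⟨hh0, hh1, -⟩ := truncation_bounds (κ := κ) hd (um m z)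
    have hη0 := cutoff_nonneg (x₀ := x₀) (R := R) (q := q) z.1
    have hη1 := cutoff_le_one (x₀ := x₀) (R := R) (q := q) z.1
    have hG := Y.prim_nonneg ‖spaceGrad (um m) z‖
    rw [abs_of_nonneg (mul_nonneg (mul_nonneg hh0 hη0) hG), one_mul]
    exact (mul_le_of_le_one_left hG (mul_le_one₀ hh1 hη0 hη1)).trans (S.prim_grad_le m z hz)

theorem SmoothApprox.tendsto_sobolevDensity (S : SmoothApprox G K u Du F um Fm M Mm)
    (Y : YoungPair g₀ g₁ g G) (hK : MeasurableSet K) {x₀ : Euc n} {ρ R κ d : ℝ} {q : ℕ}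
    (hq : 2 ≤ q) (hκ : 0 ≤ κ) (hd : 0 < d) :
    IntegrableOn (sobolevDensity G ρ κ d (cutoff x₀ R q) u Du) K ∧
      (∀ m, IntegrableOn (sobolevDensity G ρ κ d (cutoff x₀ R q) (um m) (spaceGrad (um m))) K) ∧
      Tendsto (fun m => ∫ z in K, |sobolevDensity G ρ κ d (cutoff x₀ R q) (um m)
        (spaceGrad (um m)) z - sobolevDensity G ρ κ d (cutoff x₀ R q) u Du z|) atTop (𝓝 0) := by
  have hc1 := Y.prim_continuous
  have hc2 := continuous_trunc κ d
  have hc3 := continuous_truncDeriv κ d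
  have hη := contDiff_cutoff (x₀ := x₀) (R := R) hq
  refine S.tendsto_integral_abs_sub hK (C := 1 + max 1 ρ⁻¹ ^ g₁)
    (fun m => continuous_sobolevDensity Y hη.continuous (S.contDiff_fun m)) ?_ ?_
  · filter_upwards [S.tendsto_fun, S.tendsto_grad] with z h1 h2
    refine Tendsto.add ((((hc3.tendsto _).comp h1).mul_const _).mul
      ((hc1.tendsto _).comp h2.norm)) ?_
    exact (hc1.tendsto _).comp (((hc2.tendsto _).comp h1).div_const ρ)
  · intro m z hz
    obtain ⟨hh0, hh1, ht0, -⟩ := truncation_bounds (κ := κ) hd (um m z)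
    have hη0 := cutoff_nonneg (x₀ := x₀) (R := R) (q := q) z.1
    have hη1 := cutoff_le_one (x₀ := x₀) (R := R) (q := q) z.1
    have hG := Y.prim_nonneg ‖spaceGrad (um m) z‖
    rw [abs_of_nonneg (sobolevDensity_nonneg Y hd cutoff_nonneg _ _ _), add_mul, one_mul]
    refine add_le_add ?_ ?_
    · exact (mul_le_of_le_one_left hG (mul_le_one₀ hh1 hη0 hη1)).trans (S.prim_grad_le m z hz)
    · refine (Y.prim_div_le ht0).trans (mul_le_mul_of_nonneg_left ?_ (by positivity))
      exact (Y.prim_monotone ((trunc_le_max hd _).trans (max_sub_zero_le_abs hκ))).trans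
        (S.prim_le m z hz)

/-- On the shorter cylinder the time weight is at least δθ, so it can be divided out of the gradient
estimate. The G term of the truncation is below the excess. -/
theorem SmoothApprox.integral_sobolevDensity_le {x₀ : Euc n} {t₀ ρ θ : ℝ}
    (S : SmoothApprox G (closedCylinder x₀ t₀ ρ θ) u Du F um Fm M Mm)
    (Y : YoungPair g₀ g₁ g G) (h1 : 1 ≤ g₁) (hν : 0 < ν) (hν1 : ν ≤ 1)
    (hC₁ : 1 ≤ C₁) {q : ℕ} (hq : 2 ≤ q) (hqg : g₁ ≤ q)
    (hcoer : ∀ z, ν * G ‖Du z‖ ≤ inner ℝ (F z) (Du z)) (hgrow : ∀ z, ‖F z‖ ≤ C₁ * g ‖Du z‖)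
    {R τ τ' κ d δ : ℝ} (hρ : 0 < ρ) (hρR : ρ / 2 ≤ R) (hRρ : R ≤ ρ) (hθ : 0 < θ) (hτ0 : 0 < τ)
    (hτ : τ ≤ θ) (hκ : 0 ≤ κ) (hd : 0 < d) (hδ : 0 < δ) (hδ1 : δ ≤ 1) (hτ' : δ * θ ≤ τ - τ') :
    ∫ z in closedCylinder x₀ t₀ R τ', sobolevDensity G ρ κ d (cutoff x₀ R q) u Du z
      ≤ (2 * energyConst g₁ ν C₁ q / ν + 1) / δ
        * ∫ z in closedCylinder x₀ t₀ R τ, excess G ρ θ κ u z := by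
  have hKm := measurableSet_closedCylinder x₀ t₀ ρ θ
  have hKR := measurableSet_closedCylinder x₀ t₀ R τ
  have hKR' := measurableSet_closedCylinder x₀ t₀ R τ'
  have hττ : τ' ≤ τ := by have := mul_pos hδ hθ; linarith
  have hsubK : closedCylinder x₀ t₀ R τ ⊆ closedCylinder x₀ t₀ ρ θ := closedCylinder_mono hRρ hτ
  have hsubR : closedCylinder x₀ t₀ R τ' ⊆ closedCylinder x₀ t₀ R τ := closedCylinder_mono le_rfl hττ
  have hD := S.integrableOn_weightedGrad (x₀ := x₀) (R := R) (κ := κ) Y hKm hq hd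
  have hex := (S.integrableOn_excess (ρ := ρ) Y hKm hθ hκ).mono_set hsubK
  have hsob := ((S.tendsto_sobolevDensity (x₀ := x₀) (ρ := ρ) (R := R) Y hKm hq hκ hd).1.mono_set
    (hsubR.trans hsubK))
  have hE := (S.energy_bounds Y h1 hν hν1 hC₁ hq hqg hcoer hgrow hρ hρR hRρ hθ hτ0 hτ hκ hd hD).2
  set D := fun z : Euc n × ℝ => truncDeriv κ d (u z) * cutoff x₀ R q z.1 * G ‖Du z‖ with hDdef
  set X := ∫ z in closedCylinder x₀ t₀ R τ, excess G ρ θ κ u z with hX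
  set C := energyConst g₁ ν C₁ q
  have hDn : ∀ z, 0 ≤ D z := fun z => mul_nonneg (mul_nonneg
    (truncation_bounds (κ := κ) hd (u z)).1 (cutoff_nonneg _)) (Y.prim_nonneg _)
  have hexn : ∀ z, 0 ≤ excess G ρ θ κ u z := fun z => excess_nonneg Y hθ u z
  have hDR := hD.mono_set hsubK
  have htD : IntegrableOn (fun z => (z.2 - (t₀ - τ)) * D z) (closedCylinder x₀ t₀ R τ) := by
    refine hDR.bdd_mul (c := θ)
      (by fun_prop : Continuous fun z : Euc n × ℝ => z.2 - (t₀ - τ)).aestronglyMeasurable ?_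
    filter_upwards [ae_restrict_mem hKR] with z hz
    have h5 := hz.2.1
    have h6 := hz.2.2
    rw [Real.norm_eq_abs, abs_le]
    constructor <;> linarith
  have e1 : δ * θ * ∫ z in closedCylinder x₀ t₀ R τ', D z
      ≤ ∫ z in closedCylinder x₀ t₀ R τ, (z.2 - (t₀ - τ)) * D z := by
    rw [← integral_const_mul]
    calc ∫ z in closedCylinder x₀ t₀ R τ', δ * θ * D z
        ≤ ∫ z in closedCylinder x₀ t₀ R τ', (z.2 - (t₀ - τ)) * D z := by
          refine setIntegral_mono_on ((hDR.mono_set hsubR).const_mul _) (htD.mono_set hsubR) hKR'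
            fun z hz => mul_le_mul_of_nonneg_right ?_ (hDn z)
          have := hz.2.1
          linarith
      _ ≤ _ := by
          refine setIntegral_mono_set htD ?_ hsubR.eventuallyLE
          filter_upwards [ae_restrict_mem hKR] with z hz
          have := hz.2.1
          exact mul_nonneg (by linarith) (hDn z)
  have e2 : ∫ z in closedCylinder x₀ t₀ R τ', D z ≤ 2 * C / ν / δ * X := by
    have h5 : ν / 2 * (δ * θ * ∫ z in closedCylinder x₀ t₀ R τ', D z) ≤ θ * (C * X) :=
      (mul_le_mul_of_nonneg_left e1 (by positivity)).trans hE
    have h6 : (∫ z in closedCylinder x₀ t₀ R τ', D z) * (ν * δ * θ) ≤ 2 * C * X * θ := by linarith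
    have h7 : (∫ z in closedCylinder x₀ t₀ R τ', D z) * (ν * δ) ≤ 2 * C * X := by
      refine le_of_mul_le_mul_right ?_ hθ
      linarith
    calc _ ≤ 2 * C * X / (ν * δ) := (le_div_iff₀ (by positivity)).2 h7
      _ = _ := by field_simp
  have e3 : ∫ z in closedCylinder x₀ t₀ R τ', (D z + excess G ρ θ κ u z) ≤ 2 * C / ν / δ * X + X := by
    rw [integral_add (hDR.mono_set hsubR) (hex.mono_set hsubR)]
    refine add_le_add e2 ?_
    exact setIntegral_mono_set hex (Eventually.of_forall hexn) hsubR.eventuallyLE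
  have hX0 : 0 ≤ X := integral_nonneg hexn
  have e4 : X ≤ 1 / δ * X := le_mul_of_one_le_left hX0 (by rw [le_div_iff₀ hδ]; linarith)
  calc _ ≤ ∫ z in closedCylinder x₀ t₀ R τ', (D z + excess G ρ θ κ u z) := by
        refine integral_mono hsob ((hDR.mono_set hsubR).add (hex.mono_set hsubR)) fun z => ?_
        refine add_le_add le_rfl ?_
        have h5 : trunc κ d (u z) / ρ ≤ max (u z - κ) 0 / ρ := by
          gcongr; exact trunc_le_max hd _
        exact (Y.prim_monotone h5).trans (le_add_of_nonneg_right (by positivity))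
    _ ≤ 2 * C / ν / δ * X + 1 / δ * X := e3.trans (by linarith)
    _ = _ := by ring

/-- Gain of integrability on a space-time cylinder. -/
theorem SmoothApprox.lintegral_gainDensity_le {x₀ : Euc n} {t₀ ρ θ : ℝ}
    (S : SmoothApprox G (closedCylinder x₀ t₀ ρ θ) u Du F um Fm M Mm)
    {p : ℝ} {CS : NNReal} (hCS : IsSobolevConst n p CS) (hp : 0 < p) (hg0 : 1 ≤ g₀) (hpg : p < g₀)
    (Y : YoungPair g₀ g₁ g G) (h1 : 1 ≤ g₁) (hν : 0 < ν) (hν1 : ν ≤ 1)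
    (hC₁ : 1 ≤ C₁) {q : ℕ} (hq : 2 ≤ q) (hqg : g₁ ≤ q)
    (hcoer : ∀ z, ν * G ‖Du z‖ ≤ inner ℝ (F z) (Du z)) (hgrow : ∀ z, ‖F z‖ ≤ C₁ * g ‖Du z‖)
    {R τ τ' κ d δ : ℝ} (hρ : 0 < ρ) (hρR : ρ / 2 ≤ R) (hRρ : R ≤ ρ) (hθ : 0 < θ) (hτ0 : 0 < τ)
    (hτ : τ ≤ θ) (hκ : 0 ≤ κ) (hd : 0 < d) (hδ : 0 < δ) (hτ' : δ * θ ≤ τ - τ') :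
    ∫⁻ z in closedCylinder x₀ t₀ R τ',
        ENNReal.ofReal (gainDensity G ρ κ d (p / n) (cutoff x₀ R q) u z)
      ≤ ENNReal.ofReal (CS * (gradConst g₁ p q * ρ ^ (-p))
        * (2 / δ * (energyConst g₁ ν C₁ q
          * ∫ z in closedCylinder x₀ t₀ R τ, excess G ρ θ κ u z)) ^ (p / n)
        * ∫ z in closedCylinder x₀ t₀ R τ', sobolevDensity G ρ κ d (cutoff x₀ R q) u Du z) := by
  have hKm := measurableSet_closedCylinder x₀ t₀ ρ θ
  have hττ : τ' ≤ τ := by have := mul_pos hδ hθ; linarith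
  have hsub : closedCylinder x₀ t₀ R τ' ⊆ closedCylinder x₀ t₀ ρ θ :=
    closedCylinder_mono hRρ (hττ.trans hτ)
  have hD := S.integrableOn_weightedGrad (x₀ := x₀) (R := R) (κ := κ) Y hKm hq hd
  obtain ⟨e, he, he0, hslice⟩ :=
    (S.energy_bounds Y h1 hν hν1 hC₁ hq hqg hcoer hgrow hρ hρR hRρ hθ hτ0 hτ hκ hd hD).1
  obtain ⟨hsob, hsobm, hsoblim⟩ :=
    S.tendsto_sobolevDensity (x₀ := x₀) (ρ := ρ) (R := R) Y hKm hq hκ hd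
  set X := ∫ z in closedCylinder x₀ t₀ R τ, excess G ρ θ κ u z with hX
  set C := energyConst g₁ ν C₁ q
  set c := (CS : ℝ) * (gradConst g₁ p q * ρ ^ (-p)) with hc
  have hβ : 0 ≤ p / n := by positivity
  have hX0 : 0 ≤ X := integral_nonneg fun z => excess_nonneg Y hθ u z
  have hC0 : 0 < C := energyConst_pos (by linarith) hν (by linarith) q
  have hηc := (contDiff_cutoff (x₀ := x₀) (R := R) hq).continuous
  set T := fun m => 2 / δ * (C * X + e m / θ) with hT
  have hTnn : ∀ m, 0 ≤ T m := fun m => mul_nonneg (by positivity)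
    (add_nonneg (by positivity) (div_nonneg (he0 m) hθ.le))
  have hc0 : 0 ≤ c := mul_nonneg CS.coe_nonneg
    (mul_nonneg (gradConst_nonneg (by linarith) hp q) (Real.rpow_nonneg hρ.le _))
  set γ := fun m z => gainDensity G ρ κ d (p / n) (cutoff x₀ R q) (um m) z with hγ
  set σ := fun m z => sobolevDensity G ρ κ d (cutoff x₀ R q) (um m) (spaceGrad (um m)) z with hσ
  have hγc : ∀ m, Continuous (γ m) := fun m =>
    continuous_gainDensity Y hβ hηc (S.contDiff_fun m).continuous
  have hσc : ∀ m, Continuous (σ m) := fun m =>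
    continuous_sobolevDensity Y hηc (S.contDiff_fun m)
  have hσn : ∀ m z, 0 ≤ σ m z := fun m z => sobolevDensity_nonneg Y hd cutoff_nonneg _ _ z
  have hvol : (volume : Measure (Euc n × ℝ)) = (volume : Measure (Euc n)).prod volume := rfl
  -- The slice inequality is integrated in time. The bound T m on the slice mass is the same for all
  -- t, since the time weight is at least δθ there.
  have hm : ∀ m, ∫⁻ z in closedCylinder x₀ t₀ R τ', ENNReal.ofReal (γ m z)
      ≤ ENNReal.ofReal (c * T m ^ (p / n) * ∫ z in closedCylinder x₀ t₀ R τ', σ m z) := by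
    intro m
    have hcT : 0 ≤ c * T m ^ (p / n) := mul_nonneg hc0 (Real.rpow_nonneg (hTnn m) _)
    have hσi : ENNReal.ofReal (∫ z in closedCylinder x₀ t₀ R τ', σ m z)
        = ∫⁻ z in closedCylinder x₀ t₀ R τ', ENNReal.ofReal (σ m z) :=
      ofReal_integral_eq_lintegral_ofReal ((hsobm m).mono_set hsub) (Eventually.of_forall (hσn m))
    rw [ENNReal.ofReal_mul hcT, hσi, closedCylinder, hvol,
      setLIntegral_prod_symm (fun z => ENNReal.ofReal (γ m z))
        (ENNReal.measurable_ofReal.comp (hγc m).measurable).aemeasurable,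
      setLIntegral_prod_symm (fun z => ENNReal.ofReal (σ m z))
        (ENNReal.measurable_ofReal.comp (hσc m).measurable).aemeasurable,
      ← lintegral_const_mul' _ _ ENNReal.ofReal_ne_top]
    refine setLIntegral_mono' measurableSet_Icc fun t ht => ?_
    refine lintegral_gainDensity_slice_le hCS Y h1 hp hg0 hpg hρ hρR hd hq (S.contDiff_fun m) t ?_
    have ht' := hslice m t ⟨by linarith [ht.1], ht.2⟩
    set I := ∫ x, truncPrim κ d (um m (x, t)) * cutoff x₀ R q x
    have hI0 : 0 ≤ I := integral_nonneg fun x => mul_nonneg (by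
      have h5 := (truncation_bounds (κ := κ) hd (um m (x, t))).2.2.2.2.1
      have h6 := sq_nonneg (trunc κ d (um m (x, t)))
      linarith) (cutoff_nonneg x)
    have h5 : δ * θ * I ≤ θ * (C * X) + e m :=
      (mul_le_mul_of_nonneg_right (by linarith [ht.1]) hI0).trans ht'
    calc 2 * I = 2 / δ * (δ * θ * I / θ) := by field_simp
      _ ≤ 2 / δ * ((θ * (C * X) + e m) / θ) := by gcongr
      _ = T m := by rw [hT]; field_simp
  have hlimT : Tendsto T atTop (𝓝 (2 / δ * (C * X))) := by
    have := ((he.div_const θ).const_add (C * X)).const_mul (2 / δ)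
    simpa using this
  have hlimσ : Tendsto (fun m => ∫ z in closedCylinder x₀ t₀ R τ', σ m z) atTop
      (𝓝 (∫ z in closedCylinder x₀ t₀ R τ', sobolevDensity G ρ κ d (cutoff x₀ R q) u Du z)) := by
    rw [tendsto_iff_norm_sub_tendsto_zero]
    refine squeeze_zero (fun m => norm_nonneg _) (fun m => ?_) hsoblim
    rw [← integral_sub ((hsobm m).mono_set hsub) (hsob.mono_set hsub)]
    refine (norm_integral_le_integral_norm _).trans ?_
    exact setIntegral_mono_set ((hsobm m).sub hsob).abs
      (Eventually.of_forall fun z => abs_nonneg _) hsub.eventuallyLE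
  have hlim : Tendsto (fun m => ENNReal.ofReal (c * T m ^ (p / n)
      * ∫ z in closedCylinder x₀ t₀ R τ', σ m z)) atTop (𝓝 (ENNReal.ofReal (c
      * (2 / δ * (C * X)) ^ (p / n)
      * ∫ z in closedCylinder x₀ t₀ R τ', sobolevDensity G ρ κ d (cutoff x₀ R q) u Du z))) :=
    (ENNReal.continuous_ofReal.tendsto _).comp
      (((hlimT.rpow_const (Or.inr hβ)).const_mul c).mul hlimσ)
  -- The gain density has no dominating function, so only Fatou's lemma is available on the left;
  -- the right side converges.
  have hγlim : ∀ᵐ z ∂(volume.restrict (closedCylinder x₀ t₀ R τ')),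
      ENNReal.ofReal (gainDensity G ρ κ d (p / n) (cutoff x₀ R q) u z)
        = liminf (fun m => ENNReal.ofReal (γ m z)) atTop := by
    filter_upwards [ae_restrict_of_ae_restrict_of_subset hsub S.tendsto_fun] with z hz
    refine (Tendsto.liminf_eq ((ENNReal.continuous_ofReal.tendsto _).comp ?_)).symm
    have h5 := ((continuous_trunc κ d).tendsto _).comp hz
    refine Tendsto.mul ((Y.prim_continuous.tendsto _).comp ((h5.mul_const _).div_const ρ)) ?_
    exact ((h5.pow 2).mul_const _).rpow_const (Or.inr hβ)
  calc _ = ∫⁻ z in closedCylinder x₀ t₀ R τ', liminf (fun m => ENNReal.ofReal (γ m z)) atTop :=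
        lintegral_congr_ae hγlim
    _ ≤ liminf (fun m => ∫⁻ z in closedCylinder x₀ t₀ R τ', ENNReal.ofReal (γ m z)) atTop :=
        lintegral_liminf_le fun m => ENNReal.measurable_ofReal.comp (hγc m).measurable
    _ ≤ liminf (fun m => ENNReal.ofReal (c * T m ^ (p / n)
          * ∫ z in closedCylinder x₀ t₀ R τ', σ m z)) atTop :=
        liminf_le_liminf (Eventually.of_forall hm)
    _ = _ := hlim.liminf_eq

end Step

end ParabolicOrlicz

namespace ParabolicOrlicz
open Filter Topology

/-! ### One step of the iteration. -/

section Step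

variable {n : ℕ} {g₀ g₁ ν C₁ : ℝ} {g G : ℝ → ℝ}
variable {u : Euc n × ℝ → ℝ} {Du F : Euc n × ℝ → Euc n}
  {um : ℕ → Euc n × ℝ → ℝ} {Fm : ℕ → Euc n × ℝ → Euc n} {M : Euc n × ℝ → ℝ}
  {Mm : ℕ → Euc n × ℝ → ℝ}

/-- The exponent of `2 / δ` in `excess_mul_le_gainDensity`. -/
noncomputable def gainExp (g₁ β : ℝ) (q : ℕ) : ℝ := g₁ + 2 * β + (q * g₁ + q * β)

/-- Only points with u > κ + d matter. There the truncation s is at least δk/2, and the intrinsic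
relation gives s²/θ = (s/k)² G(k/ρ). Hence both parts of the excess are bounded by (s/k)^(2β)
G(s/ρ), up to powers of 2/δ; further such powers restore the cutoff, which is at least δ^q. -/
theorem excess_mul_le_gainDensity (Y : YoungPair g₀ g₁ g G) (hg0 : 0 ≤ g₁) {p β ρ θ k κ d δ : ℝ}
    (hpg : p ≤ g₀) (hβ : 0 ≤ β) (hpβ : 2 ≤ p + 2 * β) (hρ : 0 < ρ) (hk : 0 < k)
    (hθ : θ = k ^ 2 / G (k / ρ)) (hδ : 0 < δ) (hδ1 : δ ≤ 1) (hdk : δ * k ≤ d) {q : ℕ}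
    {η : Euc n → ℝ} (u : Euc n × ℝ → ℝ) (z : Euc n × ℝ) (hη : δ ^ q ≤ η z.1) :
    excess G ρ θ (κ + d) u z * (k ^ 2) ^ β
      ≤ 2 * (2 / δ) ^ gainExp g₁ β q * gainDensity G ρ κ d β η u z := by
  have hd : 0 < d := (mul_pos hδ hk).trans_le hdk
  have hη0 : 0 < η z.1 := (pow_pos hδ q).trans_le hη
  have hGk : 0 < G (k / ρ) := Y.prim_pos (by positivity)
  have hA0 : 0 < 2 / δ := by positivity
  rcases le_or_gt (u z) (κ + d) with hle | hgt
  · have h0 : max (u z - (κ + d)) 0 = 0 := max_eq_right (by linarith)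
    have : excess G ρ θ (κ + d) u z = 0 := by
      rw [excess, h0, zero_div, Y.prim_zero_of_nonpos 0 le_rfl]; simp
    rw [this, zero_mul]
    refine mul_nonneg (by positivity) (mul_nonneg (Y.prim_nonneg _) ?_)
    exact Real.rpow_nonneg (mul_nonneg (sq_nonneg _) hη0.le) _
  obtain ⟨-, -, -, -, -, -, hbig⟩ := truncation_bounds (κ := κ) hd (u z)
  obtain ⟨hs1, hs2⟩ := hbig hgt
  rw [gainDensity]
  set s := trunc κ d (u z) with hs
  set A := 2 / δ with hA
  set e := η z.1 with he
  have hA1 : 1 ≤ A := by rw [hA, le_div_iff₀ hδ]; linarith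
  have hs0 : 0 < s := by linarith
  have hAs : k ≤ A * s := by
    rw [hA, div_mul_eq_mul_div, le_div_iff₀ hδ]; linarith
  have hAe : 1 ≤ A ^ q * e := by
    have h5 : 1 ≤ A * δ := by rw [hA, div_mul_cancel₀ _ hδ.ne']; norm_num
    calc (1 : ℝ) ≤ (A * δ) ^ q := one_le_pow₀ h5
      _ = A ^ q * δ ^ q := mul_pow _ _ _
      _ ≤ A ^ q * e := by gcongr
  have hex : excess G ρ θ (κ + d) u z ≤ G (s / ρ) + (s / k) ^ 2 * G (k / ρ) := by
    have hm : max (u z - (κ + d)) 0 ≤ s := max_le (by linarith) hs0.le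
    have hm0 : 0 ≤ max (u z - (κ + d)) 0 := le_max_right _ _
    have hθ' : (s / k) ^ 2 * G (k / ρ) = s ^ 2 / θ := by rw [hθ]; field_simp
    rw [hθ']
    have hθ0 : 0 < θ := by rw [hθ]; positivity
    refine add_le_add (Y.prim_monotone (by gcongr)) (by gcongr)
  have hAl : 1 ≤ A * (s / k) := by rw [← mul_div_assoc, le_div_iff₀ hk]; linarith
  have hl0 : 0 < s / k := by positivity
  have h1l : 1 ≤ A ^ (2 * β) * (s / k) ^ (2 * β) := by
    rw [← Real.mul_rpow hA0.le hl0.le]; exact Real.one_le_rpow hAl (by positivity)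
  have hGs : 0 ≤ G (s / ρ) := Y.prim_nonneg _
  have hl2 : 0 ≤ (s / k) ^ (2 * β) := by positivity
  have hAg : 1 ≤ A ^ g₁ := Real.one_le_rpow hA1 hg0
  have t1 : G (s / ρ) ≤ A ^ g₁ * (A ^ (2 * β) * (s / k) ^ (2 * β)) * G (s / ρ) :=
    le_mul_of_one_le_left hGs (one_le_mul_of_one_le_of_one_le hAg h1l)
  -- For s ≥ k, the condition 2 ≤ p + 2β is used together with (s/k)^p G(k/ρ) ≤ G(s/ρ). For s ≤ k
  -- the two are comparable, as k ≤ As.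
  have t2 : (s / k) ^ 2 * G (k / ρ) ≤ A ^ g₁ * (A ^ (2 * β) * (s / k) ^ (2 * β)) * G (s / ρ) := by
    rcases le_total 1 (s / k) with h | h
    · have h5 : k / ρ ≤ s / ρ := by
        have : k ≤ s := by rwa [one_le_div hk] at h
        gcongr
      have h6 := Y.prim_mul_rpow_le hpg (by positivity : 0 < k / ρ) h5
      have h7 : (s / k) ^ p * G (k / ρ) ≤ G (s / ρ) := by
        have h8 : (s / k) ^ p = (s / ρ) ^ p / (k / ρ) ^ p := by
          rw [← Real.div_rpow (by positivity) (by positivity)]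
          congr 1; field_simp
        rw [h8, div_mul_eq_mul_div, div_le_iff₀ (by positivity)]
        linarith
      have h9 : (s / k) ^ 2 ≤ (s / k) ^ (2 * β) * (s / k) ^ p := by
        rw [← Real.rpow_add hl0, ← Real.rpow_natCast]
        exact Real.rpow_le_rpow_of_exponent_le h (by push_cast; linarith)
      have hA2 : 1 ≤ A ^ (2 * β) := Real.one_le_rpow hA1 (by positivity)
      calc (s / k) ^ 2 * G (k / ρ) ≤ (s / k) ^ (2 * β) * (s / k) ^ p * G (k / ρ) := by gcongr
        _ = (s / k) ^ (2 * β) * ((s / k) ^ p * G (k / ρ)) := by ring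
        _ ≤ (s / k) ^ (2 * β) * G (s / ρ) := by gcongr
        _ ≤ A ^ g₁ * A ^ (2 * β) * ((s / k) ^ (2 * β) * G (s / ρ)) :=
            le_mul_of_one_le_left (by positivity) (one_le_mul_of_one_le_of_one_le hAg hA2)
        _ = _ := by ring
    · have h5 : G (k / ρ) ≤ A ^ g₁ * G (s / ρ) := by
        refine (Y.prim_monotone ?_).trans (Y.prim_mul_le hA1)
        rw [← mul_div_assoc]; gcongr
      calc (s / k) ^ 2 * G (k / ρ) ≤ 1 * (A ^ g₁ * G (s / ρ)) := by
            refine mul_le_mul (pow_le_one₀ hl0.le h) h5 hGk.le zero_le_one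
        _ ≤ (A ^ (2 * β) * (s / k) ^ (2 * β)) * (A ^ g₁ * G (s / ρ)) := by gcongr
        _ = _ := by ring
  have hlk : (s / k) ^ (2 * β) * (k ^ 2) ^ β = (s ^ 2) ^ β := by
    rw [Real.rpow_mul hl0.le, Real.rpow_two, ← Real.mul_rpow (by positivity) (by positivity)]
    congr 1; field_simp
  have t3 : (s ^ 2) ^ β ≤ A ^ (q * β) * (s ^ 2 * e) ^ β := by
    rw [Real.rpow_mul hA0.le, Real.rpow_natCast, ← Real.mul_rpow (by positivity) (by positivity)]
    refine Real.rpow_le_rpow (by positivity) ?_ hβ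
    calc s ^ 2 ≤ A ^ q * e * s ^ 2 := le_mul_of_one_le_left (by positivity) hAe
      _ = _ := by ring
  have t4 : G (s / ρ) ≤ A ^ (q * g₁) * G (s * e / ρ) := by
    rw [Real.rpow_mul hA0.le, Real.rpow_natCast]
    refine (Y.prim_monotone ?_).trans (Y.prim_mul_le (one_le_pow₀ hA1))
    calc s / ρ ≤ A ^ q * e * (s / ρ) := le_mul_of_one_le_left (by positivity) hAe
      _ = _ := by ring
  have hGe : 0 ≤ G (s * e / ρ) := Y.prim_nonneg _
  calc excess G ρ θ (κ + d) u z * (k ^ 2) ^ β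
      ≤ (2 * (A ^ g₁ * (A ^ (2 * β) * (s / k) ^ (2 * β)) * G (s / ρ))) * (k ^ 2) ^ β := by
        gcongr; linarith
    _ = 2 * A ^ g₁ * A ^ (2 * β) * ((s / k) ^ (2 * β) * (k ^ 2) ^ β) * G (s / ρ) := by ring
    _ ≤ 2 * A ^ g₁ * A ^ (2 * β) * (A ^ (q * β) * (s ^ 2 * e) ^ β)
        * (A ^ (q * g₁) * G (s * e / ρ)) := by
        rw [hlk]; gcongr
    _ = _ := by
        rw [gainExp, Real.rpow_add hA0, Real.rpow_add hA0, Real.rpow_add hA0]; ring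

/-- The constant of the iteration step. -/
noncomputable def stepConst (g₁ ν C₁ p β : ℝ) (q : ℕ) (CS : NNReal) : ℝ :=
  2 * CS * gradConst g₁ p q * energyConst g₁ ν C₁ q ^ β * (2 * energyConst g₁ ν C₁ q / ν + 1)

/-- One step of the iteration. -/
theorem SmoothApprox.integral_excess_le {x₀ : Euc n} {t₀ ρ θ : ℝ}
    (S : SmoothApprox G (closedCylinder x₀ t₀ ρ θ) u Du F um Fm M Mm)
    {p : ℝ} {CS : NNReal} (hCS : IsSobolevConst n p CS) (hp : 0 < p) (hg0 : 1 ≤ g₀) (hpg : p < g₀)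
    (hpn : 2 ≤ p + 2 * (p / n))
    (Y : YoungPair g₀ g₁ g G) (h1 : 1 ≤ g₁) (hν : 0 < ν) (hν1 : ν ≤ 1)
    (hC₁ : 1 ≤ C₁) {q : ℕ} (hq : 2 ≤ q) (hqg : g₁ ≤ q)
    (hcoer : ∀ z, ν * G ‖Du z‖ ≤ inner ℝ (F z) (Du z)) (hgrow : ∀ z, ‖F z‖ ≤ C₁ * g ‖Du z‖)
    {k r R τ τ' κ d δ : ℝ} (hρ : 0 < ρ) (hk : 0 < k) (hθ : θ = k ^ 2 / G (k / ρ))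
    (hr : 0 ≤ r) (hρR : ρ / 2 ≤ R) (hRρ : R ≤ ρ) (hτ0 : 0 < τ)
    (hτ : τ ≤ θ) (hκ : 0 ≤ κ) (hδ : 0 < δ) (hδ1 : δ ≤ 1) (hτ' : δ * θ ≤ τ - τ')
    (hrR : δ * ρ ≤ R - r) (hdk : δ * k ≤ d) :
    (∫ z in closedCylinder x₀ t₀ r τ', excess G ρ θ (κ + d) u z) * (ρ ^ p * (k ^ 2) ^ (p / n))
      ≤ stepConst g₁ ν C₁ p (p / n) q CS * (2 / δ) ^ (gainExp g₁ (p / n) q + 1 + p / n)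
        * (∫ z in closedCylinder x₀ t₀ R τ, excess G ρ θ κ u z) ^ (1 + p / n) := by
  have hR : 0 < R := by linarith
  have hd : 0 < d := (mul_pos hδ hk).trans_le hdk
  have hGk : 0 < G (k / ρ) := Y.prim_pos (by positivity)
  have hθ0 : 0 < θ := by rw [hθ]; positivity
  have hβ : 0 ≤ p / n := by positivity
  have hττ : τ' ≤ τ := by have := mul_pos hδ hθ0; linarith
  have hrR' : r < R := by have := mul_pos hδ hρ; linarith
  have hKm := measurableSet_closedCylinder x₀ t₀ ρ θ
  have hKr := measurableSet_closedCylinder x₀ t₀ r τ'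
  have hsub : closedCylinder x₀ t₀ r τ' ⊆ closedCylinder x₀ t₀ ρ θ :=
    closedCylinder_mono (hrR'.le.trans hRρ) (hττ.trans hτ)
  have hgain := S.lintegral_gainDensity_le hCS hp hg0 hpg Y h1 hν hν1 hC₁ hq hqg hcoer hgrow hρ hρR
    hRρ hθ0 hτ0 hτ hκ hd hδ hτ'
  have hsob := S.integral_sobolevDensity_le Y h1 hν hν1 hC₁ hq hqg hcoer hgrow hρ hρR
    hRρ hθ0 hτ0 hτ hκ hd hδ hδ1 hτ'
  have hex' := (S.integrableOn_excess (ρ := ρ) Y hKm hθ0 (by linarith : 0 ≤ κ + d)).mono_set hsub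
  set X := ∫ z in closedCylinder x₀ t₀ R τ, excess G ρ θ κ u z with hX
  set X' := ∫ z in closedCylinder x₀ t₀ r τ', excess G ρ θ (κ + d) u z with hX'
  set C := energyConst g₁ ν C₁ q
  set β := p / n with hβdef
  set A := 2 / δ with hA
  have hA0 : 0 < A := by positivity
  have hX0 : 0 ≤ X := integral_nonneg fun z => excess_nonneg Y hθ0 u z
  have hC0 : 0 < C := energyConst_pos (by linarith) hν (by linarith) q
  have hg := gradConst_nonneg (by linarith : 0 ≤ g₁) hp q
  have hpt : ∀ z ∈ closedCylinder x₀ t₀ r τ', excess G ρ θ (κ + d) u z * (k ^ 2) ^ β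
      ≤ 2 * A ^ gainExp g₁ β q * gainDensity G ρ κ d β (cutoff x₀ R q) u z := by
    intro z hz
    refine excess_mul_le_gainDensity Y (by linarith) hpg.le hβ hpn hρ hk hθ hδ hδ1 hdk u z ?_
    refine pow_le_pow_left₀ hδ.le (le_trans ?_ (le_cutoffBase hr hrR' hz.1)) q
    rw [le_div_iff₀ hR]
    exact (mul_le_mul_of_nonneg_left hRρ hδ.le).trans hrR
  set B := CS * (gradConst g₁ p q * ρ ^ (-p)) * (A * (C * X)) ^ β *
    ∫ z in closedCylinder x₀ t₀ R τ', sobolevDensity G ρ κ d (cutoff x₀ R q) u Du z with hB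
  have hB0 : 0 ≤ B := mul_nonneg (by positivity)
    (integral_nonneg fun z => sobolevDensity_nonneg Y hd cutoff_nonneg _ _ z)
  have hreal : X' * (k ^ 2) ^ β ≤ 2 * A ^ gainExp g₁ β q * B := by
    rw [hX', ← integral_mul_const, ← ENNReal.ofReal_le_ofReal_iff (by positivity),
      ofReal_integral_eq_lintegral_ofReal (hex'.mul_const _) (Eventually.of_forall fun z =>
        mul_nonneg (excess_nonneg Y hθ0 u z) (by positivity))]
    calc _ ≤ ∫⁻ z in closedCylinder x₀ t₀ r τ', ENNReal.ofReal (2 * A ^ gainExp g₁ β q)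
          * ENNReal.ofReal (gainDensity G ρ κ d β (cutoff x₀ R q) u z) := by
          refine setLIntegral_mono' hKr fun z hz => ?_
          rw [← ENNReal.ofReal_mul (by positivity)]
          exact ENNReal.ofReal_le_ofReal (hpt z hz)
      _ = ENNReal.ofReal (2 * A ^ gainExp g₁ β q) * ∫⁻ z in closedCylinder x₀ t₀ r τ',
          ENNReal.ofReal (gainDensity G ρ κ d β (cutoff x₀ R q) u z) :=
          lintegral_const_mul' _ _ ENNReal.ofReal_ne_top
      _ ≤ ENNReal.ofReal (2 * A ^ gainExp g₁ β q) * ENNReal.ofReal B := by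
          gcongr
          exact (lintegral_mono_set (closedCylinder_mono hrR'.le le_rfl)).trans hgain
      _ = _ := (ENNReal.ofReal_mul (by positivity)).symm
  -- The slice bound contributes the power β of X and the gradient bound one further power.
  have hB' : B * ρ ^ p ≤ CS * gradConst g₁ p q * (A * (C * X)) ^ β * ((2 * C / ν + 1) * A * X) := by
    have hρp : ρ ^ (-p) * ρ ^ p = 1 := by
      rw [← Real.rpow_add hρ, neg_add_cancel, Real.rpow_zero]
    calc B * ρ ^ p = CS * gradConst g₁ p q * (ρ ^ (-p) * ρ ^ p) * (A * (C * X)) ^ β *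
          ∫ z in closedCylinder x₀ t₀ R τ', sobolevDensity G ρ κ d (cutoff x₀ R q) u Du z := by
          rw [hB]; ring
      _ ≤ CS * gradConst g₁ p q * 1 * (A * (C * X)) ^ β * ((2 * C / ν + 1) / δ * X) := by
          rw [hρp]; gcongr
      _ ≤ CS * gradConst g₁ p q * 1 * (A * (C * X)) ^ β * ((2 * C / ν + 1) * A * X) := by
          have : (2 * C / ν + 1) / δ ≤ (2 * C / ν + 1) * A := by
            have h5 : 1 / δ ≤ A := by rw [hA]; gcongr; norm_num
            calc (2 * C / ν + 1) / δ = (2 * C / ν + 1) * (1 / δ) := by ring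
              _ ≤ _ := by gcongr
          gcongr
      _ = _ := by ring
  calc X' * (ρ ^ p * (k ^ 2) ^ β) = X' * (k ^ 2) ^ β * ρ ^ p := by ring
    _ ≤ 2 * A ^ gainExp g₁ β q * B * ρ ^ p := by gcongr
    _ = 2 * A ^ gainExp g₁ β q * (B * ρ ^ p) := by ring
    _ ≤ 2 * A ^ gainExp g₁ β q * (CS * gradConst g₁ p q * (A * (C * X)) ^ β
          * ((2 * C / ν + 1) * A * X)) := by gcongr
    _ = _ := by
        rw [Real.mul_rpow hA0.le (by positivity), Real.mul_rpow hC0.le hX0, stepConst,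
          Real.rpow_add hA0, Real.rpow_add hA0, Real.rpow_one,
          Real.rpow_add_of_nonneg hX0 zero_le_one hβ, Real.rpow_one]
        ring

end Step

end ParabolicOrlicz

namespace ParabolicOrlicz
open Filter Topology

/-! ### De Giorgi iteration and the smallness constants. -/

section Iteration

variable {n : ℕ} {g₀ g₁ ν C₁ : ℝ} {g G : ℝ → ℝ}
variable {u : Euc n × ℝ → ℝ} {Du F : Euc n × ℝ → Euc n}
  {um : ℕ → Euc n × ℝ → ℝ} {Fm : ℕ → Euc n × ℝ → Euc n} {M : Euc n × ℝ → ℝ}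
  {Mm : ℕ → Euc n × ℝ → ℝ}

theorem excess_anti (Y : YoungPair g₀ g₁ g G) {ρ θ κ κ' : ℝ} (hρ : 0 < ρ) (hθ : 0 < θ)
    (h : κ ≤ κ') (u : Euc n × ℝ → ℝ) (z : Euc n × ℝ) :
    excess G ρ θ κ' u z ≤ excess G ρ θ κ u z := by
  have h1 : max (u z - κ') 0 ≤ max (u z - κ) 0 := max_le_max (by linarith) le_rfl
  have h0 : 0 ≤ max (u z - κ') 0 := le_max_right _ _
  exact add_le_add (Y.prim_monotone (by gcongr)) (by gcongr)

theorem stepConst_nonneg (h1 : 0 < g₁) (hν : 0 < ν) (hC₁ : 0 ≤ C₁) {p β : ℝ} (hp : 0 < p) (q : ℕ)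
    (CS : NNReal) : 0 ≤ stepConst g₁ ν C₁ p β q CS := by
  have h2 := energyConst_pos h1 hν hC₁ q
  have h3 := gradConst_nonneg h1.le hp q
  unfold stepConst
  positivity

/-- The De Giorgi iteration. -/
theorem SmoothApprox.ae_le {x₀ : Euc n} {t₀ ρ θ : ℝ}
    (S : SmoothApprox G (closedCylinder x₀ t₀ ρ θ) u Du F um Fm M Mm) (hn : 0 < n)
    {p : ℝ} {CS : NNReal} (hCS : IsSobolevConst n p CS) (hp : 0 < p) (hg0 : 1 ≤ g₀) (hpg : p < g₀)
    (hpn : 2 ≤ p + 2 * (p / n))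
    (Y : YoungPair g₀ g₁ g G) (h1 : 1 ≤ g₁) (hν : 0 < ν) (hν1 : ν ≤ 1)
    (hC₁ : 1 ≤ C₁) {q : ℕ} (hq : 2 ≤ q) (hqg : g₁ ≤ q)
    (hcoer : ∀ z, ν * G ‖Du z‖ ≤ inner ℝ (F z) (Du z)) (hgrow : ∀ z, ‖F z‖ ≤ C₁ * g ‖Du z‖)
    {k c : ℝ} (hρ : 0 < ρ) (hk : 0 < k) (hθ : θ = k ^ 2 / G (k / ρ)) (hc : 0 < c) (hc1 : c < 1)
    (hbc : 2 ^ (gainExp g₁ (p / n) q + 1 + p / n) * c ^ (p / n) ≤ 1)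
    (h0 : stepConst g₁ ν C₁ p (p / n) q CS * 8 ^ (gainExp g₁ (p / n) q + 1 + p / n)
      * ((∫ z in closedCylinder x₀ t₀ ρ θ, excess G ρ θ 0 u z) / (ρ ^ n * k ^ 2)) ^ (p / n) ≤ c) :
    ∀ᵐ z ∂(volume.restrict (closedCylinder x₀ t₀ (ρ / 2) (θ / 2))), u z ≤ k := by
  have hGk : 0 < G (k / ρ) := Y.prim_pos (by positivity)
  have hθ0 : 0 < θ := by rw [hθ]; positivity
  have hn' : (0 : ℝ) < n := by exact_mod_cast hn
  have hβ : 0 < p / n := by positivity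
  have hKm := measurableSet_closedCylinder x₀ t₀ ρ θ
  set N := gainExp g₁ (p / n) q + 1 + p / n with hN
  set P := stepConst g₁ ν C₁ p (p / n) q CS with hP
  have hP0 : 0 ≤ P := stepConst_nonneg (by linarith) hν (by linarith) hp q CS
  -- Radii and heights decrease from ρ, θ to their halves, and levels increase from 0 to k, all at
  -- the rate 2^(-j).
  set h : ℕ → ℝ := fun j => (1 / 2) ^ j with hh
  have hpos : ∀ j, 0 < h j := fun j => by positivity
  have hle1 : ∀ j, h j ≤ 1 := fun j => pow_le_one₀ (by norm_num) (by norm_num)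
  have hmul : ∀ {a : ℝ}, 0 < a → ∀ j, 0 < a * h j ∧ a * h j ≤ a := fun ha j =>
    ⟨mul_pos ha (hpos j), mul_le_of_le_one_right ha.le (hle1 j)⟩
  have hsucc : ∀ j, h (j + 1) = h j / 2 := fun j => by simp only [hh, pow_succ]; ring
  set X : ℕ → ℝ := fun j => ∫ z in closedCylinder x₀ t₀ (ρ / 2 * (1 + h j)) (θ / 2 * (1 + h j)),
    excess G ρ θ (k * (1 - h j)) u z with hX
  have hX0 : ∀ j, 0 ≤ X j := fun j => integral_nonneg fun z => excess_nonneg Y hθ0 u z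
  set D := ρ ^ n * k ^ 2 with hD
  have hD0 : 0 < D := by positivity
  -- Dividing X by ρⁿk² makes the recursion dimensionless, so its constants depend only on the data.
  have hDβ : D ^ (p / n) = ρ ^ p * (k ^ 2) ^ (p / n) := by
    rw [hD, Real.mul_rpow (by positivity) (by positivity), ← Real.rpow_natCast ρ n,
      ← Real.rpow_mul hρ.le, mul_div_cancel₀ _ hn'.ne']
  have hstep : ∀ j, X (j + 1) / D ≤ P * 8 ^ N * (2 ^ N) ^ j * (X j / D) ^ (1 + p / n) := by
    intro j
    have hj := hpos j
    have hj1 := hle1 j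
    obtain ⟨r1, r2⟩ := hmul hρ j
    obtain ⟨s1, s2⟩ := hmul hθ0 j
    obtain ⟨k1, k2⟩ := hmul hk j
    -- The gap δ = 2^(-j)/4 is exactly the relative decrease of radius and height; the level rises
    -- by twice as much.
    have hδ2 : 2 / (h j / 4) = 8 * 2 ^ j := by
      rw [hh]; simp only [one_div, inv_pow]; field_simp; norm_num
    have hs := S.integral_excess_le (r := ρ / 2 * (1 + h (j + 1))) (R := ρ / 2 * (1 + h j))
      (τ := θ / 2 * (1 + h j)) (τ' := θ / 2 * (1 + h (j + 1))) (κ := k * (1 - h j))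
      (d := k * (h j / 2)) (δ := h j / 4) hCS hp hg0 hpg hpn Y h1 hν hν1 hC₁ hq hqg hcoer hgrow
      hρ hk hθ (by have := hpos (j + 1); positivity) (by linarith) (by linarith) (by positivity)
      (by linarith) (mul_nonneg hk.le (by linarith)) (by positivity) (by linarith)
      (by rw [hsucc]; linarith) (by rw [hsucc]; linarith) (by linarith)
    rw [show k * (1 - h j) + k * (h j / 2) = k * (1 - h (j + 1)) by rw [hsucc]; ring, ← hDβ,
      hδ2] at hs
    change X (j + 1) * D ^ (p / n) ≤ P * (8 * 2 ^ j) ^ N * X j ^ (1 + p / n) at hs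
    have hpow : (8 * 2 ^ j : ℝ) ^ N = 8 ^ N * (2 ^ N) ^ j := by
      rw [Real.mul_rpow (by norm_num) (by positivity), ← Real.rpow_natCast 2 j,
        ← Real.rpow_mul (by norm_num), mul_comm (j : ℝ) N, Real.rpow_mul (by norm_num),
        Real.rpow_natCast]
    rw [hpow] at hs
    rw [Real.div_rpow (hX0 j) hD0.le, Real.rpow_add hD0, Real.rpow_one, ← mul_div_assoc,
      div_le_div_iff₀ hD0 (by positivity)]
    calc X (j + 1) * (D * D ^ (p / n)) = X (j + 1) * D ^ (p / n) * D := by ring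
      _ ≤ P * (8 ^ N * (2 ^ N) ^ j) * X j ^ (1 + p / n) * D := by gcongr
      _ = _ := by ring
  have hlim : Tendsto (fun j => X j / D) atTop (𝓝 0) := by
    refine tendsto_zero_of_fast_decay (fun j => div_nonneg (hX0 j) hD0.le)
      (by positivity : 0 ≤ P * 8 ^ N) (by positivity) hc hc1 hβ hbc ?_ hstep
    have e1 : ρ / 2 * (1 + h 0) = ρ := by simp only [hh, pow_zero]; ring
    have e2 : θ / 2 * (1 + h 0) = θ := by simp only [hh, pow_zero]; ring
    have e3 : k * (1 - h 0) = 0 := by simp only [hh, pow_zero]; ring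
    have e4 : X 0 = ∫ z in closedCylinder x₀ t₀ ρ θ, excess G ρ θ 0 u z := by
      simp only [hX, e1, e2, e3]
    rw [e4]
    exact h0
  have hlimX : Tendsto X atTop (𝓝 0) := by
    have := hlim.mul_const D
    simpa [div_mul_cancel₀ _ hD0.ne'] using this
  have hsub : closedCylinder x₀ t₀ (ρ / 2) (θ / 2) ⊆ closedCylinder x₀ t₀ ρ θ :=
    closedCylinder_mono (by linarith) (by linarith)
  have hint := (S.integrableOn_excess (ρ := ρ) Y hKm hθ0 hk.le).mono_set hsub
  -- The excess decreases in the level and all cylinders contain the limiting one, so this integral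
  -- is below every Xⱼ.
  have hI : ∫ z in closedCylinder x₀ t₀ (ρ / 2) (θ / 2), excess G ρ θ k u z = 0 := by
    refine le_antisymm (ge_of_tendsto' hlimX fun j => ?_)
      (integral_nonneg fun z => excess_nonneg Y hθ0 u z)
    have hj := hpos j
    have hj1 := hle1 j
    obtain ⟨r1, r2⟩ := hmul hρ j
    obtain ⟨s1, s2⟩ := hmul hθ0 j
    obtain ⟨k1, k2⟩ := hmul hk j
    have i1 := S.integrableOn_excess (ρ := ρ) Y hKm hθ0 (κ := k * (1 - h j))
      (mul_nonneg hk.le (by linarith))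
    calc _ ≤ ∫ z in closedCylinder x₀ t₀ (ρ / 2) (θ / 2), excess G ρ θ (k * (1 - h j)) u z :=
          integral_mono hint (i1.mono_set hsub) fun z => excess_anti Y hρ hθ0 (by linarith) u z
      _ ≤ X j := by
          refine setIntegral_mono_set (i1.mono_set (closedCylinder_mono (by linarith)
            (by linarith))) (Eventually.of_forall fun z => excess_nonneg Y hθ0 u z)
            (closedCylinder_mono (by linarith) (by linarith)).eventuallyLE
  rw [integral_eq_zero_iff_of_nonneg (fun z => excess_nonneg Y hθ0 u z) hint] at hI
  filter_upwards [hI] with z hz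
  have h5 : max (u z - k) 0 ^ 2 / θ ≤ 0 :=
    (le_add_of_nonneg_left (Y.prim_nonneg _)).trans hz.le
  by_contra hlt
  have h6 : 0 < max (u z - k) 0 := lt_max_of_lt_left (by linarith [not_le.1 hlt])
  have : 0 < max (u z - k) 0 ^ 2 / θ := by positivity
  linarith

theorem cylinder_ae_eq_closedCylinder (x₀ : Euc n) (t₀ : ℝ) {ρ : ℝ} (hρ : 0 < ρ) (θ : ℝ) :
    cylinder x₀ t₀ ρ θ =ᵐ[volume] closedCylinder x₀ t₀ ρ θ := by
  refine Measure.set_prod_ae_eq ?_ Ioo_ae_eq_Icc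
  refine ae_eq_of_subset_of_measure_ge Metric.ball_subset_closedBall ?_
    measurableSet_ball.nullMeasurableSet measure_closedBall_lt_top.ne
  rw [Measure.addHaar_closedBall _ _ hρ.le, Measure.addHaar_ball_of_pos _ _ hρ]

theorem volume_real_cylinder (x₀ : Euc n) (t₀ : ℝ) {ρ θ : ℝ} (hρ : 0 < ρ) (hθ : 0 ≤ θ) :
    volume.real (cylinder x₀ t₀ ρ θ)
      = ρ ^ n * (volume : Measure (Euc n)).real (Metric.ball 0 1) * θ := by
  have h : (volume : Measure (Euc n × ℝ)) = (volume : Measure (Euc n)).prod volume := rfl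
  rw [cylinder, h, measureReal_prod_prod, measureReal_def, Measure.addHaar_ball_of_pos _ _ hρ,
    finrank_euclideanSpace_fin, ENNReal.toReal_mul, ENNReal.toReal_ofReal (by positivity),
    Real.volume_real_Ioo, sub_sub_cancel, max_eq_left hθ, measureReal_def]

/-- At level 0 nonnegativity of u removes the positive part, and the boundary of the cylinder is a
null set. -/
theorem integral_excess_zero_eq {g : ℝ → ℝ} {x₀ : Euc n} {t₀ ρ θ : ℝ} (hρ : 0 < ρ)
    (hθ : 0 < θ)
    (hu : ∀ᵐ z ∂(volume.restrict (cylinder x₀ t₀ ρ θ)), 0 ≤ u z) :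
    ∫ z in closedCylinder x₀ t₀ ρ θ, excess (primitive (extZero g)) ρ θ 0 u z
      = ρ ^ n * (volume : Measure (Euc n)).real (Metric.ball 0 1) * θ
        * ⨍ z in cylinder x₀ t₀ ρ θ, (primitive g (u z / ρ) + u z ^ 2 / θ) := by
  have hω : 0 < (volume : Measure (Euc n)).real (Metric.ball 0 1) :=
    ENNReal.toReal_pos (Metric.measure_ball_pos _ _ one_pos).ne' measure_ball_lt_top.ne
  rw [setAverage_eq, volume_real_cylinder x₀ t₀ hρ hθ.le, smul_eq_mul,
    mul_inv_cancel_left₀ (by positivity),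
    ← setIntegral_congr_set (cylinder_ae_eq_closedCylinder x₀ t₀ hρ θ)]
  refine integral_congr_ae ?_
  filter_upwards [hu] with z hz
  rw [excess, sub_zero, max_eq_left hz, primitive_extZero (by positivity)]

theorem exists_pos_mul_rpow_le {C w c β : ℝ} (hC : 0 ≤ C) (hw : 0 < w) (hc : 0 < c) (hβ : 0 < β) :
    ∃ σ : ℝ, 0 < σ ∧ σ < 1 ∧ C * (w * σ) ^ β ≤ c := by
  -- Here C + 1 replaces C because C may vanish; the 1/2 keeps the witness below 1.
  refine ⟨min (1 / 2) ((c / (C + 1)) ^ (1 / β) / w), lt_min (by norm_num) (by positivity),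
    (min_le_left _ _).trans_lt (by norm_num), ?_⟩
  set σ := min (1 / 2) ((c / (C + 1)) ^ (1 / β) / w)
  have hσ0 : 0 ≤ σ := le_min (by norm_num) (by positivity)
  have h1 : w * σ ≤ (c / (C + 1)) ^ (1 / β) := by
    rw [mul_comm, ← le_div_iff₀ hw]; exact min_le_right _ _
  have h2 : (w * σ) ^ β ≤ c / (C + 1) := by
    calc (w * σ) ^ β ≤ ((c / (C + 1)) ^ (1 / β)) ^ β :=
          Real.rpow_le_rpow (by positivity) h1 hβ.le
      _ = c / (C + 1) := by
          rw [← Real.rpow_mul (by positivity), one_div_mul_cancel hβ.ne', Real.rpow_one]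
  calc C * (w * σ) ^ β ≤ C * (c / (C + 1)) := by gcongr
    _ = c * (C / (C + 1)) := by ring
    _ ≤ c * 1 := by gcongr; rw [div_le_one (by positivity)]; linarith
    _ = c := mul_one c

theorem exists_lt_one_mul_rpow_le {b β : ℝ} (hb : 0 < b) (hβ : 0 < β) :
    ∃ c : ℝ, 0 < c ∧ c < 1 ∧ b * c ^ β ≤ 1 := by
  obtain ⟨c, h1, h2, h3⟩ := exists_pos_mul_rpow_le hb.le one_pos one_pos hβ
  exact ⟨c, h1, h2, by rwa [one_mul] at h3⟩

end Iteration

end ParabolicOrlicz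

/-! ### Choice of exponents and conclusion. -/

open ParabolicOrlicz in
theorem mainTheorem5 (n : ℕ) (hn : 2 ≤ n) (g₀ g₁ ν L : ℝ)
    (hg₀ : 2 * (n : ℝ) / ((n : ℝ) + 2) < g₀) (hg₁ : g₀ ≤ g₁)
    (hν : 0 < ν) (hν1 : ν ≤ 1) (hL : 1 ≤ L) :
    ∃ σ : ℝ, 0 < σ ∧ σ < 1 ∧
      ∀ (g : ℝ → ℝ) (A : EuclideanSpace ℝ (Fin n) → EuclideanSpace ℝ (Fin n))
        (Ω : Set (EuclideanSpace ℝ (Fin n))) (T : ℝ)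
        (u : EuclideanSpace ℝ (Fin n) × ℝ → ℝ)
        (x₀ : EuclideanSpace ℝ (Fin n)) (t₀ k ρ θ : ℝ),
        ParabolicOrlicz.OrliczCondition g₀ g₁ g →
        ParabolicOrlicz.StructureCondition ν L g A →
        IsOpen Ω → IsConnected Ω → Bornology.IsBounded Ω → 0 < T →
        ParabolicOrlicz.IsWeakSubsolution g A Ω T u →
        (∀ᵐ z ∂(volume.restrict (Ω ×ˢ Ioo 0 T)), 0 ≤ u z) →
        (x₀, t₀) ∈ Ω ×ˢ Ioo 0 T →
        0 < k → 0 < ρ → 0 < θ →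
        closure (Metric.ball x₀ ρ) ⊆ Ω → 0 < t₀ - θ →
        θ = k ^ 2 / ParabolicOrlicz.primitive g (k / ρ) →
        (⨍ z in ParabolicOrlicz.cylinder x₀ t₀ ρ θ,
          (ParabolicOrlicz.primitive g (u z / ρ) + u z ^ 2 / θ))
            ≤ σ * ParabolicOrlicz.primitive g (k / ρ) →
        essSup (fun z => (u z : EReal))
          (volume.restrict (ParabolicOrlicz.cylinder x₀ t₀ (ρ / 2) (θ / 2))) ≤ (k : EReal) := by
  have hn' : (2 : ℝ) ≤ n := by exact_mod_cast hn
  have hn0 : 0 < n := by omega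
  have hcrit1 : 1 ≤ 2 * (n : ℝ) / (n + 2) := by rw [le_div_iff₀ (by positivity)]; linarith
  have hcrit2 : 2 * (n : ℝ) / (n + 2) < 2 := by rw [div_lt_iff₀ (by positivity)]; linarith
  -- The lower bound gives p ≥ 1 and p + 2p/n ≥ 2; the upper bounds give p < g₀ and p < n.
  obtain ⟨p, hpcrit, hpmin⟩ := exists_between (lt_min hg₀ hcrit2)
  have hpg : p < g₀ := hpmin.trans_le (min_le_left _ _)
  have hp2 : p < 2 := hpmin.trans_le (min_le_right _ _)
  have hp1 : 1 ≤ p := by linarith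
  have hp : 0 < p := by linarith
  have h1 : 1 < g₀ := by linarith
  have hpn : 2 ≤ p + 2 * (p / n) := by
    rw [div_lt_iff₀ (by positivity)] at hpcrit
    have : p + 2 * (p / n) = p * (n + 2) / n := by field_simp
    rw [this, le_div_iff₀ (by positivity)]
    linarith
  obtain ⟨CS, hCS⟩ := exists_sobolev_const hp1 (hp2.trans_le hn')
  -- At least 2 for a C¹ cutoff, at least g₁ for the absorption of the cutoff term.
  set q : ℕ := max 2 ⌈g₁⌉₊ with hq
  have hq2 : 2 ≤ q := le_max_left _ _
  have hqg : g₁ ≤ q := (Nat.le_ceil g₁).trans (by exact_mod_cast le_max_right _ _)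
  set C₁ : ℝ := max 1 (L / (g₀ - 1)) with hC₁
  have hC₁1 : 1 ≤ C₁ := le_max_left _ _
  have hβ : 0 < p / n := by positivity
  have hω : 0 < (volume : Measure (Euc n)).real (Metric.ball 0 1) :=
    ENNReal.toReal_pos (Metric.measure_ball_pos _ _ one_pos).ne' measure_ball_lt_top.ne
  obtain ⟨c, hc, hc1, hbc⟩ := exists_lt_one_mul_rpow_le
    (b := 2 ^ (gainExp g₁ (p / n) q + 1 + p / n)) (by positivity) hβ
  have hP0 : 0 ≤ stepConst g₁ ν C₁ p (p / n) q CS :=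
    stepConst_nonneg (by linarith) hν (by linarith) hp q CS
  -- The constant is fixed before g, 𝒜, Ω and u are introduced. The factor w is the volume of the
  -- unit ball, which enters through the average.
  obtain ⟨σ, hσ, hσ1, hσc⟩ := exists_pos_mul_rpow_le
    (C := stepConst g₁ ν C₁ p (p / n) q CS * 8 ^ (gainExp g₁ (p / n) q + 1 + p / n))
    (by positivity) hω hc hβ
  refine ⟨σ, hσ, hσ1, ?_⟩
  intro g A Ω T u x₀ t₀ k ρ θ hg hA hΩ _ _ _ hsub hu hx₀ hk hρ hθ0 hball ht₀ hθ havg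
  obtain ⟨Du, hV, hweak⟩ := hsub
  have Y := hg.youngPair h1
  have hball' : Metric.closedBall x₀ ρ ⊆ Ω := by rwa [closure_ball x₀ hρ.ne'] at hball
  obtain ⟨um, Fm, M, Mm, S⟩ := exists_smoothApprox h1 hg₁ (by linarith) hg hA hΩ hV hweak
    (isCompact_closedBall x₀ ρ) hball' ht₀ (by linarith : t₀ - θ ≤ t₀) hx₀.2.2
  have hθ' : θ = k ^ 2 / primitive (extZero g) (k / ρ) := by
    rw [primitive_extZero (by positivity)]; exact hθ
  have hG : 0 < primitive g (k / ρ) := by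
    rw [← primitive_extZero (by positivity)]; exact Y.prim_pos (by positivity)
  have hgrow : ∀ z, ‖A (Du z) - A 0‖ ≤ C₁ * extZero g ‖Du z‖ := fun z =>
    (hA.norm_sub_le Y (by linarith) h1 (Du z)).trans
      (mul_le_mul_of_nonneg_right (le_max_right _ _) (Y.nonneg _))
  have hcyl : cylinder x₀ t₀ ρ θ ⊆ Ω ×ˢ Ioo 0 T :=
    prod_mono (Metric.ball_subset_closedBall.trans hball') (Ioo_subset_Ioo ht₀.le hx₀.2.2.le)
  have hX := integral_excess_zero_eq (g := g) hρ hθ0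
    (ae_restrict_of_ae_restrict_of_subset hcyl hu)
  -- The relation θ G(k/ρ) = k² cancels k and ρ from the normalized initial excess.
  have hXle : (∫ z in closedCylinder x₀ t₀ ρ θ, excess (primitive (extZero g)) ρ θ 0 u z)
      / (ρ ^ n * k ^ 2) ≤ (volume : Measure (Euc n)).real (Metric.ball 0 1) * σ := by
    rw [hX, div_le_iff₀ (by positivity)]
    calc _ ≤ ρ ^ n * (volume : Measure (Euc n)).real (Metric.ball 0 1) * θ
          * (σ * primitive g (k / ρ)) := mul_le_mul_of_nonneg_left havg (by positivity)
      _ = _ := by rw [hθ]; field_simp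
  have hae := SmoothApprox.ae_le (x₀ := x₀) (t₀ := t₀) S hn0 hCS hp h1.le hpg hpn Y (by linarith)
    hν hν1 hC₁1 hq2 hqg (fun z => hA.coercive Y hν.le (Du z)) hgrow hρ hk hθ' hc hc1 hbc
    (le_trans (mul_le_mul_of_nonneg_left (Real.rpow_le_rpow (div_nonneg
      (integral_nonneg fun z => excess_nonneg Y hθ0 u z) (by positivity)) hXle hβ.le)
      (by positivity)) hσc)
  refine essSup_le_of_ae_le _ ?_
  have hsub : cylinder x₀ t₀ (ρ / 2) (θ / 2) ⊆ closedCylinder x₀ t₀ (ρ / 2) (θ / 2) :=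
    prod_mono Metric.ball_subset_closedBall Ioo_subset_Icc_self
  filter_upwards [ae_restrict_of_ae_restrict_of_subset hsub hae] with z hz
  exact EReal.coe_le_coe_iff.2 hz
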